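/- **Setting.** Let $\mathfrak g$ be a finite-dimensional complex semisimple Lie algebra with Cartan subalgebra $\mathfrak h$, $\operatorname{rank}(\mathfrak g)=\dim\mathfrak h>1$, with simple roots $\{\alpha_i\}_{i\in\mathbf I}$ and positive roots $\Phi_+$, and put $\mathsf Q_+=\mathbb Z_{\ge 0}\Phi_+$. Let $(\cdot,\cdot)$ be an invariant symmetric non-degenerate bilinear form on $\mathfrak g$, normalised so that short roots (in each irreducible component) have square length $2$; let $\nu:\mathfrak h\to\mathfrak h^*$ be the induced isomorphism, $d_i=(\alpha_i,\alpha_i)/2$, $a_{ij}=2(\alpha_i,\alpha_j)/(\alpha_i,\alpha_i)$, $d_ih_i=\nu^{-1}(\alpha_i)$, and choose $x_i^\pm\in\mathfrak g_{\pm\alpha_i}$ with $[x_i^+,x_i^-]=d_ih_i$. Let $\hbar\in\mathbb C^\times$. The Yangian $Y=Y_\hbar(\mathfrak g)$ is the unital associative $\mathbb C$-algebra generated by $x^\pm_{i,r},\xi_{i,r}$ ($i\in\mathbf I$, $r\in\mathbb Z_{\ge 0}$) subject to the relations, for all $i,j\in\mathbf I$ and $r,s\ge 0$, $$[\xi_{i,r},\xi_{j,s}]=0,\qquad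 [\xi_{i,0},x^\pm_{j,s}]=\pm d_ia_{ij}x^\pm_{j,s},\qquad [x^+_{i,r},x^-_{j,s}]=\delta_{ij}\xi_{i,r+s},$$ $$[\xi_{i,r+1},x^\pm_{j,s}]-[\xi_{i,r},x^\pm_{j,s+1}]=\pm\hbar\tfrac{d_ia_{ij}}2(\xi_{i,r}x^\pm_{j,s}+x^\pm_{j,s}\xi_{i,r}),$$ $$[x^\pm_{i,r+1},x^\pm_{j,s}]-[x^\pm_{i,r},x^\pm_{j,s+1}]=\pm\hbar\tfrac{d_ia_{ij}}2(x^\pm_{i,r}x^\pm_{j,s}+x^\pm_{j,s}x^\pm_{i,r}),$$ and, for $i\ne j$, $m=1-a_{ij}$ and $r_1,\dots,r_m,s\ge 0$, $\sum_{\pi\in\mathfrak S_m}[x^\pm_{i,r_{\pi(1)}},[x^\pm_{i,r_{\pi(2)}},[\cdots,[x^\pm_{i,r_{\pi(m)}},x^\pm_{j,s}]\cdots]]]=0$. Identify $\mathfrak g$ with a Lie subalgebra of $Y$ by $x_i^\pm\mapsto x^\pm_{i,0}$, $d_ih_i\mapsto\xi_{i,0}$, and let $Y_\beta=\{y\in Y:[h,y]=\beta(h)y\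 \ \forall h\in\mathfrak h\}$. Let $Y^{\ge}$ (resp. $Y^{\le}$) be the subalgebra generated by all $\xi_{i,r}$ and $x^+_{i,r}$ (resp. $x^-_{i,r}$), and write $Y^{\ge}_\beta=Y^{\ge}\cap Y_\beta$, $Y^{\le}_\beta=Y^{\le}\cap Y_\beta$. Let $\operatorname T:\mathfrak h\to Y$ be the linear map with $\operatorname T(d_ih_i)=\xi_{i,1}-\frac\hbar2\xi_{i,0}^2$. For $\beta\in\Phi_+$ let $x^\pm_{\beta,0}\in\mathfrak g_{\pm\beta}\subset Y$ be root vectors with $(x^-_{\beta,0},x^+_{\beta,0})=1$, and put $\mathsf r^-=\hbar\sum_{\beta\in\Phi_+}x^-_{\beta,0}\otimes x^+_{\beta,0}$ and $\mathsf r^-(h)=[h\otimes 1,\mathsf r^-]$ for $h\in\mathfrak h$. The lower triangular factor $\mathcal R^-(s)$ of the universal $R$-matrix is the weight zero element $\mathcal R^-(s)=\sum_{\gamma\in\mathsf Q_+}\mathcal R^-_\gamma(s)$ of $(Y^{\le}\otimes Y^{\ge})[\![s^{-1}]\!]$, with $\mathcal R^-_\gamma(s)\in(Y^{\le}_{-\gamma}\otimes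 Y^{\ge}_\gamma)[\![s^{-1}]\!]$, which is characterised by $\mathcal R^-_0(s)=1\otimes 1$ and $$[\operatorname T(h)\otimes 1+1\otimes\operatorname T(h)+s\,h\otimes 1,\ \mathcal R^-(s)]=\mathcal R^-(s)\,\mathsf r^-(h)\qquad\text{for all }h\in\mathfrak h.$$ A weight zero element $\mathcal J(s)=\sum_{\gamma\in\mathsf Q_+}\mathcal J_\gamma(s)$ of $(Y^{\le}\otimes Y^{\ge})[\![s^{-1}]\!]$, with $\mathcal J_\gamma(s)\in(Y^{\le}_{-\gamma}\otimes Y^{\ge}_\gamma)[\![s^{-1}]\!]$, has $\mathbb Z\alpha$-*support* ($\alpha\in\Phi_+$) if $\mathcal J_\gamma(s)=0$ for $\gamma\notin\mathbb Z\alpha$ and $\mathcal J_0(s)=1\otimes 1$. **Theorem.** Let $\prec$ be a total order on $\Phi_+$ for which there are simple roots $\alpha_i,\alpha_j$ such that $\alpha_i+\alpha_j\in\Phi_+$, $\alpha_i+\ell\alpha_j\notin\Phi_+$ for every $\ell\ge 2$, and $\alpha_i\prec\alpha_i+\alpha_j\prec\alpha_j$. 1. Let $F^{(\alpha)}_n(s)\in(Y^{\le}_{-n\alpha}\otimes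 Y^{\ge}_{n\alpha})[\![s^{-1}]\!]$ ($\alpha\in\Phi_+$, $n\in\mathbb Z_{\ge 0}$) be arbitrary elements with $F^{(\alpha)}_0(s)=1\otimes 1$, and for $\gamma\in\mathsf Q_+$ let $$F_\gamma(s)=\sum_{\underline k}\ \prod^{\prec}_{\alpha\in\Phi_+}F^{(\alpha)}_{k_\alpha}(s),$$ where the sum is over all $\underline k\in\mathbb Z_{\ge 0}^{\Phi_+}$ with $\sum_\alpha k_\alpha\alpha=\gamma$ and the product is taken in increasing order with respect to $\prec$. Then the family $\{F_\gamma(s)\}_{\gamma\in\mathsf Q_+}$ does not satisfy the system of equations $$[\operatorname T(h)\otimes 1+1\otimes\operatorname T(h)+s\,h\otimes 1,\ F_\gamma(s)]=-\hbar\sum_{\substack{\alpha\in\Phi_+\\ \gamma-\alpha\in\mathsf Q_+}}\alpha(h)\,F_{\gamma-\alpha}(s)\,(x^-_{\alpha,0}\otimes x^+_{\alpha,0})\qquad(h\in\mathfrak h,\ \gamma\in\mathsf Q_+).$$ 2. Consequently, $\mathcal R^-(s)$ does not admit a factorization $\mathcal R^-(s)=\prod^{\prec}_{\alpha\in\Phi_+}\mathcal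 J^{(\alpha)}(s)$ in which each $\mathcal J^{(\alpha)}(s)$ is a weight zero element of $(Y^{\le}\otimes Y^{\ge})[\![s^{-1}]\!]$ with $\mathbb Z\alpha$-support. -/

import Mathlib

open scoped TensorProduct

noncomputable section

/-! ### The Yangian of a symmetrised Cartan matrix -/

/-- The generators `x^±_{i,r}` and `ξ_{i,r}` of the Yangian; the sign is a unit of `ℤ`. -/
inductive YangianGen (I : Type*)
  | x (ε : ℤˣ) (i : I) (r : ℕ)
  | xi (i : I) (r : ℕ)

namespace YangianGen

/-- The free generator `x^ε_{i,r}`. -/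
def fx {I : Type*} (ε : ℤˣ) (i : I) (r : ℕ) : FreeAlgebra ℂ (YangianGen I) :=
  FreeAlgebra.ι ℂ (YangianGen.x ε i r)

/-- The free generator `ξ_{i,r}`. -/
def fxi {I : Type*} (i : I) (r : ℕ) : FreeAlgebra ℂ (YangianGen I) :=
  FreeAlgebra.ι ℂ (YangianGen.xi i r)

end YangianGen

open YangianGen in
/-- The defining relations of the Yangian with Cartan matrix `A = (a_{ij})`,
symmetrising numbers `d_i` and parameter `ħ`. -/
inductive YangianRel {I : Type*} (A : Matrix I I ℤ) (d : I → ℂ) (ħ : ℂ) :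
    FreeAlgebra ℂ (YangianGen I) → FreeAlgebra ℂ (YangianGen I) → Prop
  | Y1 (i j : I) (r s : ℕ) : YangianRel A d ħ ⁅fxi i r, fxi j s⁆ 0
  | Y2 (ε : ℤˣ) (i j : I) (s : ℕ) :
      YangianRel A d ħ ⁅fxi i 0, fx ε j s⁆ ((((ε : ℤ) : ℂ) * (d i * (A i j : ℂ))) • fx ε j s)
  | Y3 (ε : ℤˣ) (i j : I) (r s : ℕ) :
      YangianRel A d ħ (⁅fxi i (r + 1), fx ε j s⁆ - ⁅fxi i r, fx ε j (s + 1)⁆)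
        ((((ε : ℤ) : ℂ) * ħ * (d i * (A i j : ℂ) / 2)) •
          (fxi i r * fx ε j s + fx ε j s * fxi i r))
  | Y4 (ε : ℤˣ) (i j : I) (r s : ℕ) :
      YangianRel A d ħ (⁅fx ε i (r + 1), fx ε j s⁆ - ⁅fx ε i r, fx ε j (s + 1)⁆)
        ((((ε : ℤ) : ℂ) * ħ * (d i * (A i j : ℂ) / 2)) •
          (fx ε i r * fx ε j s + fx ε j s * fx ε i r))
  | Y5_same (i : I) (r s : ℕ) : YangianRel A d ħ ⁅fx 1 i r, fx (-1) i s⁆ (fxi i (r + s))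
  | Y5_ne (i j : I) (hij : i ≠ j) (r s : ℕ) : YangianRel A d ħ ⁅fx 1 i r, fx (-1) j s⁆ 0
  | Y6 (ε : ℤˣ) (i j : I) (hij : i ≠ j) (r : Fin (1 - A i j).toNat → ℕ) (s : ℕ) :
      YangianRel A d ħ
        (∑ π : Equiv.Perm (Fin (1 - A i j).toNat),
          (List.ofFn fun k => r (π k)).foldr (fun t y => ⁅fx ε i t, y⁆) (fx ε j s)) 0

/-- The Yangian with Cartan matrix `A`, symmetrising numbers `d` and parameter `ħ`: the unital
associative `ℂ`-algebra given by generators and relations. -/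
def Yangian {I : Type*} (A : Matrix I I ℤ) (d : I → ℂ) (ħ : ℂ) : Type _ :=
  RingQuot (YangianRel A d ħ)

namespace Yangian

variable {I : Type*} (A : Matrix I I ℤ) (d : I → ℂ) (ħ : ℂ)

instance : Ring (Yangian A d ħ) := inferInstanceAs (Ring (RingQuot (YangianRel A d ħ)))

instance : Algebra ℂ (Yangian A d ħ) :=
  inferInstanceAs (Algebra ℂ (RingQuot (YangianRel A d ħ)))

/-- The quotient map from the free algebra. -/
def mk : FreeAlgebra ℂ (YangianGen I) →ₐ[ℂ] Yangian A d ħ :=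
  RingQuot.mkAlgHom ℂ (YangianRel A d ħ)

/-- The generator `x^ε_{i,r}` of the Yangian. -/
def x (ε : ℤˣ) (i : I) (r : ℕ) : Yangian A d ħ :=
  mk A d ħ (YangianGen.fx ε i r)

/-- The generator `ξ_{i,r}` of the Yangian. -/
def xi (i : I) (r : ℕ) : Yangian A d ħ :=
  mk A d ħ (YangianGen.fxi i r)

/-- `t_{i,1} = ξ_{i,1} - (ħ/2) ξ_{i,0}²`. -/
def t1 (i : I) : Yangian A d ħ := xi A d ħ i 1 - (ħ / 2) • (xi A d ħ i 0) ^ 2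

/-- The subalgebra generated by all `ξ_{i,r}`. -/
def zero : Subalgebra ℂ (Yangian A d ħ) :=
  Algebra.adjoin ℂ {y | ∃ i r, y = xi A d ħ i r}

/-- The subalgebra generated by all `x^ε_{i,r}`. -/
def nil (ε : ℤˣ) : Subalgebra ℂ (Yangian A d ħ) :=
  Algebra.adjoin ℂ {y | ∃ i r, y = x A d ħ ε i r}

/-- The subalgebra `Y^≥`, generated by `Y^0` and `Y^+`. -/
def ge : Subalgebra ℂ (Yangian A d ħ) := zero A d ħ ⊔ nil A d ħ 1

/-- The subalgebra `Y^≤`, generated by `Y^0` and `Y^-`. -/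
def le : Subalgebra ℂ (Yangian A d ħ) := zero A d ħ ⊔ nil A d ħ (-1)

end Yangian

/-! ### Invariant forms on a semisimple Lie algebra -/

/-- An invariant symmetric non-degenerate bilinear form on a Lie algebra. -/
structure InvForm (L : Type*) [LieRing L] [LieAlgebra ℂ L] where
  /-- the underlying bilinear form -/
  form : LinearMap.BilinForm ℂ L
  symm : ∀ x y, form x y = form y x
  invariant : ∀ x y z, form ⁅x, y⁆ z = form x ⁅y, z⁆
  nondegenerate : ∀ x, (∀ y, form x y = 0) → x = 0

open LieAlgebra LieAlgebra.IsKilling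

section Semisimple

variable {L : Type*} [LieRing L] [LieAlgebra ℂ L] [FiniteDimensional ℂ L]
  [LieAlgebra.IsSemisimple ℂ L] {H : LieSubalgebra ℂ L} [H.IsCartanSubalgebra]

namespace InvForm

/-- The map `ν : 𝔥 → 𝔥^*`, `ν(h) = (h, ·)`. -/
def nuHom (κ : InvForm L) (H : LieSubalgebra ℂ L) : H →ₗ[ℂ] Module.Dual ℂ H :=
  κ.form.restrict H.toSubmodule

theorem nuHom_injective (κ : InvForm L) (H : LieSubalgebra ℂ L) [H.IsCartanSubalgebra] :
    Function.Injective (κ.nuHom H) := by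
  rw [injective_iff_map_eq_zero]
  intro t ht
  have key : ∀ x : L, κ.form t x = 0 := by
    intro x
    have hx : x ∈ ⨆ χ : LieModule.Weight ℂ H L, LieModule.genWeightSpace L χ := by
      rw [LieModule.iSup_genWeightSpace_eq_top' ℂ H L]
      exact LieSubmodule.mem_top x
    induction hx using LieSubmodule.iSup_induction' with
    | mem χ y hy =>
      by_cases hχ : χ.IsZero
      · have hy' : y ∈ H := by
          have h0 : y ∈ rootSpace H (0 : H → ℂ) := by
            have e : (χ : H → ℂ) = 0 := hχ
            rw [← e]; exact hy
          rw [LieAlgebra.rootSpace_zero_eq] at h0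
          exact h0
        exact LinearMap.congr_fun ht (⟨y, hy'⟩ : H)
      · obtain ⟨h, hh⟩ : ∃ h : H, χ h ≠ 0 := by
          by_contra hcon
          push Not at hcon
          exact hχ (funext hcon)
        have h1 : ⁅(h : L), y⁆ = χ h • y := lie_eq_smul_of_mem_rootSpace hy h
        have h2 : ⁅(t : L), (h : L)⁆ = 0 := by
          have : ⁅t, h⁆ = 0 := trivial_lie_zero _ _ _ _
          rw [← LieSubalgebra.coe_bracket, this]; rfl
        have h3 := κ.invariant t h y
        rw [h1, h2, map_smul, map_zero, LinearMap.zero_apply, smul_eq_mul] at h3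
        exact (mul_eq_zero.mp h3.symm).resolve_left hh
    | zero => simp
    | add y z _ _ hy hz => rw [map_add, hy, hz, add_zero]
  exact Subtype.ext (κ.nondegenerate t key)

/-- The isomorphism `ν : 𝔥 ≃ 𝔥^*` determined by the form. -/
def nu (κ : InvForm L) (H : LieSubalgebra ℂ L) [H.IsCartanSubalgebra] :
    H ≃ₗ[ℂ] Module.Dual ℂ H :=
  LinearEquiv.ofInjectiveOfFinrankEq (κ.nuHom H) (κ.nuHom_injective H)
    Subspace.dual_finrank_eq.symm

/-- The induced form on `𝔥^*`. -/
def dual (κ : InvForm L) (H : LieSubalgebra ℂ L) [H.IsCartanSubalgebra]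
    (α β : Module.Dual ℂ H) : ℂ :=
  κ.form ((κ.nu H).symm α) ((κ.nu H).symm β)

end InvForm

/-- A root is short if it is not longer than any root which is not orthogonal to it, that is,
`|2(α,β)/(β,β)| ≤ |2(α,β)/(α,α)|` for all roots `β`. Since the short roots of an irreducible
component span it, these are precisely the short roots of the irreducible components (all roots
of a simply laced component being short). -/
def IsShortRoot (α : H.root) : Prop :=
  ∀ β : H.root, |(rootSystem H).pairingIn ℤ α β| ≤ |(rootSystem H).pairingIn ℤ β α|

/-- The form is normalised so that the square length of short roots is `2`. -/
def InvForm.IsNormalized (κ : InvForm L) (H : LieSubalgebra ℂ L) [H.IsCartanSubalgebra] : Prop :=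
  ∀ α : H.root, IsShortRoot α → κ.dual H ((rootSystem H).root α) ((rootSystem H).root α) = 2

end Semisimple

/-! ### Roots, root lattice cone, partitions, ordered products -/

section Roots

variable {L : Type*} [LieRing L] [LieAlgebra ℂ L] [FiniteDimensional ℂ L]
  [LieAlgebra.IsSemisimple ℂ L] {H : LieSubalgebra ℂ L} [H.IsCartanSubalgebra]
  (b : (rootSystem H).Base)

/-- The positive roots `Φ₊` (with respect to the basis `b` of simple roots). -/
def PosRoot : Type _ := {α : H.root // b.IsPos α}

instance : Finite (PosRoot b) := inferInstanceAs (Finite {α : H.root // b.IsPos α})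

instance : Fintype (PosRoot b) := Fintype.ofFinite _

variable {b}

/-- A positive root as a linear form on `𝔥`. -/
def PosRoot.root (α : PosRoot b) : Module.Dual ℂ H := (rootSystem H).root α.1

/-- The positive root `α` is a simple root. -/
def PosRoot.IsSimple (α : PosRoot b) : Prop := α.1 ∈ b.support

variable (b)

/-- The semigroup `Q₊ = ℤ_{≥ 0} Φ₊`. -/
def Qplus : AddSubmonoid (Module.Dual ℂ H) :=
  AddSubmonoid.closure (Set.range (PosRoot.root (b := b)))

theorem partitions_finite (γ : Module.Dual ℂ H) :
    {k : PosRoot b → ℕ | γ = ∑ α, k α • α.root}.Finite := by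
  let ht : Module.Dual ℂ H →ₗ[ℂ] ℂ := b.toWeightBasis.constr ℂ fun _ => (1 : ℂ)
  have hht : ∀ α : PosRoot b, ht α.root = ((b.height α.1 : ℤ) : ℂ) := by
    intro α
    obtain ⟨f, -, -, hf⟩ := b.exists_root_eq_sum_int α.1
    rw [RootPairing.Base.height_eq_sum hf, PosRoot.root, hf, map_sum, Int.cast_sum]
    refine Finset.sum_congr rfl fun j hj => ?_
    have e : ht ((rootSystem H).root j) = 1 := by
      have := b.toWeightBasis.constr_basis ℂ (fun _ => (1 : ℂ)) ⟨j, hj⟩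
      rwa [RootPairing.Base.toWeightBasis_apply] at this
    rw [map_zsmul, e, zsmul_one]
  by_cases hN : ∃ N : ℤ, (N : ℂ) = ht γ
  · obtain ⟨N, hN⟩ := hN
    refine (Set.Finite.pi' fun _ : PosRoot b => Set.finite_Iic N.toNat).subset ?_
    intro k hk α
    have h1 : N = ∑ α : PosRoot b, (k α : ℤ) * b.height α.1 := by
      have : (N : ℂ) = ((∑ α : PosRoot b, (k α : ℤ) * b.height α.1 : ℤ) : ℂ) := by
        rw [hN, show γ = _ from hk, map_sum, Int.cast_sum]
        refine Finset.sum_congr rfl fun β _ => ?_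
        rw [map_nsmul, hht β, nsmul_eq_mul]; push_cast; rfl
      exact_mod_cast this
    have hpos : ∀ β : PosRoot b, 1 ≤ b.height β.1 := fun β => β.2
    have h2 : (k α : ℤ) * b.height α.1 ≤ N := by
      rw [h1]
      refine Finset.single_le_sum (f := fun β : PosRoot b => (k β : ℤ) * b.height β.1)
        (fun β _ => ?_) (Finset.mem_univ α)
      have := hpos β
      positivity
    have h3 : (k α : ℤ) ≤ N := by nlinarith [hpos α]
    simp only [Set.mem_Iic]
    omega
  · refine Set.Finite.subset Set.finite_empty fun k hk => hN ?_
    refine ⟨∑ α : PosRoot b, (k α : ℤ) * b.height α.1, ?_⟩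
    rw [show γ = _ from hk, map_sum, Int.cast_sum]
    refine Finset.sum_congr rfl fun β _ => ?_
    rw [map_nsmul, hht β, nsmul_eq_mul]; push_cast; rfl

/-- The finite set `P(γ)` of partitions of `γ` as a sum of positive roots. -/
def partitions (γ : Module.Dual ℂ H) : Finset (PosRoot b → ℕ) := (partitions_finite b γ).toFinset

variable {b}

/-- The product of the `A α` over all positive roots, in increasing order. -/
def orderedProd [LinearOrder (PosRoot b)] {M : Type*} [Monoid M] (A : PosRoot b → M) : M :=
  (((Finset.univ : Finset (PosRoot b)).sort (· ≤ ·)).map A).prod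

variable (b)

/-- The condition imposed on the total order: there are simple roots `α_i`, `α_j` such that
`α_i + α_j` is a root, `α_i + ℓ α_j` is not a root for `ℓ ≥ 2`, and
`α_i ≺ α_i + α_j ≺ α_j`. -/
def IsAdmissibleOrder [LinearOrder (PosRoot b)] : Prop :=
  ∃ αi αj αij : PosRoot b, αi.IsSimple ∧ αj.IsSimple ∧
    αij.root = αi.root + αj.root ∧
    (∀ ℓ : ℕ, 2 ≤ ℓ → ∀ β : PosRoot b, β.root ≠ αi.root + ℓ • αj.root) ∧
    αi < αij ∧ αij < αj

end Roots

/-! ### The Yangian of a semisimple Lie algebra -/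

section YangianOfLie

variable {L : Type*} [LieRing L] [LieAlgebra ℂ L] [FiniteDimensional ℂ L]
  [LieAlgebra.IsSemisimple ℂ L] {H : LieSubalgebra ℂ L} [H.IsCartanSubalgebra]

/-- The Cartan matrix `a_{ij} = 2(α_i,α_j)/(α_i,α_i)`, i.e. the value of `α_j` on the coroot
of `α_i`. -/
def cartanA (b : (rootSystem H).Base) : Matrix b.support b.support ℤ :=
  fun i j => (rootSystem H).pairingIn ℤ j.1 i.1

/-- `d_i = (α_i,α_i)/2`. -/
def cartanD (κ : InvForm L) (b : (rootSystem H).Base) : b.support → ℂ :=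
  fun i => κ.dual H ((rootSystem H).root i.1) ((rootSystem H).root i.1) / 2

/-- The Yangian `Y_ħ(𝔤)`. -/
abbrev YangianLie (κ : InvForm L) (b : (rootSystem H).Base) (ħ : ℂ) : Type _ :=
  Yangian (cartanA b) (cartanD κ b) ħ

/-- The basis of `𝔥` formed by the elements `d_i h_i = ν⁻¹(α_i)`. -/
def dhBasis (κ : InvForm L) (b : (rootSystem H).Base) : Module.Basis b.support ℂ H :=
  b.toWeightBasis.map (κ.nu H).symm

variable (κ : InvForm L) (b : (rootSystem H).Base) (ħ : ℂ)

/-- The embedding `𝔥 → Y_ħ(𝔤)`, `d_i h_i ↦ ξ_{i,0}`. -/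
def hEmb : H →ₗ[ℂ] YangianLie κ b ħ :=
  (dhBasis κ b).constr ℂ fun i => Yangian.xi (cartanA b) (cartanD κ b) ħ i 0

/-- The embedding `T : 𝔥 → Y_ħ(𝔤)`, `d_i h_i ↦ t_{i,1}`. -/
def tEmb : H →ₗ[ℂ] YangianLie κ b ħ :=
  (dhBasis κ b).constr ℂ fun i => Yangian.t1 (cartanA b) (cartanD κ b) ħ i

/-- The weight space `Y_ħ(𝔤)_β = {y | [h, y] = β(h) y for all h ∈ 𝔥}`. -/
def yWeight (β : Module.Dual ℂ H) : Submodule ℂ (YangianLie κ b ħ) where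
  carrier := {y | ∀ h : H, ⁅hEmb κ b ħ h, y⁆ = β h • y}
  add_mem' {x y} hx hy h := by
    have h1 := hx h
    have h2 := hy h
    rw [Ring.lie_def] at h1 h2 ⊢
    rw [mul_add, add_mul, add_sub_add_comm, h1, h2, smul_add]
  zero_mem' h := by simp [Ring.lie_def]
  smul_mem' c y hy h := by
    rw [Ring.lie_def, mul_smul_comm, smul_mul_assoc, ← smul_sub, ← Ring.lie_def, hy h, smul_comm]

/-- The subspace `Y^≤_{-γ} ⊗ Y^≥_γ` of `Y ⊗ Y`. -/
def blockSpace (γ : Module.Dual ℂ H) : Submodule ℂ (YangianLie κ b ħ ⊗[ℂ] YangianLie κ b ħ) :=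
  LinearMap.range (TensorProduct.mapIncl
    (Subalgebra.toSubmodule (Yangian.le (cartanA b) (cartanD κ b) ħ) ⊓ yWeight κ b ħ (-γ))
    (Subalgebra.toSubmodule (Yangian.ge (cartanA b) (cartanD κ b) ħ) ⊓ yWeight κ b ħ γ))

/-- The subspace `Y^≤ ⊗ Y^≥` of `Y ⊗ Y`. -/
def leGe : Submodule ℂ (YangianLie κ b ħ ⊗[ℂ] YangianLie κ b ħ) :=
  LinearMap.range (TensorProduct.mapIncl
    (Subalgebra.toSubmodule (Yangian.le (cartanA b) (cartanD κ b) ħ))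
    (Subalgebra.toSubmodule (Yangian.ge (cartanA b) (cartanD κ b) ħ)))

/-- The algebra `(Y ⊗ Y)⟦s⁻¹⟧`; the variable of the power series ring is `s⁻¹`. -/
abbrev YYSeries : Type _ := PowerSeries (YangianLie κ b ħ ⊗[ℂ] YangianLie κ b ħ)

/-- The algebra `(Y ⊗ Y)((s⁻¹))` of Laurent series in `s⁻¹`. -/
abbrev YYLaurent : Type _ := LaurentSeries (YangianLie κ b ħ ⊗[ℂ] YangianLie κ b ħ)

/-! ### Root vectors -/

/-- A choice of root vectors `x_i^± ∈ 𝔤_{±α_i}` with `[x_i^+, x_i^-] = d_i h_i = ν⁻¹(α_i)`. -/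
structure SimpleRootVectors where
  /-- the root vectors `x_i^+` -/
  e : b.support → L
  /-- the root vectors `x_i^-` -/
  f : b.support → L
  e_mem : ∀ i, e i ∈ rootSpace H ((rootSystem H).root i.1 : H → ℂ)
  f_mem : ∀ i, f i ∈ rootSpace H (-(rootSystem H).root i.1 : H → ℂ)
  lie_e_f : ∀ i, ⁅e i, f i⁆ = (dhBasis κ b i : L)

variable {κ b}

/-- The graph of the identification of `𝔤` with a Lie subalgebra of `Y_ħ(𝔤)`, which is uniquely
determined by `x_i^± ↦ x^±_{i,0}` and `d_i h_i ↦ ξ_{i,0}`: the smallest Lie subalgebra of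
`𝔤 × Y_ħ(𝔤)` that contains these pairs. -/
inductive GEmb (c : SimpleRootVectors κ b) (ħ : ℂ) : L → YangianLie κ b ħ → Prop
  | e (i : b.support) : GEmb c ħ (c.e i) (Yangian.x _ _ _ 1 i 0)
  | f (i : b.support) : GEmb c ħ (c.f i) (Yangian.x _ _ _ (-1) i 0)
  | h (i : b.support) : GEmb c ħ (dhBasis κ b i) (Yangian.xi _ _ _ i 0)
  | zero : GEmb c ħ 0 0
  | add {u v : L} {y z : YangianLie κ b ħ} :
      GEmb c ħ u y → GEmb c ħ v z → GEmb c ħ (u + v) (y + z)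
  | smul (a : ℂ) {u : L} {y : YangianLie κ b ħ} : GEmb c ħ u y → GEmb c ħ (a • u) (a • y)
  | lie {u v : L} {y z : YangianLie κ b ħ} :
      GEmb c ħ u y → GEmb c ħ v z → GEmb c ħ ⁅u, v⁆ ⁅y, z⁆

/-- A choice of root vectors `x^±_{β,0} ∈ 𝔤_{±β} ⊂ Y_ħ(𝔤)`, for `β ∈ Φ₊`, such that
`(x^-_{β,0}, x^+_{β,0}) = 1`. Here `up β`, `um β` are the vectors in `𝔤`, and `xp β`, `xm β` are
the same vectors in `Y_ħ(𝔤)`. -/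
structure RootVectors (c : SimpleRootVectors κ b) (ħ : ℂ) where
  /-- the root vector of weight `β` in `𝔤` -/
  up : PosRoot b → L
  /-- the root vector of weight `-β` in `𝔤` -/
  um : PosRoot b → L
  /-- the root vector of weight `β` in the Yangian -/
  xp : PosRoot b → YangianLie κ b ħ
  /-- the root vector of weight `-β` in the Yangian -/
  xm : PosRoot b → YangianLie κ b ħ
  up_mem : ∀ β, up β ∈ rootSpace H (β.root : H → ℂ)
  um_mem : ∀ β, um β ∈ rootSpace H (-β.root : H → ℂ)
  emb_up : ∀ β, GEmb c ħ (up β) (xp β)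
  emb_um : ∀ β, GEmb c ħ (um β) (xm β)
  form_eq_one : ∀ β, κ.form (um β) (up β) = 1

variable {c : SimpleRootVectors κ b} {ħ}

/-- `r⁻ = ħ ∑_{β ∈ Φ₊} x^-_{β,0} ⊗ x^+_{β,0}`. -/
def rMinus (x : RootVectors c ħ) : YangianLie κ b ħ ⊗[ℂ] YangianLie κ b ħ :=
  ħ • ∑ β : PosRoot b, x.xm β ⊗ₜ[ℂ] x.xp β

/-- `r⁻(h) = [h ⊗ 1, r⁻]`. -/
def rMinusH (x : RootVectors c ħ) (h : H) : YangianLie κ b ħ ⊗[ℂ] YangianLie κ b ħ :=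
  ⁅hEmb κ b ħ h ⊗ₜ[ℂ] (1 : YangianLie κ b ħ), rMinus x⁆

/-! ### The intertwining equation -/

variable (κ b ħ)

/-- The inclusion `(Y ⊗ Y)⟦s⁻¹⟧ → (Y ⊗ Y)((s⁻¹))`. -/
def toLaurent : YYSeries κ b ħ →+* YYLaurent κ b ħ := HahnSeries.ofPowerSeries ℤ _

/-- `T(h) ⊗ 1 + 1 ⊗ T(h) + s h ⊗ 1`; note that `s` is the inverse of the variable. -/
def dElem (h : H) : YYLaurent κ b ħ :=
  HahnSeries.C (tEmb κ b ħ h ⊗ₜ[ℂ] (1 : YangianLie κ b ħ)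
    + (1 : YangianLie κ b ħ) ⊗ₜ[ℂ] tEmb κ b ħ h)
    + HahnSeries.single (-1 : ℤ) (hEmb κ b ħ h ⊗ₜ[ℂ] (1 : YangianLie κ b ħ))

variable {κ b ħ}

open Classical in
/-- The intertwining equation for the family `(F_γ(s))`, `γ ∈ Q₊`, componentwise: for all
`h ∈ 𝔥` and `γ ∈ Q₊`,
`[T(h) ⊗ 1 + 1 ⊗ T(h) + s h ⊗ 1, F_γ(s)] =
  -ħ ∑_{α ∈ Φ₊, γ - α ∈ Q₊} α(h) F_{γ-α}(s) (x^-_{α,0} ⊗ x^+_{α,0})`. -/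
def SatisfiesBlockIE (x : RootVectors c ħ) (F : Module.Dual ℂ H → YYSeries κ b ħ) : Prop :=
  ∀ h : H, ∀ γ ∈ Qplus b,
    ⁅dElem κ b ħ h, toLaurent κ b ħ (F γ)⁆ =
      -(ħ • ∑ α : PosRoot b with γ - α.root ∈ Qplus b,
        α.root h • (toLaurent κ b ħ (F (γ - α.root)) *
          HahnSeries.C (x.xm α ⊗ₜ[ℂ] x.xp α)))

/-- The intertwining equation
`[T(h) ⊗ 1 + 1 ⊗ T(h) + s h ⊗ 1, R(s)] = R(s) r⁻(h)` for all `h ∈ 𝔥`. -/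
def SatisfiesIE (x : RootVectors c ħ) (R : YYSeries κ b ħ) : Prop :=
  ∀ h : H, ⁅dElem κ b ħ h, toLaurent κ b ħ R⁆ = toLaurent κ b ħ R * HahnSeries.C (rMinusH x h)

/-! ### Zero weight elements and their components -/

/-- `J(s)` is a weight zero element of `(Y^≤ ⊗ Y^≥)⟦s⁻¹⟧`. -/
def IsWeightZero (J : YYSeries κ b ħ) : Prop :=
  ∀ n : ℕ, PowerSeries.coeff n J ∈ leGe κ b ħ ∧
    ∀ h : H, ⁅hEmb κ b ħ h ⊗ₜ[ℂ] (1 : YangianLie κ b ħ)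
      + (1 : YangianLie κ b ħ) ⊗ₜ[ℂ] hEmb κ b ħ h, PowerSeries.coeff n J⁆ = 0

/-- `(J_γ(s))` is the family of components of `J(s)`, i.e. `J(s) = ∑_{γ ∈ Q₊} J_γ(s)` with
`J_γ(s) ∈ (Y^≤_{-γ} ⊗ Y^≥_γ)⟦s⁻¹⟧`; each coefficient is a finite sum. -/
structure IsDecomposition (J : YYSeries κ b ħ) (Jc : Qplus b → YYSeries κ b ħ) : Prop where
  mem : ∀ (γ : Qplus b) n, PowerSeries.coeff n (Jc γ) ∈ blockSpace κ b ħ γ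
  finite : ∀ n, {γ | PowerSeries.coeff n (Jc γ) ≠ 0}.Finite
  sum : ∀ n, PowerSeries.coeff n J = ∑ᶠ γ, PowerSeries.coeff n (Jc γ)

/-- The weight zero element `J(s)` of `(Y^≤ ⊗ Y^≥)⟦s⁻¹⟧` has `ℤα`-support: `J_γ(s) = 0` for
`γ ∉ ℤα`, and `J_0(s) = 1 ⊗ 1`. -/
def HasZSupport (α : PosRoot b) (J : YYSeries κ b ħ) : Prop :=
  IsWeightZero J ∧ ∃ Jc : Qplus b → YYSeries κ b ħ, IsDecomposition J Jc ∧
    (∀ γ : Qplus b, (γ : Module.Dual ℂ H) ∉ AddSubgroup.zmultiples α.root → Jc γ = 0) ∧ Jc 0 = 1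

/-- The defining properties of the lower triangular factor `R⁻(s)` of the universal R-matrix: it
is the zero weight element of `(Y^≤ ⊗ Y^≥)⟦s⁻¹⟧` with `R⁻_0(s) = 1 ⊗ 1` that solves the
intertwining equation. -/
def IsLowerFactor (x : RootVectors c ħ) (R : YYSeries κ b ħ) : Prop :=
  IsWeightZero R ∧ (∃ Rc : Qplus b → YYSeries κ b ħ, IsDecomposition R Rc ∧ Rc 0 = 1) ∧
    SatisfiesIE x R

/-! ### Block elements -/

/-- A collection of blocks: `F^{(α)}_n(s) ∈ (Y^≤_{-nα} ⊗ Y^≥_{nα})⟦s⁻¹⟧` with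
`F^{(α)}_0(s) = 1 ⊗ 1`. -/
structure IsBlockFamily (F : PosRoot b → ℕ → YYSeries κ b ħ) : Prop where
  mem : ∀ α n m, PowerSeries.coeff m (F α n) ∈ blockSpace κ b ħ (n • α.root)
  zero : ∀ α, F α 0 = 1

/-- `F_γ(s) = ∑_{k ∈ P(γ)} ∏^≺_{α ∈ Φ₊} F^{(α)}_{k_α}(s)`. -/
def blockProduct [LinearOrder (PosRoot b)] (F : PosRoot b → ℕ → YYSeries κ b ħ)
    (γ : Module.Dual ℂ H) : YYSeries κ b ħ :=
  ∑ k ∈ partitions b γ, orderedProd fun α => F α (k α)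

end YangianOfLie

end

/-! ### Rational identities from Lagrange interpolation and Vandermonde determinants. -/

section Identities

open Polynomial Finset

/-! Suppose that the ordered products of blocks solve the componentwise equation. Only the weights
pα_i + qα_j with p ≤ 1 and q ≤ 2 are needed. The hypotheses on roots leave α_i, α_j and α_i + α_j as
the only positive roots below them, so, writing F_{p,q} for the component of this weight, the order
α_i ≺ α_i + α_j ≺ α_j forces F_{1,2} = F_{1,0} F_{0,2} + (F_{1,1} - F_{1,0} F_{0,1}) F_{0,1}
(`AdmissibleTriple.blockProduct_factorization`). On the other hand, the equation at the fundamental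
coweights dual to α_i and α_j is a recursion for the coefficients of the F_{p,q}. Inserting it into
the coefficient of s⁻³ of the factorization gives (ħ/2)[X_j, [X_j, X_i]] = [X_ij, [T(w), X_j]] in Y
⊗ Y, where X_β = x^-_β ⊗ x^+_β, the index ij stands for α_i + α_j, T(w) abbreviates T(w) ⊗ 1 + 1 ⊗
T(w), and w is the coweight dual to α_j (`lie_eq_of_factorization`).

The condition on the α_j-string through α_i means a_{ji} = -1. The Serre relations at levels 0 and 1
then reduce both sides to multiples of the tensor Z of the elements x_j^∓ [x_j^∓, x_i^∓]: the left
side is ħZ and the right side is 2ħZ (`tmul_eq_zero_of_lie_eq`). Hence Z = 0, and a contradiction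
follows as soon as x_j^± [x_j^±, x_i^±] ≠ 0 in the Yangian.

This last fact needs a representation, as a presentation by itself proves no element nonzero. The
Yangian is made to act by difference operators, in the style of Gerasimov, Kharchev, Lebedev and
Oblezin, on functions of finitely many points which move along strings with step ħd_i. The raising
and lowering currents remove and add a point, with rational costs, and the Cartan currents are
diagonal. The quadratic relations hold term by term. The Serre relations reduce, by polarization, to
a vanishing sum over subsets which is an expanded determinant (`sum_powerset_fin_eq_zero`). For
starting points in general position no cost vanishes, and a test function detects the element in
question (`Yangian.mul_lie_ne_zero`).

The vector x^±_{β,0} of the nonsimple root is only known through the graph of 𝔤 → Y, so this graph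
must be shown to be single-valued. It is generated by Chevalley-type elements of 𝔤 × Y, and an
element of it over 0 ∈ 𝔤 vanishes by a lowest weight argument, as in the theory of Kac–Moody
algebras (`ChevalleyData.eq_zero_of_mem_gen`, `GEmb.eq_zero`).

For the second assertion, the components of factors with ℤα-support form blocks. The product expands
into the F_γ, and these lie in distinct weight spaces of 𝔥 acting on the left tensor factor, so the
equation for R⁻ splits into the equations for its components (`SatisfiesIE.satisfiesBlockIE`). -/

/-- The nodal polynomial has the same leading term as P and vanishes at the nodes. Interpolating the
difference, of degree below the number of nodes, reads off its top coefficient, to which the nodal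
polynomial contributes the sum of the nodes. -/
theorem sum_eval_div_prod_sub {ι : Type*} [DecidableEq ι] (s : Finset ι) (v : ι → ℂ)
    (hv : Set.InjOn v s) (P : ℂ[X]) (hP : P.Monic) (hdeg : P.natDegree = #s) (hs : s.Nonempty) :
    ∑ i ∈ s, P.eval (v i) / ∏ j ∈ s.erase i, (v i - v j) = P.nextCoeff + ∑ i ∈ s, v i := by
  have hN : (Lagrange.nodal s v).Monic := Lagrange.nodal_monic
  have hNd : (Lagrange.nodal s v).natDegree = #s := Lagrange.natDegree_nodal
  have hlt : (P - Lagrange.nodal s v).degree < #s := by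
    have h := degree_sub_lt_left (p := P) (q := Lagrange.nodal s v)
      (by rw [degree_eq_natDegree hP.ne_zero, degree_eq_natDegree hN.ne_zero, hdeg, hNd])
      hP.ne_zero (by rw [hP.leadingCoeff, hN.leadingCoeff])
    rwa [degree_eq_natDegree hP.ne_zero, hdeg] at h
  have key := Lagrange.coeff_eq_sum hv hlt
  have hpos : 0 < #s := hs.card_pos
  have hc : (P - Lagrange.nodal s v).coeff (#s - 1) = P.nextCoeff + ∑ i ∈ s, v i := by
    rw [coeff_sub, nextCoeff_of_natDegree_pos (by omega), hdeg]
    have : (Lagrange.nodal s v).nextCoeff = - ∑ i ∈ s, v i := by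
      rw [Lagrange.nodal_eq, Monic.nextCoeff_prod _ _ fun i _ => monic_X_sub_C _]
      simp [nextCoeff_X_sub_C]
    rw [nextCoeff_of_natDegree_pos (by omega), hNd] at this
    rw [this]; ring
  rw [← hc, key]
  refine sum_congr rfl fun i hi => ?_
  rw [eval_sub, Lagrange.eval_nodal_at_node hi, sub_zero]

/-- Interpolation of P = ∏ (X - v_k - δ): the factor of P(v_i) with k = i is -δ. This identity
produces the factorials in powers of the shift operators. -/
theorem sum_prod_sub_add_div {ι : Type*} [DecidableEq ι] (s : Finset ι) (v : ι → ℂ)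
    (hv : Set.InjOn v s) {δ : ℂ} (hδ : δ ≠ 0) :
    ∑ i ∈ s, ∏ j ∈ s.erase i, ((v j - v i + δ) / (v j - v i)) = #s := by
  rcases s.eq_empty_or_nonempty with rfl | hs
  · simp
  have h := sum_eval_div_prod_sub s v hv (∏ k ∈ s, (X - C (v k + δ)))
    (monic_prod_of_monic _ _ fun i _ => monic_X_sub_C _)
    (by rw [natDegree_prod_of_monic _ _ fun i _ => monic_X_sub_C _]
        simp only [natDegree_X_sub_C, sum_const, smul_eq_mul, mul_one]) hs
  rw [Monic.nextCoeff_prod _ _ fun i _ => monic_X_sub_C _] at h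
  simp only [nextCoeff_X_sub_C, eval_prod, eval_sub, eval_X, eval_C, sum_neg_distrib,
    sum_add_distrib, sum_const, nsmul_eq_mul] at h
  have h2 : ∀ i ∈ s, (∏ k ∈ s, (v i - (v k + δ))) / ∏ j ∈ s.erase i, (v i - v j) =
      -δ * ∏ j ∈ s.erase i, ((v j - v i + δ) / (v j - v i)) := by
    intro i hi
    rw [← mul_prod_erase s _ hi, mul_div_assoc, ← prod_div_distrib]
    congr 1
    · ring
    · refine prod_congr rfl fun j _ => ?_
      rw [← neg_div_neg_eq]; congr 1 <;> ring
  rw [sum_congr rfl h2, ← mul_sum] at h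
  have : -δ * ∑ i ∈ s, ∏ j ∈ s.erase i, ((v j - v i + δ) / (v j - v i)) = -δ * #s := by
    rw [h]; ring
  exact mul_left_cancel₀ (neg_ne_zero.mpr hδ) this

/-- Differences of two shifted or of two unshifted nodes do not change, so only the mixed pairs
contribute. -/
theorem det_vandermonde_piecewise_add {m : ℕ} (u : Fin m → ℂ) (hu : Function.Injective u) (δ : ℂ)
    (K : Finset (Fin m)) :
    (Matrix.vandermonde fun i => if i ∈ K then u i + δ else u i).det =
      (Matrix.vandermonde u).det *
        ∏ x ∈ K, ∏ y ∈ Kᶜ, ((u x - u y + δ) / (u x - u y)) := by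
  have e : ∏ x ∈ K, ∏ y ∈ Kᶜ, ((u x - u y + δ) / (u x - u y)) =
      ∏ i : Fin m, ∏ j ∈ Ioi i, (if i ∈ K ∧ j ∉ K then (u i - u j + δ) / (u i - u j) else
        if j ∈ K ∧ i ∉ K then (u j - u i + δ) / (u j - u i) else 1) := by
    have e1 : ∏ x ∈ K, ∏ y ∈ Kᶜ, ((u x - u y + δ) / (u x - u y)) =
        ∏ x : Fin m, ∏ y : Fin m, (if x ∈ K ∧ y ∉ K then (u x - u y + δ) / (u x - u y) else 1) := by
      rw [← prod_subset (subset_univ K)]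
      · refine prod_congr rfl fun x hx => ?_
        rw [← prod_subset (subset_univ Kᶜ)]
        · refine prod_congr rfl fun y hy => ?_
          rw [if_pos ⟨hx, by simpa using hy⟩]
        · intro y _ hy
          rw [if_neg]; simp at hy; tauto
      · intro x _ hx
        refine prod_eq_one fun y _ => ?_
        rw [if_neg]; tauto
    rw [e1]
    have e2 : ∀ f : Fin m → Fin m → ℂ, (∀ i, f i i = 1) →
        ∏ x, ∏ y, f x y = ∏ i, ∏ j ∈ Ioi i, (f i j * f j i) := by
      intro f hf
      have : ∀ i, ∏ y, f i y = (∏ j ∈ Ioi i, f i j) * ∏ j ∈ Iio i, f i j := by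
        intro i
        have hd : (univ : Finset (Fin m)) = insert i (Ioi i ∪ Iio i) := by
          ext j; simp; omega
        rw [hd, prod_insert (by simp), hf, one_mul, prod_union]
        rw [Finset.disjoint_left]; intro a; simp; omega
      simp only [this, prod_mul_distrib]
      congr 1
      rw [prod_sigma', prod_sigma']
      refine prod_bij' (fun x _ => ⟨x.2, x.1⟩) (fun x _ => ⟨x.2, x.1⟩) ?_ ?_ ?_ ?_ ?_ <;> simp
    rw [e2 _ (by intro i; rw [if_neg]; tauto)]
    refine prod_congr rfl fun i _ => prod_congr rfl fun j _ => ?_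
    by_cases hi : i ∈ K <;> by_cases hj : j ∈ K <;> simp [hi, hj]
  rw [e, Matrix.det_vandermonde, Matrix.det_vandermonde, ← prod_mul_distrib]
  refine prod_congr rfl fun i _ => ?_
  rw [← prod_mul_distrib]
  refine prod_congr rfl fun j hj => ?_
  have hij : i ≠ j := (by simpa using hj : i < j).ne
  have h1 : u i - u j ≠ 0 := sub_ne_zero.mpr (hu.ne hij)
  have h2 : u j - u i ≠ 0 := sub_ne_zero.mpr (hu.ne hij.symm)
  by_cases hi : i ∈ K <;> by_cases hj : j ∈ K <;> simp [hi, hj]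
  · field_simp; ring
  · field_simp; ring

/-- The matrix is a Vandermonde matrix times the upper triangular matrix of coefficients, which has
a zero on its diagonal. -/
theorem det_eval_eq_zero {m : ℕ} (u : Fin m → ℂ) (q : Fin m → ℂ[X])
    (hq : ∀ r, (q r).natDegree ≤ r) {r₀ : Fin m} (h0 : (q r₀).coeff r₀ = 0) :
    (Matrix.of fun b r => (q r).eval (u b)).det = 0 := by
  rw [Matrix.eval_matrixOfPolynomials_eq_vandermonde_mul_matrixOfPolynomials u q hq,
    Matrix.det_mul, Matrix.det_of_isUpperTriangular (M := Matrix.of fun i j : Fin m => (q j).coeff i),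
    prod_eq_zero (mem_univ r₀) (by simpa using h0), mul_zero]
  · intro i j hij
    exact coeff_eq_zero_of_natDegree_lt (lt_of_le_of_lt (hq j) hij)

/-- The heart of the Serre relations. The polynomial q_r = (X - v - a) X^r - (X - v + a)(X + δ)^r
has degree at most r, and its coefficient -2a - rδ at X^r vanishes for r = m - 1 by the choice of a.
Hence det q_r(u_b) = 0. Expanding the rows by multilinearity, with K the set of rows where the
second term is taken, gives Vandermonde determinants with the nodes of K shifted by δ. -/
theorem sum_powerset_fin_eq_zero {m : ℕ} (hm : 0 < m) (u : Fin m → ℂ) (hu : Function.Injective u)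
    {δ a v : ℂ} (ha : 2 * a = -((m : ℂ) - 1) * δ) (hne : ∀ i, u i - v - a ≠ 0) :
    ∑ K : Finset (Fin m), (-1) ^ #K * (∏ x ∈ K, ((u x - v + a) / (u x - v - a))) *
      ∏ x ∈ K, ∏ y ∈ Kᶜ, ((u x - u y + δ) / (u x - u y)) = 0 := by
  set q : Fin m → ℂ[X] := fun r =>
    (X - C (v + a)) * X ^ (r : ℕ) - (X - C (v - a)) * (X + C δ) ^ (r : ℕ) with hqdef
  have hcoeff : ∀ r : Fin m, ∀ n : ℕ, (r : ℕ) ≤ n → (q r).coeff n =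
      if n = r then -2 * a - r * δ else 0 := by
    intro r n hn
    have h3 : ((X + C δ) ^ (r : ℕ)).coeff n = if n = r then 1 else 0 := by
      rw [coeff_X_add_C_pow]
      split_ifs with h
      · simp [h]
      · rw [Nat.choose_eq_zero_of_lt (by omega)]; simp
    rw [hqdef]
    simp only [sub_mul, coeff_sub, coeff_C_mul, coeff_X_pow, h3]
    rcases Nat.eq_zero_or_pos n with rfl | hpos
    · have hr : (r : ℕ) = 0 := by omega
      simp [hr]; ring
    · obtain ⟨k, rfl⟩ : ∃ k, n = k + 1 := ⟨n - 1, by omega⟩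
      rw [coeff_X_mul, coeff_X_mul, coeff_X_add_C_pow, coeff_X_pow]
      by_cases h : k + 1 = r
      · rw [if_neg (show k ≠ r by omega), if_pos h, if_pos h, ← h, Nat.choose_succ_self_right]
        simp; ring
      · by_cases h' : k = r
        · rw [if_pos h', ← h']; simp
        · rw [if_neg h', Nat.choose_eq_zero_of_lt (by omega)]; simp [h]
  have hdet : (Matrix.of fun b r => (q r).eval (u b)).det = 0 := by
    refine det_eval_eq_zero u q (fun r => ?_) (r₀ := ⟨m - 1, by omega⟩) ?_
    · rw [natDegree_le_iff_coeff_eq_zero]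
      intro N hN
      rw [hcoeff r N (by omega), if_neg (by omega)]
    · rw [hcoeff _ _ le_rfl, if_pos rfl]
      simp only [Nat.cast_sub (show 1 ≤ m from hm), Nat.cast_one]
      linear_combination -ha
  have hexp : (Matrix.of fun b r => (q r).eval (u b)).det =
      ∑ K : Finset (Fin m), (∏ x, (u x - v - a)) *
        ((-1) ^ #K * (∏ x ∈ K, ((u x - v + a) / (u x - v - a))) *
        (Matrix.vandermonde fun i => if i ∈ K then u i + δ else u i).det) := by
    have hM : (Matrix.of fun b r => (q r).eval (u b)) =
        (fun b r => -(u b - v + a) * (u b + δ) ^ (r : ℕ) : Fin m → Fin m → ℂ) +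
          (fun b r => (u b - v - a) * u b ^ (r : ℕ) : Fin m → Fin m → ℂ) := by
      ext b r
      simp [hqdef]; ring
    rw [hM]
    refine (MultilinearMap.map_add_univ
      (Matrix.detRowAlternating (R := ℂ) (n := Fin m)).toMultilinearMap _ _).trans ?_
    refine sum_congr rfl fun K _ => ?_
    have hpw : (K.piecewise (fun b r => -(u b - v + a) * (u b + δ) ^ (r : ℕ))
        (fun b r => (u b - v - a) * u b ^ (r : ℕ)) : Fin m → Fin m → ℂ) =
        fun b => (K.piecewise (fun b => -(u b - v + a)) fun b => (u b - v - a)) b •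
          (Matrix.vandermonde fun i => if i ∈ K then u i + δ else u i) b := by
      ext b r
      by_cases hb : b ∈ K <;> simp [hb, Matrix.vandermonde_apply]
    rw [hpw]
    refine (MultilinearMap.map_smul_univ _ _ _).trans ?_
    change _ * (Matrix.vandermonde fun i => if i ∈ K then u i + δ else u i).det = _
    rw [← mul_assoc]
    congr 1
    rw [Finset.prod_piecewise, ← prod_mul_prod_compl K fun x => u x - v - a]
    simp only [univ_inter, ← compl_eq_univ_sdiff]
    rw [prod_neg, prod_div_distrib]
    have : ∏ x ∈ K, (u x - v - a) ≠ 0 := prod_ne_zero_iff.mpr fun i _ => hne i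
    field_simp
  rw [hexp] at hdet
  have h1 : ∏ x, (u x - v - a) ≠ 0 := prod_ne_zero_iff.mpr fun i _ => hne i
  have h2 : (Matrix.vandermonde u).det ≠ 0 := Matrix.det_vandermonde_ne_zero_iff.mpr hu
  have h3 : (∏ x, (u x - v - a)) * (Matrix.vandermonde u).det *
    (∑ K : Finset (Fin m), (-1) ^ #K * (∏ x ∈ K, ((u x - v + a) / (u x - v - a))) *
      ∏ x ∈ K, ∏ y ∈ Kᶜ, ((u x - u y + δ) / (u x - u y))) = 0 := by
    rw [← hdet, mul_sum]
    refine sum_congr rfl fun K _ => ?_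
    rw [det_vandermonde_piecewise_add u hu]
    ring
  exact (mul_eq_zero.mp h3).resolve_left (mul_ne_zero h1 h2)

theorem sum_powerset_eq_zero {ι : Type*} [DecidableEq ι] (s : Finset ι) (hs : 0 < #s) (u : ι → ℂ)
    (hu : Set.InjOn u s) {δ a v : ℂ} (ha : 2 * a = -((#s : ℂ) - 1) * δ)
    (hne : ∀ i ∈ s, u i - v - a ≠ 0) :
    ∑ K ∈ s.powerset, (-1) ^ #K * (∏ x ∈ K, ((u x - v + a) / (u x - v - a))) *
      ∏ x ∈ K, ∏ y ∈ s \ K, ((u x - u y + δ) / (u x - u y)) = 0 := by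
  let e : Fin #s ≃ s := s.equivFin.symm
  let e' : Fin #s ↪ ι := e.toEmbedding.trans (Function.Embedding.subtype _)
  have he' : ∀ i, e' i ∈ s := fun i => (e i).2
  have hmap : (univ : Finset (Fin #s)).map e' = s := by
    ext x
    simp only [mem_map, mem_univ, true_and]
    refine ⟨by rintro ⟨i, rfl⟩; exact he' i, fun hx => ⟨e.symm ⟨x, hx⟩, ?_⟩⟩
    simp [e']
  rw [← sum_powerset_fin_eq_zero hs (fun i => u (e' i))
    (fun i j h => e'.injective (hu (he' i) (he' j) h)) ha fun i => hne _ (he' i)]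
  symm
  refine sum_bij (fun K _ => K.map e') ?_ ?_ ?_ ?_
  · intro K _
    rw [mem_powerset]
    conv_rhs => rw [← hmap]
    exact map_subset_map.mpr (subset_univ _)
  · intro K _ K' _ h
    exact map_injective _ h
  · intro K hK
    refine ⟨univ.filter fun i => e' i ∈ K, mem_univ _, ?_⟩
    ext x
    simp only [mem_map, mem_filter, mem_univ, true_and]
    refine ⟨by rintro ⟨i, hi, rfl⟩; exact hi, fun hx => ?_⟩
    have : x ∈ univ.map e' := by rw [hmap]; exact mem_powerset.mp hK hx
    obtain ⟨i, -, rfl⟩ := mem_map.mp this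
    exact ⟨i, hx, rfl⟩
  · intro K _
    have : s \ K.map e' = Kᶜ.map e' := by
      ext x
      rw [mem_sdiff]
      nth_rewrite 1 [← hmap]
      simp only [mem_map, mem_univ, true_and, mem_compl]
      constructor
      · rintro ⟨⟨i, rfl⟩, h⟩
        exact ⟨i, fun hi => h ⟨i, hi, rfl⟩, rfl⟩
      · rintro ⟨i, hi, rfl⟩
        exact ⟨⟨i, rfl⟩, by rintro ⟨j, hj, h⟩; exact hi (e'.injective h ▸ hj)⟩
    rw [this]
    simp only [card_map, prod_map]

end Identities

/-! ### Shift operators on strings of points: quadratic relations and bookkeeping of steps. -/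

section StringModel

set_option linter.unusedSectionVars false

open Finset

/-- Combinatorial data for one half of a representation of the Yangian by difference operators:
states `Ω`, strings of points `R i` of colour `i`; adding to the state `n` the next point of a string
`a` leads to the state `n + e i a`, and costs `A i n u`, where `u = p i a n` is the added point.
The cost of `u` changes by the factor `γ i j u v` after a point `v` of colour `j` has been added. -/
structure StringModel (I : Type*) (R : I → Type*) (Ω : Type*) [AddCommMonoid Ω] where
  /-- the step along a string -/
  e : ∀ i, R i → Ω
  /-- the next point of a string -/
  p : ∀ i, R i → Ω → ℂ
  /-- the distance of points in a string -/
  δ : I → ℂ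
  /-- the cost of adding a point -/
  A : I → Ω → ℂ → ℂ
  /-- the interaction of points -/
  γ : I → I → ℂ → ℂ → ℂ
  /-- the interaction constants -/
  c : I → I → ℂ
  δ_ne_zero : ∀ i, δ i ≠ 0
  p_self : ∀ i a n, p i a (n + e i a) = p i a n + δ i
  p_of_ne : ∀ i a b n, a ≠ b → p i a (n + e i b) = p i a n
  p_of_ne_color : ∀ i j a b n, i ≠ j → p i a (n + e j b) = p i a n
  p_sub_ne : ∀ i a b n (k : ℤ), a ≠ b → p i a n - p i b n ≠ k * δ i
  c_self : ∀ i, c i i = δ i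
  γ_self : ∀ i u v, γ i i u v = (u - v + δ i) / (u - v)
  sub_sub_c_ne_zero : ∀ i j a b n (k : ℕ), i ≠ j → p i a n + k * δ i - p j b n - c i j ≠ 0
  γ_cross : ∀ i j a b n (k : ℕ), i ≠ j →
    (p i a n + k * δ i - p j b n - c i j) * γ i j (p i a n + k * δ i) (p j b n) =
    (p i a n + k * δ i - p j b n + c i j) * γ j i (p j b n) (p i a n + k * δ i)
  A_add : ∀ i j a b n (k : ℕ), (i = j → p i a n + k * δ i ≠ p j b n) →
    A i (n + e j b) (p i a n + k * δ i) =
      γ i j (p i a n + k * δ i) (p j b n) * A i n (p i a n + k * δ i)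

namespace StringModel

variable {I : Type*} {R : I → Type*} [∀ i, Fintype (R i)] {Ω : Type*}
  [AddCommMonoid Ω] (M : StringModel I R Ω)

/-- The operator adding a point `u` of colour `i` with weight `f u`. -/
def X (i : I) (f : ℂ → ℂ) : Module.End ℂ (Ω → ℂ) where
  toFun ψ n := ∑ a, f (M.p i a n) * M.A i n (M.p i a n) * ψ (n + M.e i a)
  map_add' φ ψ := by
    funext n
    simp only [Pi.add_apply, mul_add, sum_add_distrib]
  map_smul' t ψ := by
    funext n
    simp only [Pi.smul_apply, smul_eq_mul, RingHom.id_apply, mul_sum]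
    exact sum_congr rfl fun a _ => by ring

theorem X_apply (i : I) (f : ℂ → ℂ) (ψ : Ω → ℂ) (n : Ω) :
    M.X i f ψ n = ∑ a, f (M.p i a n) * M.A i n (M.p i a n) * ψ (n + M.e i a) := rfl

theorem X_mul_X_apply (i j : I) (f g : ℂ → ℂ) (ψ : Ω → ℂ) (n : Ω) :
    (M.X i f * M.X j g) ψ n = ∑ a, ∑ b, f (M.p i a n) * M.A i n (M.p i a n) *
      (g (M.p j b (n + M.e i a)) * M.A j (n + M.e i a) (M.p j b (n + M.e i a))) *
        ψ (n + M.e i a + M.e j b) := by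
  rw [Module.End.mul_apply, X_apply]
  refine sum_congr rfl fun a _ => ?_
  rw [X_apply, mul_sum]
  exact sum_congr rfl fun b _ => by ring

theorem X_add (i : I) (f g : ℂ → ℂ) : M.X i (f + g) = M.X i f + M.X i g := by
  refine LinearMap.ext fun ψ => funext fun n => ?_
  simp only [LinearMap.add_apply, Pi.add_apply, X_apply, add_mul, sum_add_distrib]

theorem X_sum (i : I) {κ : Type*} (s : Finset κ) (f : κ → ℂ → ℂ) :
    M.X i (∑ t ∈ s, f t) = ∑ t ∈ s, M.X i (f t) := by
  classical
  induction s using Finset.induction_on with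
  | empty =>
    refine LinearMap.ext fun ψ => funext fun n => ?_
    simp [X_apply]
  | insert a s ha ih => rw [sum_insert ha, sum_insert ha, X_add, ih]

theorem p_ne {i : I} {a b : R i} (n : Ω) (h : a ≠ b) : M.p i a n ≠ M.p i b n := by
  have := M.p_sub_ne i a b n 0 h
  intro h'
  simp [h'] at this

theorem γ_exchange (i j : I) (a : R i) (b : R j) (n : Ω) (h : i = j → M.p i a n ≠ M.p j b n) :
    (M.p i a n - M.p j b n - M.c i j) * M.γ i j (M.p i a n) (M.p j b n) =
    (M.p i a n - M.p j b n + M.c i j) * M.γ j i (M.p j b n) (M.p i a n) := by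
  by_cases hij : i = j
  · subst hij
    have h1 := sub_ne_zero.mpr (h rfl)
    have h2 := sub_ne_zero.mpr (h rfl).symm
    rw [M.γ_self, M.γ_self, M.c_self]
    field_simp
    ring
  · simpa using M.γ_cross i j a b n 0 hij

/-- The relation holds for each pair (a, b) of strings separately. For distinct strings it is the
exchange rule of γ. For two steps along one string the spectral values differ by δ, which is the
interaction constant of a colour with itself. -/
theorem X_exchange (i j : I) (f g : ℂ → ℂ) :
    (M.X i (fun u => u * f u) * M.X j g - M.X j g * M.X i (fun u => u * f u)) -
      (M.X i f * M.X j (fun u => u * g u) - M.X j (fun u => u * g u) * M.X i f) =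
    -M.c i j • (M.X i f * M.X j g + M.X j g * M.X i f) := by
  classical
  refine LinearMap.ext fun ψ => funext fun n => ?_
  simp only [LinearMap.sub_apply, LinearMap.smul_apply, LinearMap.add_apply, Pi.sub_apply,
    Pi.smul_apply, Pi.add_apply, X_mul_X_apply, smul_eq_mul]
  rw [sum_comm (s := (univ : Finset (R j))), sum_comm (s := (univ : Finset (R j))),
    sum_comm (s := (univ : Finset (R j)))]
  simp only [← sum_sub_distrib, ← sum_add_distrib, mul_sum]
  refine sum_congr rfl fun a _ => sum_congr rfl fun b _ => ?_
  rw [show n + M.e j b + M.e i a = n + M.e i a + M.e j b from add_right_comm _ _ _]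
  by_cases hab : i = j ∧ HEq a b
  · obtain ⟨rfl, hab⟩ := hab
    obtain rfl := eq_of_heq hab
    rw [M.p_self, M.c_self]
    ring
  · have h1 : M.p j b (n + M.e i a) = M.p j b n := by
      by_cases hij : i = j
      · subst hij
        exact M.p_of_ne _ _ _ _ fun h => hab ⟨rfl, heq_of_eq h.symm⟩
      · exact M.p_of_ne_color _ _ _ _ _ (Ne.symm hij)
    have h2 : M.p i a (n + M.e j b) = M.p i a n := by
      by_cases hij : i = j
      · subst hij
        exact M.p_of_ne _ _ _ _ fun h => hab ⟨rfl, heq_of_eq h⟩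
      · exact M.p_of_ne_color _ _ _ _ _ hij
    have hne : i = j → M.p i a n ≠ M.p j b n := by
      rintro rfl
      exact M.p_ne n fun h => hab ⟨rfl, heq_of_eq h⟩
    have h3 : M.A j (n + M.e i a) (M.p j b n) =
        M.γ j i (M.p j b n) (M.p i a n) * M.A j n (M.p j b n) := by
      simpa using M.A_add j i b a n 0 (by
        simp only [Nat.cast_zero, zero_mul, add_zero]
        rintro rfl
        exact (hne rfl).symm)
    have h4 : M.A i (n + M.e j b) (M.p i a n) =
        M.γ i j (M.p i a n) (M.p j b n) * M.A i n (M.p i a n) := by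
      simpa using M.A_add i j a b n 0 (by simpa using hne)
    rw [h1, h2, h3, h4]
    linear_combination (-(f (M.p i a n) * g (M.p j b n) * M.A i n (M.p i a n) *
      M.A j n (M.p j b n) * ψ (n + M.e i a + M.e j b))) * M.γ_exchange i j a b n hne

/-- The points added by `κ a` steps along each string `a` of colour `i`. -/
def pts {i : I} (κ : R i → ℕ) : Finset (Σ _ : R i, ℕ) := univ.sigma fun a => range (κ a)

theorem mem_pts {i : I} {κ : R i → ℕ} {x : Σ _ : R i, ℕ} : x ∈ pts κ ↔ x.2 < κ x.1 := by
  simp [pts]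

theorem card_pts {i : I} (κ : R i → ℕ) : #(pts κ) = ∑ a, κ a := by
  simp [pts, card_sigma]

/-- The `k`-th next point of a string. -/
def P (i : I) (n : Ω) (x : Σ _ : R i, ℕ) : ℂ := M.p i x.1 n + x.2 * M.δ i

theorem P_injective (i : I) (n : Ω) : Function.Injective (M.P i n) := by
  rintro ⟨a, k⟩ ⟨b, l⟩ h
  simp only [P] at h
  have hab : a = b := by
    by_contra hab
    refine M.p_sub_ne i a b n ((l : ℤ) - k) hab ?_
    push_cast
    linear_combination h
  subst hab
  have h' : ((k : ℂ) - l) * M.δ i = 0 := by linear_combination h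
  have := (mul_eq_zero.mp h').resolve_right (M.δ_ne_zero i)
  have : k = l := by exact_mod_cast sub_eq_zero.mp this
  rw [this]

/-- The displacement of the state after `κ a` steps along each string `a` of colour `i`. -/
def steps {i : I} (κ : R i → ℕ) : Ω := ∑ a, κ a • M.e i a

theorem steps_add {i : I} (κ κ' : R i → ℕ) : M.steps (κ + κ') = M.steps κ + M.steps κ' := by
  simp [steps, add_smul, sum_add_distrib]

variable [∀ i, DecidableEq (R i)]

theorem steps_single {i : I} (a : R i) : M.steps (Pi.single a 1) = M.e i a := by
  rw [steps, sum_eq_single a]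
  · simp
  · intro b _ hb; simp [hb]
  · simp

theorem prod_pts_add_single {i : I} (κ : R i → ℕ) (a : R i) (F : (Σ _ : R i, ℕ) → ℂ) :
    ∏ x ∈ pts (κ + Pi.single a 1), F x =
      F ⟨a, 0⟩ * ∏ x ∈ pts κ, F ⟨x.1, x.2 + if x.1 = a then 1 else 0⟩ := by
  simp only [pts, prod_sigma]
  rw [← mul_prod_erase univ _ (mem_univ a), ← mul_prod_erase univ (fun b => _) (mem_univ a),
    ← mul_assoc]
  congr 1
  · rw [Pi.add_apply, Pi.single_eq_same, prod_range_succ']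
    simp [mul_comm]
  · refine prod_congr rfl fun b hb => ?_
    have hb : b ≠ a := (mem_erase.mp hb).1
    simp [hb]

theorem P_add {i : I} (n : Ω) (a : R i) (x : Σ _ : R i, ℕ) :
    M.P i (n + M.e i a) x = M.P i n ⟨x.1, x.2 + if x.1 = a then 1 else 0⟩ := by
  obtain ⟨b, k⟩ := x
  simp only [P]
  by_cases h : b = a
  · subst h
    rw [M.p_self]
    simp; ring
  · rw [M.p_of_ne _ _ _ _ h]
    simp [h]

/-- Induction on the number of steps. -/
theorem steps_induction {i : I} {motive : (R i → ℕ) → Prop} (zero : motive 0)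
    (add : ∀ κ a, motive κ → motive (κ + Pi.single a 1)) (κ : R i → ℕ) : motive κ := by
  generalize hl : ∑ a, κ a = l
  induction l generalizing κ with
  | zero =>
    have : κ = 0 := by
      funext a
      exact (sum_eq_zero_iff.mp hl) a (mem_univ a)
    rw [this]; exact zero
  | succ l ih =>
    obtain ⟨a, ha⟩ : ∃ a, κ a ≠ 0 := by
      by_contra! h
      simp [h] at hl
    have e : κ = (κ - Pi.single a 1) + Pi.single a 1 := by
      funext b
      by_cases hb : b = a
      · subst hb; simp; omega
      · simp [hb]
    rw [e] at hl ⊢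
    refine add _ a (ih _ ?_)
    simpa [sum_add_distrib] using hl

theorem P_add_steps {i : I} (κ : R i → ℕ) (n : Ω) (x : Σ _ : R i, ℕ) :
    M.P i (n + M.steps κ) x = M.P i n ⟨x.1, x.2 + κ x.1⟩ := by
  induction κ using steps_induction generalizing n x with
  | zero => simp [steps]
  | add κ a ih =>
    rw [steps_add, steps_single, ← add_assoc, P_add, ih]
    obtain ⟨b, k⟩ := x
    by_cases h : b = a
    · subst h; simp; ring_nf
    · simp [h]

/-- The change of the cost after several steps of colour `i`. -/
theorem A_add_steps {i j : I} (κ : R i → ℕ) (n : Ω) (b : R j) (k : ℕ)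
    (h : i = j → M.p j b n + k * M.δ j ∉ M.P i n '' (pts κ)) :
    M.A j (n + M.steps κ) (M.p j b n + k * M.δ j) =
      (∏ x ∈ pts κ, M.γ j i (M.p j b n + k * M.δ j) (M.P i n x)) *
        M.A j n (M.p j b n + k * M.δ j) := by
  induction κ using steps_induction generalizing n k with
  | zero =>
    have : pts (0 : R i → ℕ) = ∅ := by ext; simp [mem_pts]
    simp [steps, this]
  | add κ a ih =>
    rw [steps_add, steps_single, add_comm (M.steps κ), ← add_assoc, prod_pts_add_single]
    simp only [← P_add]
    have hx0 : (⟨a, 0⟩ : Σ _ : R i, ℕ) ∈ pts (κ + Pi.single a 1) := by simp [mem_pts]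
    have hP0 : M.P i n ⟨a, 0⟩ = M.p i a n := by simp [P]
    have hA := M.A_add j i b a n k (by
      intro hij heq
      exact h hij.symm ⟨_, hx0, by rw [hP0, heq]⟩)
    -- Seen from the state after the step, the same point has index k, or k - 1 if the step was
    -- along its own string. In that case k = 0 is excluded, since the point would be the one just
    -- added.
    obtain ⟨k', hk'⟩ : ∃ k' : ℕ, M.p j b n + k * M.δ j =
        M.p j b (n + M.e i a) + k' * M.δ j := by
      by_cases hij : i = j
      · subst hij
        by_cases hab : b = a
        · subst hab
          cases k with
          | zero =>
            exact absurd ⟨_, hx0, by rw [hP0]; simp⟩ (h rfl)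
          | succ k =>
            refine ⟨k, ?_⟩
            rw [M.p_self]; push_cast; ring
        · exact ⟨k, by rw [M.p_of_ne _ _ _ _ hab]⟩
      · exact ⟨k, by rw [M.p_of_ne_color _ _ _ _ _ (Ne.symm hij)]⟩
    rw [hk'] at hA h ⊢
    rw [ih (n + M.e i a) k', hA, hP0]
    · ring
    · rintro hij ⟨x, hx, hxe⟩
      refine h hij ⟨⟨x.1, x.2 + if x.1 = a then 1 else 0⟩, ?_, ?_⟩
      · simp only [mem_coe, mem_pts] at hx ⊢
        by_cases h : x.1 = a
        · simp [h] at hx ⊢; exact hx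
        · simp [h]; exact hx
      · rw [← P_add, hxe]

end StringModel

end StringModel

/-! ### Powers of the shift operators as sums over total displacements. -/

section StringModel

set_option linter.unusedSectionVars false

open Finset

namespace StringModel

variable {I : Type*} {R : I → Type*} [∀ i, Fintype (R i)] {Ω : Type*}
  [AddCommMonoid Ω] (M : StringModel I R Ω) [∀ i, DecidableEq (R i)]

/-- The cost of adding all the points `pts κ`, up to their interaction. -/
def wt (i : I) (f : ℂ → ℂ) (n : Ω) (κ : R i → ℕ) : ℂ :=
  ∏ x ∈ pts κ, f (M.P i n x) * M.A i n (M.P i n x)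

/-- The first step along `a` multiplies the cost of each later point by its interaction with the
first point. Later points on `a` have their index raised by one, so none of them is the erased one.
-/
theorem mul_wt (i : I) (f : ℂ → ℂ) (n : Ω) (κ : R i → ℕ) (a : R i) :
    f (M.p i a n) * M.A i n (M.p i a n) * M.wt i f (n + M.e i a) κ =
      M.wt i f n (κ + Pi.single a 1) * ∏ x ∈ (pts (κ + Pi.single a 1)).erase ⟨a, 0⟩,
        M.γ i i (M.P i n x) (M.P i n ⟨a, 0⟩) := by
  have hP0 : M.P i n ⟨a, 0⟩ = M.p i a n := by simp [P]
  have hx0 : (⟨a, 0⟩ : Σ _ : R i, ℕ) ∈ pts (κ + Pi.single a 1) := by simp [mem_pts]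
  have h1 := prod_pts_add_single κ a fun x => if x = ⟨a, 0⟩ then 1 else
    M.γ i i (M.P i n x) (M.P i n ⟨a, 0⟩)
  have h2 : ∏ x ∈ (pts (κ + Pi.single a 1)).erase ⟨a, 0⟩,
      M.γ i i (M.P i n x) (M.P i n ⟨a, 0⟩) = ∏ x ∈ pts (κ + Pi.single a 1),
        if x = ⟨a, 0⟩ then 1 else M.γ i i (M.P i n x) (M.P i n ⟨a, 0⟩) := by
    rw [← mul_prod_erase _ _ hx0, if_pos rfl, one_mul]
    exact prod_congr rfl fun x hx => by rw [if_neg (mem_erase.mp hx).1]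
  rw [h2, h1, if_pos rfl, one_mul, wt, wt, prod_pts_add_single, hP0, mul_assoc (f _ * _),
    ← prod_mul_distrib]
  congr 1
  refine prod_congr rfl fun x hx => ?_
  have hne : (⟨x.1, x.2 + if x.1 = a then 1 else 0⟩ : Σ _ : R i, ℕ) ≠ ⟨a, 0⟩ := by
    intro h
    have h3 : x.1 = a := congrArg Sigma.fst h
    simp [h3] at h
  rw [if_neg hne, P_add]
  have := M.A_add i i x.1 a n (x.2 + if x.1 = a then 1 else 0) (fun _ h => hne
    (M.P_injective i n (by rw [hP0, ← h]; simp [P])))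
  rw [show M.p i x.1 n + ((x.2 + if x.1 = a then 1 else 0 : ℕ) : ℂ) * M.δ i =
    M.P i n ⟨x.1, x.2 + if x.1 = a then 1 else 0⟩ from rfl, ← hP0] at this
  rw [this, hP0]
  ring

/-- A first step followed by a displacement is the same as the total displacement with a marked
string that is used at least once. -/
theorem sum_sum_add_single {i : I} (l : ℕ) (F : R i → (R i → ℕ) → ℂ) :
    ∑ a, ∑ κ ∈ piAntidiag univ l, F a (κ + Pi.single a 1) =
      ∑ κ ∈ piAntidiag univ (l + 1), ∑ a with κ a ≠ 0, F a κ := by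
  rw [sum_sigma', sum_sigma']
  refine sum_bij' (fun x _ => ⟨x.2 + Pi.single x.1 1, x.1⟩)
    (fun x _ => ⟨x.2, x.1 - Pi.single x.2 1⟩) ?_ ?_ ?_ ?_ ?_
  · rintro ⟨a, κ⟩ h
    simp only [mem_sigma, mem_univ, true_and, mem_piAntidiag, implies_true, and_true,
      mem_filter, Pi.add_apply, Pi.single_eq_same] at h ⊢
    simp [sum_add_distrib, h]
  · rintro ⟨κ, a⟩ h
    simp only [mem_sigma, mem_univ, true_and, mem_piAntidiag, implies_true, and_true,
      mem_filter] at h ⊢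
    have e : κ = (κ - Pi.single a 1) + Pi.single a 1 := by
      funext b
      by_cases hb : b = a
      · subst hb; simp; omega
      · simp [hb]
    have h1 := h.1
    rw [e] at h1
    simpa [sum_add_distrib] using h1
  · rintro ⟨a, κ⟩ h
    simp
  · rintro ⟨κ, a⟩ h
    simp only [mem_sigma, mem_univ, true_and, mem_filter] at h
    have e : (κ - Pi.single a 1) + Pi.single a 1 = κ := by
      funext b
      by_cases hb : b = a
      · subst hb; simp; omega
      · simp [hb]
    simp [e]
  · rintro ⟨a, κ⟩ h
    rfl

/-- The interaction kills every configuration in which a point precedes its predecessor on the same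
string. This allows sums over admissible orders to be extended to sums over all subsets of points.
-/
theorem γ_self_eq_zero (i : I) (n : Ω) (a : R i) (k : ℕ) :
    M.γ i i (M.P i n ⟨a, k⟩) (M.P i n ⟨a, k + 1⟩) = 0 := by
  rw [M.γ_self]
  have : M.P i n ⟨a, k⟩ - M.P i n ⟨a, k + 1⟩ + M.δ i = 0 := by
    simp only [P]; push_cast; ring
  rw [this, zero_div]

/-- The points which do not start a string contribute zero, so the sum may run over all points,
where `sum_prod_sub_add_div` evaluates it to their number. -/
theorem sum_prod_γ (i : I) (n : Ω) (κ : R i → ℕ) :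
    ∑ a with κ a ≠ 0, ∏ x ∈ (pts κ).erase ⟨a, 0⟩, M.γ i i (M.P i n x) (M.P i n ⟨a, 0⟩) =
      ∑ a, κ a := by
  have h := sum_prod_sub_add_div (pts κ) (M.P i n) ((M.P_injective i n).injOn) (M.δ_ne_zero i)
  simp only [← M.γ_self i] at h
  rw [card_pts] at h
  rw [← h]
  have hinj : Set.InjOn (fun a => (⟨a, 0⟩ : Σ _ : R i, ℕ)) (univ.filter fun a => κ a ≠ 0) :=
    fun a _ b _ h => congrArg Sigma.fst h
  rw [← sum_image (f := fun y => ∏ x ∈ (pts κ).erase y, M.γ i i (M.P i n x) (M.P i n y)) hinj]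
  refine sum_subset ?_ ?_
  · intro x hx
    simp only [mem_image, mem_filter, mem_univ, true_and] at hx
    obtain ⟨a, ha, rfl⟩ := hx
    simp [mem_pts]; omega
  · rintro ⟨a, k⟩ hx hx'
    rw [mem_pts] at hx
    cases k with
    | zero =>
      refine absurd (mem_image.mpr ⟨a, ?_, rfl⟩) hx'
      simp at hx ⊢; omega
    | succ k =>
      refine prod_eq_zero (i := ⟨a, k⟩) ?_ (M.γ_self_eq_zero i n a k)
      simp only [mem_erase, mem_pts] at hx ⊢
      exact ⟨by simp, by omega⟩

/-- By induction: for a fixed total displacement of size l + 1, summing over the string that moves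
first yields the factor l + 1. -/
theorem X_pow_apply (i : I) (f : ℂ → ℂ) (l : ℕ) (ψ : Ω → ℂ) (n : Ω) :
    (M.X i f ^ l) ψ n =
      l.factorial * ∑ κ ∈ piAntidiag univ l, M.wt i f n κ * ψ (n + M.steps κ) := by
  induction l generalizing n with
  | zero =>
    have : pts (0 : R i → ℕ) = ∅ := by ext; simp [mem_pts]
    simp [wt, steps, this]
  | succ l ih =>
    rw [pow_succ', Module.End.mul_apply, X_apply]
    simp only [ih]
    obtain ⟨F, hF⟩ : ∃ F : R i → (R i → ℕ) → ℂ, F = fun a κ => l.factorial * (M.wt i f n κ *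
        (∏ x ∈ (pts κ).erase ⟨a, 0⟩, M.γ i i (M.P i n x) (M.P i n ⟨a, 0⟩)) *
          ψ (n + M.steps κ)) := ⟨_, rfl⟩
    have h1 : ∀ a : R i, f (M.p i a n) * M.A i n (M.p i a n) * (l.factorial *
        ∑ κ ∈ piAntidiag univ l, M.wt i f (n + M.e i a) κ * ψ (n + M.e i a + M.steps κ)) =
        ∑ κ ∈ piAntidiag univ l, F a (κ + Pi.single a 1) := by
      intro a
      rw [mul_sum, mul_sum]
      refine sum_congr rfl fun κ _ => ?_
      simp only [hF, ← mul_wt]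
      rw [steps_add, steps_single, add_comm (M.steps κ), ← add_assoc]
      ring
    rw [sum_congr rfl fun a _ => h1 a, sum_sum_add_single, mul_sum]
    refine sum_congr rfl fun κ hκ => ?_
    rw [hF, ← mul_sum, ← sum_mul, ← mul_sum, sum_prod_γ]
    rw [mem_piAntidiag] at hκ
    rw [Nat.factorial_succ, hκ.1]
    push_cast
    ring

theorem p_add_steps_of_ne {i j : I} (hij : i ≠ j) (q : R j) (κ : R i → ℕ) (n : Ω) :
    M.p j q (n + M.steps κ) = M.p j q n := by
  induction κ using steps_induction generalizing n with
  | zero => simp [steps]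
  | add κ a ih =>
    rw [steps_add, steps_single, ← add_assoc, M.p_of_ne_color _ _ _ _ _ hij.symm, ih]

theorem prod_pts_sdiff {i : I} (κ κ' : R i → ℕ) (F : (Σ _ : R i, ℕ) → ℂ) :
    ∏ x ∈ pts (κ + κ') \ pts κ, F x = ∏ x ∈ pts κ', F ⟨x.1, x.2 + κ x.1⟩ := by
  symm
  refine prod_bij' (fun x _ => ⟨x.1, x.2 + κ x.1⟩) (fun x _ => ⟨x.1, x.2 - κ x.1⟩) ?_ ?_ ?_ ?_ ?_
  · intro x hx
    simp only [mem_sdiff, mem_pts, Pi.add_apply] at hx ⊢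
    omega
  · intro x hx
    simp only [mem_sdiff, mem_pts, Pi.add_apply] at hx ⊢
    omega
  · intro x _; simp
  · rintro ⟨a, k⟩ hx
    simp only [mem_sdiff, mem_pts, Pi.add_apply] at hx
    simp only [Sigma.mk.injEq, heq_eq_eq, true_and]; omega
  · intro x _; rfl

theorem pts_mono {i : I} {κ κ' : R i → ℕ} (h : κ ≤ κ') : pts κ ⊆ pts κ' := fun x hx => by
  rw [mem_pts] at hx ⊢
  exact hx.trans_le (h x.1)

/-- The interaction of the points in `pts κ` and of the point `v`, when the points of `S` are added
before `v` and the others are added after `v`. -/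
def inter (i j : I) (n : Ω) (v : ℂ) (T S : Finset (Σ _ : R i, ℕ)) : ℂ :=
  (∏ x ∈ S, M.γ j i v (M.P i n x)) * (∏ x ∈ T \ S, M.γ i j (M.P i n x) v) *
    ∏ x ∈ T \ S, ∏ y ∈ S, M.γ i i (M.P i n x) (M.P i n y)

/-- Normal form of the terms of an iterated commutator: κ is performed before the step of colour j
and κ' after it. All costs are referred back to the initial state, and the dependence on the order
is collected in `inter`, so that terms with equal κ + κ' can be compared. -/
theorem X_pow_mul_X_mul_X_pow_apply {i j : I} (hij : i ≠ j) (f g : ℂ → ℂ) (k l : ℕ)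
    (ψ : Ω → ℂ) (n : Ω) :
    (M.X i f ^ k * M.X j g * M.X i f ^ l) ψ n = k.factorial * l.factorial *
      ∑ q, ∑ κ ∈ piAntidiag univ k, ∑ κ' ∈ piAntidiag univ l,
        g (M.p j q n) * M.A j n (M.p j q n) * M.wt i f n (κ + κ') *
          M.inter i j n (M.p j q n) (pts (κ + κ')) (pts κ) *
            ψ (n + M.steps (κ + κ') + M.e j q) := by
  rw [mul_assoc, Module.End.mul_apply, X_pow_apply, Module.End.mul_apply, mul_assoc]
  congr 1
  rw [sum_comm, mul_sum]
  refine sum_congr rfl fun κ _ => ?_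
  rw [X_apply, mul_sum, mul_sum]
  refine sum_congr rfl fun q _ => ?_
  rw [X_pow_apply, p_add_steps_of_ne _ hij, mul_sum, mul_sum, mul_sum, mul_sum]
  refine sum_congr rfl fun κ' _ => ?_
  have hA : M.A j (n + M.steps κ) (M.p j q n) =
      (∏ x ∈ pts κ, M.γ j i (M.p j q n) (M.P i n x)) * M.A j n (M.p j q n) := by
    simpa using M.A_add_steps κ n q 0 (fun h => absurd h hij)
  have hw : M.wt i f n κ * M.wt i f (n + M.steps κ + M.e j q) κ' =
      M.wt i f n (κ + κ') * ((∏ x ∈ pts (κ + κ') \ pts κ, M.γ i j (M.P i n x) (M.p j q n)) *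
        ∏ x ∈ pts (κ + κ') \ pts κ, ∏ y ∈ pts κ, M.γ i i (M.P i n x) (M.P i n y)) := by
    have hsub : pts κ ⊆ pts (κ + κ') := pts_mono fun a => by simp
    have h1 : M.wt i f n (κ + κ') = M.wt i f n κ *
        ∏ x ∈ pts (κ + κ') \ pts κ, f (M.P i n x) * M.A i n (M.P i n x) := by
      rw [wt, wt, mul_comm, prod_sdiff hsub]
    rw [h1, mul_assoc, ← prod_mul_distrib, ← prod_mul_distrib, prod_pts_sdiff, wt]
    congr 1
    refine prod_congr rfl fun x _ => ?_
    have h2 : M.P i (n + M.steps κ + M.e j q) x = M.P i n ⟨x.1, x.2 + κ x.1⟩ := by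
      rw [← P_add_steps]
      simp only [P]
      rw [M.p_of_ne_color _ _ _ _ _ hij]
    have h3 := M.A_add i j x.1 q (n + M.steps κ) x.2 (fun h => absurd h hij)
    rw [show M.p i x.1 (n + M.steps κ) + x.2 * M.δ i = M.P i (n + M.steps κ) x from rfl,
      P_add_steps, p_add_steps_of_ne _ hij] at h3
    -- Relative to the state n, the points added after κ have index at least κ on their string, so
    -- they do not lie among `pts κ`.
    have h4 := M.A_add_steps κ n x.1 (x.2 + κ x.1) (by
      rintro - ⟨y, hy, hye⟩
      have := M.P_injective i n (a₂ := ⟨x.1, x.2 + κ x.1⟩) hye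
      subst this
      simp [mem_pts] at hy)
    rw [show M.p i x.1 n + ((x.2 + κ x.1 : ℕ) : ℂ) * M.δ i = M.P i n ⟨x.1, x.2 + κ x.1⟩ from rfl]
      at h4
    rw [h2, h3, h4]
    ring
  have hst : n + (M.steps κ + M.steps κ') + M.e j q = n + M.steps κ + M.e j q + M.steps κ' := by
    abel
  rw [hA, inter, steps_add, hst]
  linear_combination (l.factorial * g (M.p j q n) *
    ((∏ x ∈ pts κ, M.γ j i (M.p j q n) (M.P i n x)) * M.A j n (M.p j q n)) *
      ψ (n + M.steps κ + M.e j q + M.steps κ')) * hw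

end StringModel

end StringModel

/-! ### The Serre relations for shift operators. -/

section StringModel

set_option linter.unusedSectionVars false

open Finset

/-- The commutator with `x`, as a linear map. -/
def adMap {W : Type*} [Ring W] [Algebra ℂ W] : W →ₗ[ℂ] Module.End ℂ W :=
  LinearMap.mul ℂ W - (LinearMap.mul ℂ W).flip

theorem adMap_apply {W : Type*} [Ring W] [Algebra ℂ W] (x y : W) : adMap x y = ⁅x, y⁆ := rfl

theorem adMap_pow_apply {W : Type*} [Ring W] [Algebra ℂ W] (x y : W) (m : ℕ) :
    (adMap x ^ m) y = ∑ k ∈ antidiagonal m,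
      ((-1 : ℂ) ^ k.2 * m.choose k.2) • (x ^ k.1 * y * x ^ k.2) := by
  have h : adMap x = LinearMap.mulLeft ℂ x + (-1 : ℂ) • LinearMap.mulRight ℂ x := by
    ext z
    simp [adMap_apply, Ring.lie_def, sub_eq_add_neg]
  have hc : Commute (LinearMap.mulLeft ℂ x) ((-1 : ℂ) • LinearMap.mulRight ℂ x) :=
    (LinearMap.commute_mulLeft_right x x).smul_right _
  rw [h, hc.add_pow', LinearMap.sum_apply]
  refine sum_congr rfl fun k hk => ?_
  rw [HasAntidiagonal.mem_antidiagonal] at hk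
  rw [smul_pow, LinearMap.pow_mulLeft, LinearMap.pow_mulRight, mul_smul_comm,
    ← Nat.cast_smul_eq_nsmul ℂ, smul_smul, LinearMap.smul_apply, Module.End.mul_apply,
    LinearMap.mulLeft_apply, LinearMap.mulRight_apply, mul_comm (m.choose k.1 : ℂ),
    ← mul_assoc (x ^ k.1), Nat.choose_symm_of_eq_add (show m = k.1 + k.2 by omega)]

namespace StringModel

variable {I : Type*} {R : I → Type*} [∀ i, Fintype (R i)] {Ω : Type*}
  [AddCommMonoid Ω] (M : StringModel I R Ω) [∀ i, DecidableEq (R i)]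

/-- A subset that is not an initial segment of every string contains some point k + 1 without the
point k, and then `γ_self_eq_zero` applies. -/
theorem inter_eq_zero (i j : I) (n : Ω) (v : ℂ) (κ : R i → ℕ) (S : Finset (Σ _ : R i, ℕ))
    (hS : S ⊆ pts κ) (hS' : ∀ κ₀ ≤ κ, S ≠ pts κ₀) : M.inter i j n v (pts κ) S = 0 := by
  by_cases hd : ∀ a k, (⟨a, k + 1⟩ : Σ _ : R i, ℕ) ∈ S → (⟨a, k⟩ : Σ _ : R i, ℕ) ∈ S
  · exfalso
    have hex : ∀ a, ∃ k, (⟨a, k⟩ : Σ _ : R i, ℕ) ∉ S := fun a =>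
      ⟨κ a, fun h => by simpa [mem_pts] using hS h⟩
    classical
    refine hS' (fun a => Nat.find (hex a)) (fun a => ?_) ?_
    · exact Nat.find_min' (hex a) fun h => by simpa [mem_pts] using hS h
    · ext ⟨a, k⟩
      rw [mem_pts]
      constructor
      · intro h
        by_contra hlt
        rw [not_lt] at hlt
        refine (?_ : (⟨a, k⟩ : Σ _ : R i, ℕ) ∉ S) h
        induction k, hlt using Nat.le_induction with
        | base => exact Nat.find_spec (hex a)
        | succ k hk ih => exact fun h' => ih (hd a k h') (hd a k h')
      · intro h
        simpa using Nat.find_min (hex a) h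
  · push Not at hd
    obtain ⟨a, k, h1, h2⟩ := hd
    have h3 : (⟨a, k⟩ : Σ _ : R i, ℕ) ∈ pts κ \ S := by
      have := hS h1
      simp only [mem_sdiff, mem_pts] at this ⊢
      exact ⟨by omega, h2⟩
    rw [inter, prod_eq_zero h3 (f := fun x => ∏ y ∈ S, M.γ i i (M.P i n x) (M.P i n y))
      (prod_eq_zero h1 (M.γ_self_eq_zero i n a k)), mul_zero]

/-- After division of the mixed factors by the common product of all γ_{ji}, the exchange rule turns
the remaining ones into ratios (u - v + c)/(u - v - c). In terms of the complement K of S this is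
`sum_powerset_eq_zero`, with a the interaction constant. -/
theorem sum_powerset_inter {i j : I} (hij : i ≠ j) (n : Ω) (q : R j) (κ : R i → ℕ)
    (hκ : 0 < ∑ a, κ a) (hc : 2 * M.c i j = -(((∑ a, κ a : ℕ) : ℂ) - 1) * M.δ i) :
    ∑ S ∈ (pts κ).powerset, (-1) ^ #(pts κ \ S) * M.inter i j n (M.p j q n) (pts κ) S = 0 := by
  rw [← card_pts] at hκ hc
  have hne : ∀ x ∈ pts κ, M.P i n x - M.p j q n - M.c i j ≠ 0 := fun x _ =>
    M.sub_sub_c_ne_zero i j x.1 q n x.2 hij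
  have h := sum_powerset_eq_zero (pts κ) hκ (M.P i n) (M.P_injective i n).injOn hc hne
  have h2 : ∑ S ∈ (pts κ).powerset, (-1) ^ #(pts κ \ S) *
      M.inter i j n (M.p j q n) (pts κ) S = (∏ x ∈ pts κ, M.γ j i (M.p j q n) (M.P i n x)) *
      ∑ K ∈ (pts κ).powerset, (-1) ^ #K *
        (∏ x ∈ K, ((M.P i n x - M.p j q n + M.c i j) / (M.P i n x - M.p j q n - M.c i j))) *
        ∏ x ∈ K, ∏ y ∈ pts κ \ K, ((M.P i n x - M.P i n y + M.δ i) /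
          (M.P i n x - M.P i n y)) := by
    rw [mul_sum]
    refine sum_bij' (fun S _ => pts κ \ S) (fun K _ => pts κ \ K) ?_ ?_ ?_ ?_ ?_
    · intro S _; simp
    · intro S _; simp
    · intro S hS; exact Finset.sdiff_sdiff_eq_self (mem_powerset.mp hS)
    · intro S hS; exact Finset.sdiff_sdiff_eq_self (mem_powerset.mp hS)
    · intro S hS
      rw [Finset.sdiff_sdiff_eq_self (mem_powerset.mp hS), inter, ← prod_sdiff (mem_powerset.mp hS)]
      simp only [← M.γ_self i]
      have : ∏ x ∈ pts κ \ S, M.γ i j (M.P i n x) (M.p j q n) =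
          (∏ x ∈ pts κ \ S, ((M.P i n x - M.p j q n + M.c i j) /
            (M.P i n x - M.p j q n - M.c i j))) *
          ∏ x ∈ pts κ \ S, M.γ j i (M.p j q n) (M.P i n x) := by
        rw [← prod_mul_distrib]
        refine prod_congr rfl fun x hx => ?_
        have h1 := hne x (mem_sdiff.mp hx).1
        have h3 : (M.P i n x - M.p j q n - M.c i j) * M.γ i j (M.P i n x) (M.p j q n) =
            (M.P i n x - M.p j q n + M.c i j) * M.γ j i (M.p j q n) (M.P i n x) :=
          M.γ_cross i j x.1 q n x.2 hij
        field_simp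
        linear_combination h3
      rw [this]
      ring
  rw [h2, h, mul_zero]

/-- Only initial segments of the strings can be performed first, while the determinant identity runs
over all subsets. The extra subsets contribute zero by `inter_eq_zero`. -/
theorem sum_Iic_inter {i j : I} (hij : i ≠ j) (n : Ω) (q : R j) (κ : R i → ℕ)
    (hκ : 0 < ∑ a, κ a) (hc : 2 * M.c i j = -(((∑ a, κ a : ℕ) : ℂ) - 1) * M.δ i) :
    ∑ κ₀ ∈ Iic κ, (-1) ^ (∑ a, (κ - κ₀) a) * M.inter i j n (M.p j q n) (pts κ) (pts κ₀) = 0 := by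
  rw [← M.sum_powerset_inter hij n q κ hκ hc]
  have hinj : Set.InjOn (pts (R := R) (i := i)) (Iic κ : Finset (R i → ℕ)) := by
    intro κ₁ _ κ₂ _ h
    funext a
    have : ∀ k, k < κ₁ a ↔ k < κ₂ a := fun k => by
      have := Finset.ext_iff.mp h ⟨a, k⟩
      simpa only [mem_pts] using this
    exact eq_of_forall_lt_iff this
  have e : ∑ κ₀ ∈ Iic κ, (-1) ^ (∑ a, (κ - κ₀) a) *
      M.inter i j n (M.p j q n) (pts κ) (pts κ₀) =
      ∑ κ₀ ∈ Iic κ, (fun S => (-1) ^ #(pts κ \ S) * M.inter i j n (M.p j q n) (pts κ) S)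
        (pts κ₀) := by
    refine sum_congr rfl fun κ₀ h0 => ?_
    have h0 : κ₀ ≤ κ := mem_Iic.mp h0
    have : #(pts κ \ pts κ₀) = ∑ a, (κ - κ₀) a := by
      rw [card_sdiff_of_subset (pts_mono h0), card_pts, card_pts]
      simp only [Pi.sub_apply]
      rw [Finset.sum_tsub_distrib _ fun a _ => h0 a]
    simp only [this]
  rw [e, ← sum_image (f := fun S => (-1) ^ #(pts κ \ S) *
    M.inter i j n (M.p j q n) (pts κ) S) (g := pts) hinj]
  refine sum_subset ?_ ?_
  · intro S hS
    obtain ⟨κ₀, h0, rfl⟩ := mem_image.mp hS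
    exact mem_powerset.mpr (pts_mono (mem_Iic.mp h0))
  · intro S hS hS'
    rw [M.inter_eq_zero i j n _ κ S (mem_powerset.mp hS), mul_zero]
    rintro κ₀ h0 rfl
    exact hS' (mem_image_of_mem _ (mem_Iic.mpr h0))

theorem sum_antidiagonal_piAntidiag {i : I} (m : ℕ) (F : (R i → ℕ) → (R i → ℕ) → ℂ) :
    ∑ k ∈ antidiagonal m, ∑ κ ∈ piAntidiag univ k.1, ∑ κ' ∈ piAntidiag univ k.2, F κ κ' =
      ∑ κ ∈ piAntidiag univ m, ∑ κ₀ ∈ Iic κ, F κ₀ (κ - κ₀) := by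
  simp only [sum_sigma']
  refine sum_bij' (fun x _ => ⟨x.2.1 + x.2.2, x.2.1⟩)
    (fun y _ => ⟨(∑ a, y.2 a, ∑ a, (y.1 - y.2) a), ⟨y.2, y.1 - y.2⟩⟩) ?_ ?_ ?_ ?_ ?_
  · rintro ⟨⟨k, l⟩, κ, κ'⟩ h
    simp only [mem_sigma, HasAntidiagonal.mem_antidiagonal, mem_piAntidiag, mem_univ, implies_true, and_true,
      mem_Iic] at h ⊢
    refine ⟨?_, fun a => by simp⟩
    simp only [Pi.add_apply, sum_add_distrib]
    exact (congrArg₂ (· + ·) h.2.1 h.2.2).trans h.1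
  · rintro ⟨κ, κ₀⟩ h
    simp only [mem_sigma, HasAntidiagonal.mem_antidiagonal, mem_piAntidiag, mem_univ, implies_true, and_true,
      mem_Iic] at h ⊢
    have h2 := h.2
    rw [← sum_add_distrib, ← h.1]
    exact sum_congr rfl fun a _ => add_tsub_cancel_of_le (h2 a)
  · rintro ⟨⟨k, l⟩, κ, κ'⟩ h
    simp only [mem_sigma, HasAntidiagonal.mem_antidiagonal, mem_piAntidiag, mem_univ, implies_true, and_true] at h
    obtain ⟨-, rfl, rfl⟩ := h
    simp
  · rintro ⟨κ, κ₀⟩ h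
    simp only [mem_sigma, mem_Iic] at h
    have : κ₀ + (κ - κ₀) = κ := add_tsub_cancel_of_le h.2
    simp [this]
  · rintro ⟨⟨k, l⟩, κ, κ'⟩ h
    simp

/-- The Serre relation for a single weight function `f`. -/
theorem adMap_X_pow_eq_zero {i j : I} (hij : i ≠ j) {m : ℕ} (hm : 0 < m)
    (hc : 2 * M.c i j = -((m : ℂ) - 1) * M.δ i) (f g : ℂ → ℂ) :
    (adMap (M.X i f) ^ m) (M.X j g) = 0 := by
  rw [adMap_pow_apply]
  refine LinearMap.ext fun ψ => funext fun n => ?_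
  rw [LinearMap.sum_apply, Finset.sum_apply]
  simp only [LinearMap.smul_apply, Pi.smul_apply, smul_eq_mul, X_pow_mul_X_mul_X_pow_apply M hij]
  -- The binomial coefficient absorbs the factorials of the two powers, so all terms carry the same
  -- factor m!.
  have h1 : ∀ k ∈ antidiagonal m, ((-1 : ℂ) ^ k.2 * m.choose k.2) *
      (k.1.factorial * k.2.factorial *
      ∑ q, ∑ κ ∈ piAntidiag univ k.1, ∑ κ' ∈ piAntidiag univ k.2,
        g (M.p j q n) * M.A j n (M.p j q n) * M.wt i f n (κ + κ') *
          M.inter i j n (M.p j q n) (pts (κ + κ')) (pts κ) *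
            ψ (n + M.steps (κ + κ') + M.e j q)) = m.factorial *
      ∑ q, ∑ κ ∈ piAntidiag univ k.1, ∑ κ' ∈ piAntidiag univ k.2, (-1 : ℂ) ^ (∑ a, κ' a) *
        (g (M.p j q n) * M.A j n (M.p j q n) * M.wt i f n (κ + κ') *
          M.inter i j n (M.p j q n) (pts (κ + κ')) (pts κ) *
            ψ (n + M.steps (κ + κ') + M.e j q)) := by
    intro k hk
    rw [HasAntidiagonal.mem_antidiagonal] at hk
    have h2 : ((m.choose k.2 : ℕ) : ℂ) * (k.1.factorial * k.2.factorial) = m.factorial := by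
      have := Nat.choose_mul_factorial_mul_factorial (show k.2 ≤ m by omega)
      rw [show m - k.2 = k.1 by omega] at this
      rw [← this]; push_cast; ring
    rw [← h2]
    have h3 : ∀ q : R j, ∑ κ ∈ piAntidiag univ k.1, ∑ κ' ∈ piAntidiag univ k.2,
        (-1 : ℂ) ^ (∑ a, κ' a) *
        (g (M.p j q n) * M.A j n (M.p j q n) * M.wt i f n (κ + κ') *
          M.inter i j n (M.p j q n) (pts (κ + κ')) (pts κ) *
            ψ (n + M.steps (κ + κ') + M.e j q)) = (-1 : ℂ) ^ k.2 *
        ∑ κ ∈ piAntidiag univ k.1, ∑ κ' ∈ piAntidiag univ k.2,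
        (g (M.p j q n) * M.A j n (M.p j q n) * M.wt i f n (κ + κ') *
          M.inter i j n (M.p j q n) (pts (κ + κ')) (pts κ) *
            ψ (n + M.steps (κ + κ') + M.e j q)) := by
      intro q
      rw [mul_sum]
      refine sum_congr rfl fun κ _ => ?_
      rw [mul_sum]
      refine sum_congr rfl fun κ' hκ' => ?_
      rw [(mem_piAntidiag.mp hκ').1]
    rw [sum_congr rfl fun q _ => h3 q, ← mul_sum]
    ring
  rw [sum_congr rfl h1, ← mul_sum, sum_comm]
  refine mul_eq_zero_of_right _ (sum_eq_zero fun q _ => ?_)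
  rw [sum_antidiagonal_piAntidiag m fun κ κ' => (-1 : ℂ) ^ (∑ a, κ' a) *
        (g (M.p j q n) * M.A j n (M.p j q n) * M.wt i f n (κ + κ') *
          M.inter i j n (M.p j q n) (pts (κ + κ')) (pts κ) *
            ψ (n + M.steps (κ + κ') + M.e j q))]
  refine sum_eq_zero fun κ hκ => ?_
  have hκm := (mem_piAntidiag.mp hκ).1
  have h4 := M.sum_Iic_inter hij n q κ (by rw [hκm]; exact hm) (by rw [hκm]; exact hc)
  rw [← mul_zero (g (M.p j q n) * M.A j n (M.p j q n) * M.wt i f n κ *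
    ψ (n + M.steps κ + M.e j q)), ← h4, mul_sum]
  refine sum_congr rfl fun κ₀ h0 => ?_
  rw [add_tsub_cancel_of_le (mem_Iic.mp h0)]
  ring

end StringModel

/-- Polarization: the symmetrization of a product is a combination of powers of sums. -/
theorem sum_perm_list_prod {W : Type*} [Ring W] [Algebra ℂ W] {m : ℕ} (y : Fin m → W) :
    ∑ π : Equiv.Perm (Fin m), (List.ofFn fun k => y (π k)).prod =
      ∑ T : Finset (Fin m), (-1 : ℂ) ^ (m - #T) • (∑ t ∈ T, y t) ^ m := by
  have h1 : ∀ T : Finset (Fin m), (∑ t ∈ T, y t) ^ m =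
      ∑ φ : Fin m → Fin m, if ∀ k, φ k ∈ T then (List.ofFn fun k => y (φ k)).prod else 0 := by
    intro T
    have := (MultilinearMap.mkPiAlgebraFin ℂ m W).map_sum_finset (fun _ t => y t) (fun _ => T)
    simp only [MultilinearMap.mkPiAlgebraFin_apply, List.ofFn_const, List.prod_replicate] at this
    rw [this, ← sum_filter]
    refine sum_congr ?_ fun _ _ => rfl
    ext φ
    simp [Fintype.mem_piFinset]
  simp only [h1, smul_sum]
  rw [sum_comm]
  have h2 : ∀ φ : Fin m → Fin m, ∑ T : Finset (Fin m), (-1 : ℂ) ^ (m - #T) •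
      (if ∀ k, φ k ∈ T then (List.ofFn fun k => y (φ k)).prod else 0) =
      if Function.Bijective φ then (List.ofFn fun k => y (φ k)).prod else 0 := by
    intro φ
    -- Inclusion–exclusion: the sets T containing the image of φ correspond to the subsets of its
    -- complement, whose alternating sum vanishes unless the complement is empty.
    have h3 : ∑ T : Finset (Fin m), (if ∀ k, φ k ∈ T then (-1 : ℂ) ^ (m - #T) else 0) =
        if Function.Bijective φ then 1 else 0 := by
      have h4 : ∑ T : Finset (Fin m), (if ∀ k, φ k ∈ T then (-1 : ℂ) ^ (m - #T) else 0) =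
          ∑ S ∈ (univ.image φ)ᶜ.powerset, (-1 : ℂ) ^ #S := by
        rw [← sum_filter]
        refine sum_bij' (fun T _ => Tᶜ) (fun S _ => Sᶜ) ?_ ?_ ?_ ?_ ?_
        · intro T hT
          simp only [mem_filter, mem_univ, true_and] at hT
          rw [mem_powerset, compl_subset_compl]
          intro x hx
          obtain ⟨k, -, rfl⟩ := mem_image.mp hx
          exact hT k
        · intro S hS
          simp only [mem_filter, mem_univ, true_and]
          intro k
          rw [mem_compl]
          intro hk
          have := mem_powerset.mp hS hk
          simp at this
        · intro T _; simp
        · intro T _; simp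
        · intro T _
          rw [card_compl, Fintype.card_fin]
      rw [h4]
      have h5 := Finset.sum_powerset_neg_one_pow_card (x := (univ.image φ)ᶜ)
      have h6 : ((univ.image φ)ᶜ = ∅) ↔ Function.Bijective φ := by
        rw [compl_eq_empty_iff, ← Finite.surjective_iff_bijective,
          Finset.eq_univ_iff_forall]
        simp [Function.Surjective]
      have h7 := congrArg (Int.cast : ℤ → ℂ) h5
      push_cast at h7
      rw [h7]
      simp only [h6]
    by_cases hφ : Function.Bijective φ
    · rw [if_pos hφ] at h3 ⊢
      refine Eq.trans ?_ (one_smul ℂ _)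
      conv_rhs => rw [← h3, Finset.sum_smul]
      exact sum_congr rfl fun T _ => by split_ifs <;> simp
    · rw [if_neg hφ] at h3 ⊢
      refine Eq.trans ?_ (zero_smul ℂ (List.ofFn fun k => y (φ k)).prod)
      conv_rhs => rw [← h3, Finset.sum_smul]
      exact sum_congr rfl fun T _ => by split_ifs <;> simp
  rw [sum_congr rfl fun φ _ => h2 φ, ← sum_filter]
  refine sum_bij (fun π _ => (π : Fin m → Fin m)) ?_ ?_ ?_ ?_
  · intro π _; exact mem_filter.mpr ⟨mem_univ _, π.bijective⟩
  · intro π _ π' _ h; exact Equiv.ext (congrFun h)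
  · intro φ hφ
    exact ⟨Equiv.ofBijective φ (mem_filter.mp hφ).2, mem_univ _, rfl⟩
  · intro π _; rfl

theorem foldr_lie_eq {W : Type*} [Ring W] [Algebra ℂ W] {α : Type*} (x : α → W) (l : List α) (y : W) :
    l.foldr (fun t z => ⁅x t, z⁆) y = ((l.map fun t => adMap (x t)).prod) y := by
  induction l with
  | nil => simp
  | cons t l ih => simp [ih, adMap_apply]

namespace StringModel

variable {I : Type*} {R : I → Type*} [∀ i, Fintype (R i)] {Ω : Type*}
  [AddCommMonoid Ω] (M : StringModel I R Ω) [∀ i, DecidableEq (R i)]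

/-- The Serre relations. -/
theorem serre {i j : I} (hij : i ≠ j) {m : ℕ} (hm : 0 < m)
    (hc : 2 * M.c i j = -((m : ℂ) - 1) * M.δ i) (f : ℕ → ℂ → ℂ) (g : ℂ → ℂ) (r : Fin m → ℕ) :
    ∑ π : Equiv.Perm (Fin m), (List.ofFn fun k => r (π k)).foldr
      (fun t y => ⁅M.X i (f t), y⁆) (M.X j g) = 0 := by
  simp only [foldr_lie_eq (fun t => M.X i (f t)), List.map_ofFn, Function.comp_def]
  -- Polarization leaves powers of one operator, because a sum of shift operators of one colour is
  -- the shift operator of the summed weight.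
  rw [← LinearMap.sum_apply, sum_perm_list_prod fun k => adMap (M.X i (f (r k))),
    LinearMap.sum_apply]
  refine sum_eq_zero fun T _ => ?_
  rw [← map_sum, ← X_sum, LinearMap.smul_apply, M.adMap_X_pow_eq_zero hij hm hc, smul_zero]

end StringModel

end StringModel

/-! ### A product of shift operators that does not vanish. -/

section StringModel

set_option linter.unusedSectionVars false

open Finset

namespace StringModel

variable {I : Type*} {R : I → Type*} [∀ i, Fintype (R i)] {Ω : Type*}
  [AddCommMonoid Ω] (M : StringModel I R Ω) [∀ i, DecidableEq (R i)]

theorem p_add (i : I) (a b : R i) (n : Ω) :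
    M.p i a (n + M.e i b) = M.p i a n + if b = a then M.δ i else 0 := by
  split_ifs with h
  · rw [h, M.p_self]
  · rw [M.p_of_ne _ _ _ _ (Ne.symm h), add_zero]

/-- Evaluated on a function that detects two steps along q and one along r, each of the two orders
leaves a single term, with the same nonzero costs but with γ_{ij} and γ_{ji} respectively. If these
agreed, the exchange rule would give 2 c_{ij} γ_{ij} = 0. -/
theorem X_mul_lie_ne_zero {i j : I} (hij : i ≠ j) (hc : M.c i j ≠ 0) (r : R i) (q : R j) (n : Ω)
    (hA : ∀ i a n, M.A i n (M.p i a n) ≠ 0)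
    (hγ : M.γ i j (M.p i r n) (M.p j q (n + M.e j q)) ≠ 0) :
    M.X j 1 * (M.X j 1 * M.X i 1 - M.X i 1 * M.X j 1) ≠ 0 := by
  intro h0
  have hδ := M.δ_ne_zero
  -- Two coordinates suffice: exactly two steps have colour j and one has colour i, so the final
  -- positions of q and r identify the strings used.
  set ψ : Ω → ℂ := fun x => if M.p j q x = M.p j q n + 2 * M.δ j ∧
    M.p i r x = M.p i r n + M.δ i then 1 else 0 with hψ
  have hsum : ∀ b b' : R j, M.p j q n + (if b = q then M.δ j else 0) +
      (if b' = q then M.δ j else 0) = M.p j q n + 2 * M.δ j ↔ b = q ∧ b' = q := by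
    intro b b'
    have := hδ j
    by_cases h1 : b = q
    · by_cases h2 : b' = q
      · simp only [h1, h2, if_true, and_self, iff_true]; ring
      · simp only [h1, h2, if_true, if_false, and_false, iff_false]
        intro h3; apply this; linear_combination -h3
    · by_cases h2 : b' = q
      · simp only [h1, h2, if_true, if_false, false_and, iff_false]
        intro h3; apply this; linear_combination -h3
      · simp only [h1, h2, if_false, false_and, iff_false]
        intro h3; apply this; linear_combination (-1/2 : ℂ) * h3
  have hsum' : ∀ a : R i, M.p i r n + (if a = r then M.δ i else 0) = M.p i r n + M.δ i ↔
      a = r := by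
    intro a
    by_cases h1 : a = r
    · simp [h1]
    · simpa [h1] using hδ i
  have h1 : ∀ b b' a, ψ (n + M.e j b + M.e j b' + M.e i a) =
      if b = q then (if b' = q then (if a = r then 1 else 0) else 0) else 0 := by
    intro b b' a
    have h1 : M.p j q (n + M.e j b + M.e j b' + M.e i a) = M.p j q n +
        (if b = q then M.δ j else 0) + (if b' = q then M.δ j else 0) := by
      rw [M.p_of_ne_color _ _ _ _ _ hij.symm, p_add, p_add]
    have h2 : M.p i r (n + M.e j b + M.e j b' + M.e i a) = M.p i r n +
        (if a = r then M.δ i else 0) := by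
      rw [p_add, M.p_of_ne_color _ _ _ _ _ hij, M.p_of_ne_color _ _ _ _ _ hij]
    simp only [hψ, h1, h2, hsum, hsum']
    by_cases h1 : b = q <;> by_cases h2 : b' = q <;> by_cases h3 : a = r <;> simp [h1, h2, h3]
  have h2 : ∀ b a b', ψ (n + M.e j b + M.e i a + M.e j b') =
      if b = q then (if a = r then (if b' = q then 1 else 0) else 0) else 0 := by
    intro b a b'
    rw [add_right_comm, h1]
    by_cases h1 : b = q <;> by_cases h2 : b' = q <;> by_cases h3 : a = r <;> simp [h1, h2, h3]
  have h := congrFun (LinearMap.congr_fun h0 ψ) n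
  rw [Module.End.mul_apply, LinearMap.sub_apply, map_sub, Pi.sub_apply, X_apply, X_apply] at h
  simp only [X_mul_X_apply, h1, h2, mul_ite, mul_one, mul_zero, sum_ite_eq', mem_univ, if_true,
    sum_ite_irrel, sum_const_zero, Pi.one_apply, one_mul] at h
  have e1 : M.p j q (n + M.e j q + M.e i r) = M.p j q (n + M.e j q) :=
    M.p_of_ne_color _ _ _ _ _ hij.symm
  have e2 : M.p i r (n + M.e j q + M.e j q) = M.p i r (n + M.e j q) :=
    M.p_of_ne_color _ _ _ _ _ hij
  have e3 : M.p i r (n + M.e j q) = M.p i r n := M.p_of_ne_color _ _ _ _ _ hij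
  have a1 := M.A_add i j r q (n + M.e j q) 0 (fun h => absurd h hij)
  have a2 := M.A_add j i q r (n + M.e j q) 0 (fun h => absurd h.symm hij)
  have a3 := M.γ_cross i j r q (n + M.e j q) 0 hij
  simp only [Nat.cast_zero, zero_mul, add_zero] at a1 a2 a3
  rw [e1, e2, a1, a2] at h
  have h5 : M.γ i j (M.p i r (n + M.e j q)) (M.p j q (n + M.e j q)) -
      M.γ j i (M.p j q (n + M.e j q)) (M.p i r (n + M.e j q)) = 0 := by
    have h6 := hA j q n
    have h7 := hA j q (n + M.e j q)
    have h8 := hA i r (n + M.e j q)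
    refine (mul_eq_zero.mp (?_ : (M.A j n (M.p j q n) *
      M.A j (n + M.e j q) (M.p j q (n + M.e j q)) *
      M.A i (n + M.e j q) (M.p i r (n + M.e j q))) * _ = 0)).resolve_left
      (mul_ne_zero (mul_ne_zero h6 h7) h8)
    simp only [LinearMap.zero_apply, Pi.zero_apply] at h
    linear_combination h
  rw [e3] at h5 a3
  refine mul_ne_zero (mul_ne_zero (two_ne_zero (α := ℂ)) hc) hγ ?_
  linear_combination -a3 - (M.p i r n - M.p j q (n + M.e j q) + M.c i j) * (-h5)

end StringModel

end StringModel

/-! ### Numerical data for the difference operators and the two string models they define. -/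

noncomputable section Representation

set_option linter.unusedSectionVars false

open Finset

/-- Numerical data which determine a representation of the Yangian by difference operators: `m i`
strings of points for each colour `i`, starting at the points `w₀` in general position. -/
structure DifferenceData (I : Type*) [Fintype I] [LinearOrder I] where
  /-- the Cartan matrix -/
  A : Matrix I I ℤ
  /-- the symmetrising numbers -/
  d : I → ℂ
  /-- the deformation parameter -/
  ħ : ℂ
  /-- the number of strings -/
  m : I → ℕ
  /-- the starting points -/
  w₀ : (Σ i, Fin (m i)) → ℂ
  /-- a subgroup that contains all differences of interest -/
  Λ : AddSubgroup ℂ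
  A_self : ∀ i, A i i = 2
  A_nonpos : ∀ i j, i ≠ j → A i j ≤ 0
  A_symm : ∀ i j, d i * A i j = d j * A j i
  d_ne_zero : ∀ i, d i ≠ 0
  ħ_ne_zero : ħ ≠ 0
  m_pos : ∀ i, 0 < m i
  m_dominant : ∀ i, 0 ≤ ∑ j, (m j : ℤ) * A j i
  δ_mem : ∀ i, ħ * d i ∈ Λ
  c_mem : ∀ i j, ħ * (d i * A i j / 2) ∈ Λ
  w₀_notMem : ∀ x, w₀ x ∉ Λ
  w₀_sub_notMem : ∀ x y, x ≠ y → w₀ x - w₀ y ∉ Λ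

namespace DifferenceData

variable {I : Type*} [Fintype I] [LinearOrder I] (D : DifferenceData I)

/-- The step of a string. -/
def δ (i : I) : ℂ := D.ħ * D.d i

/-- The interaction constants. -/
def c (i j : I) : ℂ := D.ħ * (D.d i * D.A i j / 2)

/-- The states. -/
abbrev Ω : Type _ := (Σ i, Fin (D.m i)) → ℤ

/-- The next point of a string. -/
def w (x : Σ i, Fin (D.m i)) (n : D.Ω) : ℂ := D.w₀ x + n x * D.δ x.1

/-- `-a_{ij}` for `i ≠ j`. -/
def N (i j : I) : ℕ := (-D.A i j).toNat

/-- The order of the zero of the cost at `0`. -/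
def l (i : I) : ℕ := (∑ j, (D.m j : ℤ) * D.A j i).toNat

theorem δ_ne_zero (i : I) : D.δ i ≠ 0 := mul_ne_zero D.ħ_ne_zero (D.d_ne_zero i)

theorem c_self (i : I) : D.c i i = D.δ i := by
  simp only [c, δ, D.A_self]; push_cast; ring

theorem c_symm (i j : I) : D.c i j = D.c j i := by
  simp only [c, D.A_symm]

theorem N_cast {i j : I} (hij : i ≠ j) : (D.N i j : ℂ) = -D.A i j := by
  have := D.A_nonpos i j hij
  have h : ((D.N i j : ℕ) : ℤ) = -D.A i j := Int.toNat_of_nonneg (by omega)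
  exact_mod_cast congrArg (Int.cast : ℤ → ℂ) h

theorem two_mul_c {i j : I} (hij : i ≠ j) : 2 * D.c i j = -(D.N j i * D.δ j) := by
  rw [D.N_cast hij.symm, D.c_symm]
  simp only [c, δ]
  ring

theorem w_add_single (x y : Σ i, Fin (D.m i)) (n : D.Ω) :
    D.w x (n + Pi.single y 1) = D.w x n + if x = y then D.δ x.1 else 0 := by
  simp only [w, Pi.add_apply, Pi.single_apply]
  split_ifs <;> push_cast <;> ring

theorem w_sub_single (x y : Σ i, Fin (D.m i)) (n : D.Ω) :
    D.w x (n - Pi.single y 1) = D.w x n - if x = y then D.δ x.1 else 0 := by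
  simp only [w, Pi.sub_apply, Pi.single_apply]
  split_ifs <;> push_cast <;> ring

theorem w_sub_w_notMem {x y : Σ i, Fin (D.m i)} (hxy : x ≠ y) (n n' : D.Ω) :
    D.w x n - D.w y n' ∉ D.Λ := by
  intro h
  refine D.w₀_sub_notMem x y hxy ?_
  have e : D.w₀ x - D.w₀ y = D.w x n - D.w y n' - n x • D.δ x.1 + n' y • D.δ y.1 := by
    simp only [w, zsmul_eq_mul]; ring
  rw [e]
  exact add_mem (sub_mem h (zsmul_mem (D.δ_mem _) _)) (zsmul_mem (D.δ_mem _) _)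

theorem w_sub_w_add_ne_zero {x y : Σ i, Fin (D.m i)} (hxy : x ≠ y) (n n' : D.Ω) {s : ℂ}
    (hs : s ∈ D.Λ) : D.w x n - D.w y n' + s ≠ 0 := by
  intro h
  refine D.w_sub_w_notMem hxy n n' ?_
  rw [eq_neg_of_add_eq_zero_left h]
  exact neg_mem hs

theorem natCast_mul_δ_mem (k : ℕ) (i : I) : k * D.δ i ∈ D.Λ := by
  rw [← nsmul_eq_mul]; exact nsmul_mem (D.δ_mem i) k

theorem intCast_mul_δ_mem (k : ℤ) (i : I) : k * D.δ i ∈ D.Λ := by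
  rw [← zsmul_eq_mul]; exact zsmul_mem (D.δ_mem i) k

/-- The polynomial by which a string of colour `j` enters the cost of a point of colour `i`. -/
def τ (i j : I) (x : ℂ) : ℂ := ∏ k ∈ range (D.N j i), (x - D.c i j - k * D.δ j)

/-- The product runs over an arithmetic progression with step δ_j, so the shift trades its last
factor for a new first one. The last factor is x + c_{ij} because 2c_{ij} = -N_{ji} δ_j. -/
theorem τ_sub {i j : I} (hij : i ≠ j) (x : ℂ) :
    D.τ i j (x - D.δ j) * (x - D.c i j) = D.τ i j x * (x + D.c i j) := by
  have h1 := prod_range_succ (fun k : ℕ => x - D.c i j - k * D.δ j) (D.N j i)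
  have h2 := prod_range_succ' (fun k : ℕ => x - D.c i j - k * D.δ j) (D.N j i)
  have e : ∀ k : ℕ, x - D.c i j - ((k + 1 : ℕ) : ℂ) * D.δ j = x - D.δ j - D.c i j - k * D.δ j := by
    intro k; push_cast; ring
  simp only [e] at h2
  rw [h1] at h2
  simp only [τ]
  rw [show x + D.c i j = x - D.c i j - D.N j i * D.δ j by linear_combination D.two_mul_c hij, h2]
  simp

/-- The factors of the cost of adding a point. -/
def ρ (i j : I) (x : ℂ) : ℂ := if i = j then (x + D.δ i)⁻¹ else if i < j then D.τ i j x else 1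

/-- The factors of the cost of removing a point. -/
def ρ' (i j : I) (x : ℂ) : ℂ := if i = j then x⁻¹ else if j < i then D.τ i j x else 1

/-- The cost of adding a point. -/
def costA (i : I) (n : D.Ω) (u : ℂ) : ℂ := u ^ D.l i * ∏ y, D.ρ i y.1 (u - D.w y n)

/-- The cost of removing a point. -/
def costB (i : I) (n : D.Ω) (u : ℂ) : ℂ := D.d i * ∏ y, D.ρ' i y.1 (u - D.w y n)

/-- The interaction of points. -/
def γ (i j : I) (u v : ℂ) : ℂ := if i = j then (u - v + D.δ i) / (u - v) else
  if i < j then (u - v + D.c i j) / (u - v - D.c i j) else 1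

/-- Only the factor belonging to the string y changes: by cancellation of inverse linear factors for
equal colours, and by `τ_sub` for i < y.1. General position keeps denominators away from zero. On
the string of the point itself the relevant difference is (k + 1)δ, which is nonzero for a different
reason. -/
theorem costA_add (i : I) (a : Fin (D.m i)) (y : Σ i, Fin (D.m i)) (n : D.Ω) (k : ℕ)
    (h : i = y.1 → D.w ⟨i, a⟩ n + k * D.δ i ≠ D.w y n) :
    D.costA i (n + Pi.single y 1) (D.w ⟨i, a⟩ n + k * D.δ i) =
      D.γ i y.1 (D.w ⟨i, a⟩ n + k * D.δ i) (D.w y n) *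
        D.costA i n (D.w ⟨i, a⟩ n + k * D.δ i) := by
  set u := D.w ⟨i, a⟩ n + k * D.δ i with hu
  have h1 : D.ρ i y.1 (u - D.w y (n + Pi.single y 1)) =
      D.γ i y.1 u (D.w y n) * D.ρ i y.1 (u - D.w y n) := by
    rw [w_add_single, if_pos rfl]
    by_cases hi : i = y.1
    · have h2 : u - D.w y n ≠ 0 := sub_ne_zero.mpr (h hi)
      have h3 : u - D.w y n + D.δ y.1 ≠ 0 := by
        rw [hu]
        by_cases hy : (⟨i, a⟩ : Σ i, Fin (D.m i)) = y
        · rw [hy, ← hi]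
          have : ((k + 1 : ℕ) : ℂ) * D.δ i ≠ 0 :=
            mul_ne_zero (Nat.cast_ne_zero.mpr (Nat.succ_ne_zero k)) (D.δ_ne_zero i)
          push_cast at this
          convert this using 1; ring
        · have := D.w_sub_w_add_ne_zero hy n n (add_mem (D.natCast_mul_δ_mem k i) (D.δ_mem y.1))
          convert this using 1; simp only [δ]; ring
      simp only [ρ, γ, hi, if_true]
      rw [show u - (D.w y n + D.δ y.1) + D.δ y.1 = u - D.w y n by ring]
      field_simp
    · have hy : (⟨i, a⟩ : Σ i, Fin (D.m i)) ≠ y := fun h => hi (congrArg Sigma.fst h)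
      by_cases hlt : i < y.1
      · simp only [ρ, γ, hi, hlt, if_true, if_false]
        have h3 : u - D.w y n - D.c i y.1 ≠ 0 := by
          have := D.w_sub_w_add_ne_zero hy n n
            (sub_mem (D.natCast_mul_δ_mem k i) (D.c_mem i y.1))
          rw [hu]
          convert this using 1; simp only [c]; ring
        have h4 := D.τ_sub hi (u - D.w y n)
        rw [show u - (D.w y n + D.δ y.1) = u - D.w y n - D.δ y.1 by ring]
        field_simp
        linear_combination h4
      · simp only [ρ, γ, hi, hlt, if_false, one_mul]
  rw [costA, costA, ← mul_prod_erase univ _ (mem_univ y), h1,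
    ← mul_prod_erase univ (fun y => D.ρ i y.1 (u - D.w y n)) (mem_univ y)]
  have h2 : ∏ x ∈ univ.erase y, D.ρ i x.1 (u - D.w x (n + Pi.single y 1)) =
      ∏ x ∈ univ.erase y, D.ρ i x.1 (u - D.w x n) := by
    refine prod_congr rfl fun x hx => ?_
    rw [w_add_single, if_neg (mem_erase.mp hx).1, add_zero]
  rw [h2]
  ring

/-- The same computation as for `costA_add`, with the arguments of the interaction interchanged. It
agrees with the γ of the adding model, as the commutation of adding and removing requires. -/
theorem costB_sub (i : I) (a : Fin (D.m i)) (y : Σ i, Fin (D.m i)) (n : D.Ω) (k : ℕ)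
    (h : i = y.1 → D.w ⟨i, a⟩ n - D.δ i - k * D.δ i ≠ D.w y n - D.δ y.1) :
    D.costB i (n - Pi.single y 1) (D.w ⟨i, a⟩ n - D.δ i - k * D.δ i) =
      D.γ y.1 i (D.w y n - D.δ y.1) (D.w ⟨i, a⟩ n - D.δ i - k * D.δ i) *
        D.costB i n (D.w ⟨i, a⟩ n - D.δ i - k * D.δ i) := by
  set u := D.w ⟨i, a⟩ n - D.δ i - k * D.δ i with hu
  have h1 : D.ρ' i y.1 (u - D.w y (n - Pi.single y 1)) =
      D.γ y.1 i (D.w y n - D.δ y.1) u * D.ρ' i y.1 (u - D.w y n) := by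
    rw [w_sub_single, if_pos rfl]
    by_cases hi : i = y.1
    · have h2 : D.w y n - D.δ y.1 - u ≠ 0 := sub_ne_zero.mpr (h hi).symm
      have h3 : u - D.w y n ≠ 0 := by
        rw [hu]
        by_cases hy : (⟨i, a⟩ : Σ i, Fin (D.m i)) = y
        · rw [hy]
          have : -((k + 1 : ℕ) : ℂ) * D.δ i ≠ 0 :=
            mul_ne_zero (neg_ne_zero.mpr (Nat.cast_ne_zero.mpr (Nat.succ_ne_zero k)))
              (D.δ_ne_zero i)
          push_cast at this
          convert this using 1; ring
        · have := D.w_sub_w_add_ne_zero hy n n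
            (neg_mem (add_mem (D.natCast_mul_δ_mem k i) (D.δ_mem i)))
          convert this using 1; simp only [δ]; ring
      have h2' : u - (D.w y n - D.δ y.1) ≠ 0 := fun h => h2 (by linear_combination -h)
      simp only [ρ', γ, hi, if_true]
      field_simp
      ring
    · have hy : (⟨i, a⟩ : Σ i, Fin (D.m i)) ≠ y := fun h => hi (congrArg Sigma.fst h)
      have hi' : y.1 ≠ i := Ne.symm hi
      by_cases hlt : y.1 < i
      · simp only [ρ', γ, hi, hi', hlt, if_true, if_false]
        have h3 : D.w y n - D.δ y.1 - u - D.c y.1 i ≠ 0 := by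
          have := D.w_sub_w_add_ne_zero hy n n
            (add_mem (sub_mem (D.δ_mem y.1) (add_mem (D.natCast_mul_δ_mem k i) (D.δ_mem i)))
              (D.c_mem y.1 i))
          intro h3
          refine this ?_
          simp only [c, δ] at h3 hu
          rw [hu] at h3
          simp only [δ]
          linear_combination -h3
        have h4 := D.τ_sub hi (u - D.w y n + D.δ y.1)
        rw [show u - (D.w y n - D.δ y.1) = u - D.w y n + D.δ y.1 by ring]
        rw [add_sub_cancel_right, D.c_symm] at h4
        field_simp
        linear_combination h4
      · simp only [ρ', γ, hi, hi', hlt, if_false, one_mul]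
  rw [costB, costB, ← mul_prod_erase univ _ (mem_univ y), h1,
    ← mul_prod_erase univ (fun y => D.ρ' i y.1 (u - D.w y n)) (mem_univ y)]
  have h2 : ∏ x ∈ univ.erase y, D.ρ' i x.1 (u - D.w x (n - Pi.single y 1)) =
      ∏ x ∈ univ.erase y, D.ρ' i x.1 (u - D.w x n) := by
    refine prod_congr rfl fun x hx => ?_
    rw [w_sub_single, if_neg (mem_erase.mp hx).1, sub_zero]
  rw [h2]
  ring

theorem γ_exchange {i j : I} (hij : i ≠ j) {u v : ℂ} (h1 : u - v - D.c i j ≠ 0)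
    (h2 : v - u - D.c j i ≠ 0) :
    (u - v - D.c i j) * D.γ i j u v = (u - v + D.c i j) * D.γ j i v u := by
  rcases lt_or_gt_of_ne hij with h | h
  · simp only [γ, hij, hij.symm, h, h.not_gt, if_true, if_false]
    field_simp
  · simp only [γ, hij, hij.symm, h, h.not_gt, if_true, if_false]
    rw [D.c_symm j i] at h2 ⊢
    field_simp
    ring

/-- The model in which points are added. -/
def modelA : StringModel I (fun i => Fin (D.m i)) D.Ω where
  e i a := Pi.single ⟨i, a⟩ 1
  p i a n := D.w ⟨i, a⟩ n
  δ := D.δ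
  A := D.costA
  γ := D.γ
  c := D.c
  δ_ne_zero := D.δ_ne_zero
  p_self i a n := by rw [w_add_single, if_pos rfl]
  p_of_ne i a b n h := by
    rw [w_add_single, if_neg (by simpa using h), add_zero]
  p_of_ne_color i j a b n h := by
    rw [w_add_single, if_neg (fun h' => h (congrArg Sigma.fst h')), add_zero]
  p_sub_ne i a b n k h h' := D.w_sub_w_notMem
    (x := ⟨i, a⟩) (y := ⟨i, b⟩) (fun h' => h (eq_of_heq (Sigma.mk.inj h').2)) n n
    (h' ▸ D.intCast_mul_δ_mem k i)
  c_self := D.c_self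
  γ_self i u v := by simp [γ]
  sub_sub_c_ne_zero i j a b n k h := by
    have := D.w_sub_w_add_ne_zero (x := ⟨i, a⟩) (y := ⟨j, b⟩)
      (fun h' => h (Sigma.mk.inj h').1) n n (sub_mem (D.natCast_mul_δ_mem k i) (D.c_mem i j))
    convert this using 1; simp only [c]; ring
  γ_cross i j a b n k h := by
    refine D.γ_exchange h ?_ ?_
    · have := D.w_sub_w_add_ne_zero (x := ⟨i, a⟩) (y := ⟨j, b⟩)
        (fun h' => h (Sigma.mk.inj h').1) n n (sub_mem (D.natCast_mul_δ_mem k i) (D.c_mem i j))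
      convert this using 1; simp only [c]; ring
    · have := D.w_sub_w_add_ne_zero (x := ⟨j, b⟩) (y := ⟨i, a⟩)
        (fun h' => h (Sigma.mk.inj h').1.symm) n n
        (neg_mem (add_mem (D.natCast_mul_δ_mem k i) (D.c_mem j i)))
      convert this using 1; simp only [c]; ring
  A_add i j a b n k h := D.costA_add i a ⟨j, b⟩ n k h

/-- The model in which points are removed. -/
def modelB : StringModel I (fun i => Fin (D.m i)) D.Ω where
  e i a := -Pi.single ⟨i, a⟩ 1
  -- The point removed is the one added last, which sits one step before the next free point. Adding
  -- and then removing a point thus uses the same spectral value twice.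
  p i a n := D.w ⟨i, a⟩ n - D.δ i
  δ i := -D.δ i
  A := D.costB
  γ i j u v := D.γ j i v u
  c i j := -D.c i j
  δ_ne_zero i := neg_ne_zero.mpr (D.δ_ne_zero i)
  p_self i a n := by rw [← sub_eq_add_neg, w_sub_single, if_pos rfl]; ring
  p_of_ne i a b n h := by
    rw [← sub_eq_add_neg, w_sub_single, if_neg (by simpa using h),
      sub_zero]
  p_of_ne_color i j a b n h := by
    rw [← sub_eq_add_neg, w_sub_single, if_neg (fun h' => h (congrArg Sigma.fst h')), sub_zero]
  p_sub_ne i a b n k h h' := by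
    refine D.w_sub_w_notMem (x := ⟨i, a⟩) (y := ⟨i, b⟩)
      (fun h' => h (eq_of_heq (Sigma.mk.inj h').2)) n n ?_
    have : D.w ⟨i, a⟩ n - D.w ⟨i, b⟩ n = ((-k : ℤ) : ℂ) * D.δ i := by
      push_cast; linear_combination h'
    rw [this]; exact D.intCast_mul_δ_mem _ i
  c_self i := by rw [D.c_self]
  γ_self i u v := by
    simp only [γ, if_true]
    rw [← neg_div_neg_eq]; congr 1 <;> ring
  sub_sub_c_ne_zero i j a b n k h := by
    have := D.w_sub_w_add_ne_zero (x := ⟨i, a⟩) (y := ⟨j, b⟩)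
      (fun h' => h (Sigma.mk.inj h').1) n n (add_mem (sub_mem (D.δ_mem j)
        (add_mem (D.natCast_mul_δ_mem k i) (D.δ_mem i))) (D.c_mem i j))
    convert this using 1; simp only [c, δ]; ring
  γ_cross i j a b n k h := by
    have := D.γ_exchange h.symm (u := D.w ⟨j, b⟩ n - D.δ j)
      (v := D.w ⟨i, a⟩ n - D.δ i + k * -D.δ i) ?_ ?_
    · rw [D.c_symm j i] at this
      linear_combination -this
    · have := D.w_sub_w_add_ne_zero (x := ⟨j, b⟩) (y := ⟨i, a⟩)
        (fun h' => h (Sigma.mk.inj h').1.symm) n n (sub_mem (sub_mem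
        (add_mem (D.natCast_mul_δ_mem k i) (D.δ_mem i)) (D.δ_mem j)) (D.c_mem j i))
      convert this using 1; simp only [c, δ]; ring
    · have := D.w_sub_w_add_ne_zero (x := ⟨i, a⟩) (y := ⟨j, b⟩)
        (fun h' => h (Sigma.mk.inj h').1) n n (sub_mem (sub_mem (D.δ_mem j)
        (add_mem (D.natCast_mul_δ_mem k i) (D.δ_mem i))) (D.c_mem i j))
      convert this using 1; simp only [c, δ]; ring
  A_add i j a b n k h := by
    have e : ∀ k : ℕ, D.w ⟨i, a⟩ n - D.δ i + k * -D.δ i = D.w ⟨i, a⟩ n - D.δ i - k * D.δ i :=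
      fun k => by ring
    rw [e] at h ⊢
    rw [← sub_eq_add_neg]
    exact D.costB_sub i a ⟨j, b⟩ n k h

end DifferenceData

end Representation

/-! ### Commutation of adding and removing points, and the eigenvalues of the Cartan currents. -/

noncomputable section Representation

set_option linter.unusedSectionVars false

open Finset

namespace DifferenceData

variable {I : Type*} [Fintype I] [LinearOrder I] (D : DifferenceData I)

/-- The eigenvalue contribution of adding and removing a point. -/
def cost (x : Σ i, Fin (D.m i)) (n : D.Ω) : ℂ :=
  D.costA x.1 n (D.w x n) * D.costB x.1 (n + Pi.single x 1) (D.w x n)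

/-- The eigenvalues of the Cartan currents. -/
def eigen (i : I) (f : ℂ → ℂ) (n : D.Ω) : ℂ :=
  ∑ a, (f (D.w ⟨i, a⟩ n - D.δ i) * D.cost ⟨i, a⟩ (n - Pi.single ⟨i, a⟩ 1) -
    f (D.w ⟨i, a⟩ n) * D.cost ⟨i, a⟩ n)

theorem w_add_single_self (x : Σ i, Fin (D.m i)) (n : D.Ω) :
    D.w x (n + Pi.single x 1) = D.w x n + D.δ x.1 := by rw [w_add_single, if_pos rfl]

theorem w_sub_single_self (x : Σ i, Fin (D.m i)) (n : D.Ω) :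
    D.w x (n - Pi.single x 1) = D.w x n - D.δ x.1 := by rw [w_sub_single, if_pos rfl]

theorem w_add_single_ne {x y : Σ i, Fin (D.m i)} (h : x ≠ y) (n : D.Ω) :
    D.w x (n + Pi.single y 1) = D.w x n := by rw [w_add_single, if_neg h, add_zero]

theorem w_sub_single_ne {x y : Σ i, Fin (D.m i)} (h : x ≠ y) (n : D.Ω) :
    D.w x (n - Pi.single y 1) = D.w x n := by rw [w_sub_single, if_neg h, sub_zero]

theorem w_ne {x y : Σ i, Fin (D.m i)} (h : x ≠ y) (n n' : D.Ω) : D.w x n ≠ D.w y n' := by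
  have := D.w_sub_w_add_ne_zero h n n' D.Λ.zero_mem
  rw [add_zero] at this
  exact sub_ne_zero.mp this

/-- Undoing the removal at x in the cost of y and the addition at y in the cost of x produces the
same interaction factor γ(w_y, w_x - δ). This makes the off-diagonal terms of [x^+, x^-] cancel. -/
theorem costB_mul_costA {x y : Σ i, Fin (D.m i)} (h : x ≠ y) (n : D.Ω) :
    D.costB x.1 n (D.w x n - D.δ x.1) * D.costA y.1 (n - Pi.single x 1) (D.w y n) =
      D.costA y.1 n (D.w y n) * D.costB x.1 (n + Pi.single y 1) (D.w x n - D.δ x.1) := by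
  obtain ⟨i, a⟩ := x
  obtain ⟨j, b⟩ := y
  have hne : D.w ⟨j, b⟩ n ≠ D.w ⟨i, a⟩ n - D.δ i := by
    have := D.w_sub_w_add_ne_zero h.symm n n (D.δ_mem i)
    intro h'
    exact this (by rw [h']; simp only [δ]; ring)
  have h1 := D.costA_add j b ⟨i, a⟩ (n - Pi.single ⟨i, a⟩ 1) 0
  rw [sub_add_cancel, Nat.cast_zero, zero_mul, add_zero, D.w_sub_single_ne h.symm,
    D.w_sub_single_self] at h1
  have h2 := D.costB_sub i a ⟨j, b⟩ (n + Pi.single ⟨j, b⟩ 1) 0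
  rw [add_sub_cancel_right, Nat.cast_zero, zero_mul, sub_zero, D.w_add_single_ne h,
    D.w_add_single_self, add_sub_cancel_right] at h2
  rw [h1 fun _ => hne, h2 fun _ => hne.symm]
  ring

theorem cost_add_single {x y : Σ i, Fin (D.m i)} (h : x ≠ y) (n : D.Ω) :
    (D.w x n - D.w y n - D.c x.1 y.1) * D.cost x (n + Pi.single y 1) =
      (D.w x n - D.w y n + D.c x.1 y.1) * D.cost x n := by
  obtain ⟨i, a⟩ := x
  obtain ⟨j, b⟩ := y
  have hne := D.w_ne h n n
  have h1 := D.costA_add i a ⟨j, b⟩ n 0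
  rw [Nat.cast_zero, zero_mul, add_zero] at h1
  have h2 := D.costB_sub i a ⟨j, b⟩ (n + Pi.single ⟨j, b⟩ 1 + Pi.single ⟨i, a⟩ 1) 0
  rw [add_right_comm, add_sub_cancel_right, Nat.cast_zero, zero_mul, sub_zero,
    D.w_add_single_self, D.w_add_single_ne h, D.w_add_single_self, D.w_add_single_ne h.symm,
    add_sub_cancel_right, add_sub_cancel_right] at h2
  simp only [cost]
  rw [D.w_add_single_ne h, h1 fun _ => hne, h2 fun _ => hne,
    add_right_comm n (Pi.single (⟨j, b⟩ : Σ i, Fin (D.m i)) 1)]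
  have h3 : (D.w ⟨i, a⟩ n - D.w ⟨j, b⟩ n - D.c i j) * D.γ i j (D.w ⟨i, a⟩ n) (D.w ⟨j, b⟩ n) =
      (D.w ⟨i, a⟩ n - D.w ⟨j, b⟩ n + D.c i j) * D.γ j i (D.w ⟨j, b⟩ n) (D.w ⟨i, a⟩ n) := by
    by_cases hij : i = j
    · subst hij
      have h4 := sub_ne_zero.mpr hne
      have h5 := sub_ne_zero.mpr hne.symm
      simp only [γ, if_true, c_self]
      field_simp
      ring
    · refine D.γ_exchange hij ?_ ?_
      · have := D.w_sub_w_add_ne_zero h n n (neg_mem (D.c_mem i j))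
        convert this using 1; simp only [c]; ring
      · have := D.w_sub_w_add_ne_zero h.symm n n (neg_mem (D.c_mem j i))
        convert this using 1; simp only [c]; ring
  linear_combination D.costA i n (D.w ⟨i, a⟩ n) *
    D.costB i (n + Pi.single ⟨i, a⟩ 1 + Pi.single ⟨j, b⟩ 1) (D.w ⟨i, a⟩ n) * h3

/-- For strings other than y this is the exchange rule for each of the two terms. For y itself one
term on each side is annihilated by its linear factor, and the surviving ones coincide. -/
theorem eigen_add_single (i : I) (y : Σ i, Fin (D.m i)) (f : ℂ → ℂ) (n : D.Ω) :
    D.eigen i (fun u => (u - D.w y n + D.c i y.1) * f u) n =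
      D.eigen i (fun u => (u - D.w y n - D.c i y.1) * f u) (n + Pi.single y 1) := by
  refine sum_congr rfl fun a _ => ?_
  by_cases h : (⟨i, a⟩ : Σ i, Fin (D.m i)) = y
  · subst h
    rw [D.w_add_single_self, add_sub_cancel_right, add_sub_cancel_right, D.c_self]
    ring
  · have h1 := D.cost_add_single h n
    have h2 := D.cost_add_single h (n - Pi.single ⟨i, a⟩ 1)
    rw [D.w_sub_single_self, D.w_sub_single_ne (Ne.symm h)] at h2
    rw [D.w_add_single_ne h, add_sub_right_comm]
    linear_combination f (D.w ⟨i, a⟩ n) * h1 - f (D.w ⟨i, a⟩ n - D.δ i) * h2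

open Polynomial in
/-- The numerator of the cost. -/
def num (i : I) (n : D.Ω) : ℂ[X] :=
  X ^ D.l i * ∏ j ∈ univ.erase i, ∏ b : Fin (D.m j), ∏ k ∈ range (D.N j i),
    (X - C (D.w ⟨j, b⟩ n + D.c i j + k * D.δ j))

theorem num_eval (i : I) (n : D.Ω) (u : ℂ) : (D.num i n).eval u =
    u ^ D.l i * ∏ j ∈ univ.erase i, ∏ b : Fin (D.m j), D.τ i j (u - D.w ⟨j, b⟩ n) := by
  simp only [num, Polynomial.eval_mul, Polynomial.eval_pow, Polynomial.eval_X,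
    Polynomial.eval_prod, Polynomial.eval_sub, Polynomial.eval_C, τ, ← sub_sub]

theorem num_monic (i : I) (n : D.Ω) : (D.num i n).Monic :=
  (Polynomial.monic_X_pow _).mul (Polynomial.monic_prod_of_monic _ _ fun _ _ =>
    Polynomial.monic_prod_of_monic _ _ fun _ _ =>
      Polynomial.monic_prod_of_monic _ _ fun _ _ => Polynomial.monic_X_sub_C _)

/-- The exponent l_i of X is chosen to fill the degree up to twice the number of strings, the number
of nodes in `eigen_one`. -/
theorem num_natDegree (i : I) (n : D.Ω) : (D.num i n).natDegree = 2 * D.m i := by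
  have h : (D.num i n).natDegree = D.l i + ∑ j ∈ univ.erase i, D.m j * D.N j i := by
    rw [num, (Polynomial.monic_X_pow _).natDegree_mul (Polynomial.monic_prod_of_monic _ _ fun _ _ =>
      Polynomial.monic_prod_of_monic _ _ fun _ _ =>
      Polynomial.monic_prod_of_monic _ _ fun _ _ => Polynomial.monic_X_sub_C _),
      Polynomial.natDegree_X_pow, Polynomial.natDegree_prod_of_monic]
    · congr 1
      refine sum_congr rfl fun j _ => ?_
      rw [Polynomial.natDegree_prod_of_monic]
      · rw [sum_congr rfl fun b _ => Polynomial.natDegree_prod_of_monic _ _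
          fun _ _ => Polynomial.monic_X_sub_C _]
        simp only [Polynomial.natDegree_X_sub_C, sum_const, card_range, smul_eq_mul, mul_one,
          card_univ, Fintype.card_fin]
      · exact fun _ _ => Polynomial.monic_prod_of_monic _ _ fun _ _ => Polynomial.monic_X_sub_C _
    · exact fun _ _ => Polynomial.monic_prod_of_monic _ _ fun _ _ =>
        Polynomial.monic_prod_of_monic _ _ fun _ _ => Polynomial.monic_X_sub_C _
  rw [h]
  zify
  rw [l, Int.toNat_of_nonneg (D.m_dominant i), ← add_sum_erase univ _ (mem_univ i), D.A_self,
    add_assoc, ← sum_add_distrib, sum_eq_zero, add_zero, mul_comm]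
  intro j hj
  have := D.A_nonpos j i (mem_erase.mp hj).1
  rw [N, Int.toNat_of_nonneg (by omega)]
  ring

theorem num_nextCoeff (i : I) (n : D.Ω) : (D.num i n).nextCoeff =
    -∑ j ∈ univ.erase i, ∑ b : Fin (D.m j), ∑ k ∈ range (D.N j i),
      (D.w ⟨j, b⟩ n + D.c i j + k * D.δ j) := by
  have hX : ∀ k, (Polynomial.X ^ k : Polynomial ℂ).nextCoeff = 0 := by
    intro k
    rw [(Polynomial.monic_X).nextCoeff_pow, show (Polynomial.X : Polynomial ℂ).nextCoeff = 0 by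
      simpa using Polynomial.nextCoeff_X_sub_C (0 : ℂ), smul_zero]
  rw [num, (Polynomial.monic_X_pow _).nextCoeff_mul (Polynomial.monic_prod_of_monic _ _ fun _ _ =>
      Polynomial.monic_prod_of_monic _ _ fun _ _ =>
      Polynomial.monic_prod_of_monic _ _ fun _ _ => Polynomial.monic_X_sub_C _), hX, zero_add,
    Polynomial.Monic.nextCoeff_prod, ← sum_neg_distrib]
  · refine sum_congr rfl fun j _ => ?_
    rw [Polynomial.Monic.nextCoeff_prod, ← sum_neg_distrib]
    · exact sum_congr rfl fun b _ => Polynomial.prod_X_sub_C_nextCoeff _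
    · exact fun _ _ => Polynomial.monic_prod_of_monic _ _ fun _ _ => Polynomial.monic_X_sub_C _
  · exact fun _ _ => Polynomial.monic_prod_of_monic _ _ fun _ _ =>
      Polynomial.monic_prod_of_monic _ _ fun _ _ => Polynomial.monic_X_sub_C _

theorem num_sub_single (i : I) (a : Fin (D.m i)) (n : D.Ω) :
    D.num i (n - Pi.single ⟨i, a⟩ 1) = D.num i n := by
  rw [num, num]
  congr 1
  refine prod_congr rfl fun j hj => prod_congr rfl fun b _ => ?_
  rw [D.w_sub_single_ne]
  intro h
  exact (mem_erase.mp hj).1 (congrArg Sigma.fst h)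

/-- For i ≠ j exactly one of the two costs carries the polynomial τ_{ij}, whichever way the colours
are ordered. The product is therefore independent of the auxiliary order, and the string `a` itself
contributes -δ_i⁻². -/
theorem cost_eq (i : I) (a : Fin (D.m i)) (n : D.Ω) : D.cost ⟨i, a⟩ n =
    -(D.δ i * D.ħ)⁻¹ * (D.num i n).eval (D.w ⟨i, a⟩ n) /
      ∏ b ∈ univ.erase a, ((D.w ⟨i, a⟩ n - D.w ⟨i, b⟩ n) *
        (D.w ⟨i, a⟩ n - D.w ⟨i, b⟩ n + D.δ i)) := by
  set u := D.w ⟨i, a⟩ n with hu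
  have h1 : D.cost ⟨i, a⟩ n = u ^ D.l i * D.d i * ∏ j, ∏ b : Fin (D.m j),
      (D.ρ i j (u - D.w ⟨j, b⟩ n) *
        D.ρ' i j (u - D.w ⟨j, b⟩ (n + Pi.single ⟨i, a⟩ 1))) := by
    rw [cost, costA, costB, ← hu, Fintype.prod_sigma, Fintype.prod_sigma]
    simp only [prod_mul_distrib]
    ring
  have h2 : ∀ j ∈ univ.erase i, ∏ b : Fin (D.m j), (D.ρ i j (u - D.w ⟨j, b⟩ n) *
        D.ρ' i j (u - D.w ⟨j, b⟩ (n + Pi.single ⟨i, a⟩ 1))) =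
      ∏ b : Fin (D.m j), D.τ i j (u - D.w ⟨j, b⟩ n) := by
    intro j hj
    have hji := (mem_erase.mp hj).1
    refine prod_congr rfl fun b _ => ?_
    rw [D.w_add_single_ne fun h => hji (congrArg Sigma.fst h)]
    rcases lt_or_gt_of_ne hji.symm with h | h
    · simp only [ρ, ρ', hji.symm, h, h.not_gt, if_true, if_false, mul_one]
    · simp only [ρ, ρ', hji.symm, h, h.not_gt, if_true, if_false, one_mul]
  have h3 : ∏ b : Fin (D.m i), (D.ρ i i (u - D.w ⟨i, b⟩ n) *
        D.ρ' i i (u - D.w ⟨i, b⟩ (n + Pi.single ⟨i, a⟩ 1))) =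
      -(D.δ i * D.δ i)⁻¹ * (∏ b ∈ univ.erase a, ((u - D.w ⟨i, b⟩ n) *
        (u - D.w ⟨i, b⟩ n + D.δ i)))⁻¹ := by
    rw [← mul_prod_erase univ _ (mem_univ a), ← prod_inv_distrib, D.w_add_single_self, ← hu]
    congr 1
    · simp only [ρ, ρ', if_true]
      rw [sub_self, zero_add, sub_add_cancel_left, inv_neg, mul_inv]
      ring
    · refine prod_congr rfl fun b hb => ?_
      rw [D.w_add_single_ne fun h => (mem_erase.mp hb).1 (by simpa using h)]
      simp only [ρ, ρ', if_true, mul_inv]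
      ring
  have hd : (D.δ i * D.ħ)⁻¹ = D.d i * (D.δ i * D.δ i)⁻¹ := by
    have h1 := D.d_ne_zero i
    have h2 := D.ħ_ne_zero
    simp only [δ]
    field_simp
  rw [h1, ← mul_prod_erase univ _ (mem_univ i), h3, prod_congr rfl h2, num_eval, hd]
  ring

/-- The sum is the Lagrange interpolation formula of `sum_eval_div_prod_sub` for the numerator, with
the 2 m_i nodes w_a and w_a - δ_i. -/
theorem eigen_one (i : I) (n : D.Ω) : D.ħ * D.eigen i 1 n =
    (D.num i n).nextCoeff + ∑ a, (2 * D.w ⟨i, a⟩ n - D.δ i) := by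
  set v : Fin (D.m i) ⊕ Fin (D.m i) → ℂ :=
    Sum.elim (fun a => D.w ⟨i, a⟩ n) (fun a => D.w ⟨i, a⟩ n - D.δ i) with hv
  have hne : ∀ {a b : Fin (D.m i)}, a ≠ b →
      (⟨i, a⟩ : Σ i, Fin (D.m i)) ≠ ⟨i, b⟩ := fun h h' => h (by simpa using h')
  have hinj : Function.Injective v := by
    have h0 := D.δ_ne_zero i
    have h1 : ∀ a b, D.w ⟨i, a⟩ n ≠ D.w ⟨i, b⟩ n - D.δ i := by
      intro a b h
      by_cases hab : a = b
      · subst hab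
        exact h0 (by linear_combination h)
      · refine D.w_sub_w_add_ne_zero (hne hab) n n (D.δ_mem i) ?_
        rw [h]; simp only [δ]; ring
    have h2 : ∀ a b, D.w ⟨i, a⟩ n = D.w ⟨i, b⟩ n → a = b := by
      intro a b h
      by_contra hab
      exact D.w_ne (hne hab) n n h
    rintro (a | a) (b | b) h
    · exact congrArg _ (h2 a b h)
    · exact absurd h (h1 a b)
    · exact absurd h.symm (h1 b a)
    · exact congrArg _ (h2 a b (sub_left_injective h))
  have hdeg : (D.num i n).natDegree = #(univ : Finset (Fin (D.m i) ⊕ Fin (D.m i))) := by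
    rw [num_natDegree, card_univ, Fintype.card_sum, Fintype.card_fin, two_mul]
  have h := sum_eval_div_prod_sub univ v hinj.injOn _ (D.num_monic i n) hdeg
    ⟨Sum.inl ⟨0, D.m_pos i⟩, mem_univ _⟩
  have he : ∀ (x : Fin (D.m i) ⊕ Fin (D.m i)) (g : Fin (D.m i) ⊕ Fin (D.m i) → ℂ),
      ∏ j ∈ univ.erase x, g j = ∏ j, if j = x then 1 else g j := by
    intro x g
    rw [← mul_prod_erase univ (fun j => if j = x then 1 else g j) (mem_univ x), if_pos rfl, one_mul]
    exact prod_congr rfl fun j hj => (if_neg (mem_erase.mp hj).1).symm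
  have he' : ∀ (x : Fin (D.m i)) (g : Fin (D.m i) → ℂ),
      ∏ j, (if j = x then 1 else g j) = ∏ j ∈ univ.erase x, g j := by
    intro x g
    rw [← mul_prod_erase univ (fun j => if j = x then 1 else g j) (mem_univ x), if_pos rfl, one_mul]
    exact prod_congr rfl fun j hj => (if_neg (mem_erase.mp hj).1)
  rw [Fintype.sum_sum_type, Fintype.sum_sum_type] at h
  simp only [he, Fintype.prod_sum_type, Sum.inl.injEq, Sum.inr.injEq, reduceCtorEq, if_false,
    he', hv, Sum.elim_inl, Sum.elim_inr] at h
  have hsum : ∑ a, (2 * D.w ⟨i, a⟩ n - D.δ i) = ∑ a, D.w ⟨i, a⟩ n +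
      ∑ a, (D.w ⟨i, a⟩ n - D.δ i) := by
    rw [← sum_add_distrib]; exact sum_congr rfl fun a _ => by ring
  rw [hsum, ← h, eigen, mul_sum, ← sum_add_distrib]
  refine sum_congr rfl fun a _ => ?_
  rw [cost_eq, cost_eq, num_sub_single, D.w_sub_single_self]
  have h0 := D.δ_ne_zero i
  have h0' := D.ħ_ne_zero
  have e1 : ∏ b, (D.w ⟨i, a⟩ n - (D.w ⟨i, b⟩ n - D.δ i)) = D.δ i *
      ∏ b ∈ univ.erase a, (D.w ⟨i, a⟩ n - D.w ⟨i, b⟩ n + D.δ i) := by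
    rw [← mul_prod_erase univ _ (mem_univ a), sub_sub_cancel]
    congr 1
    exact prod_congr rfl fun b _ => by ring
  have e2 : ∏ b, (D.w ⟨i, a⟩ n - D.δ i - D.w ⟨i, b⟩ n) = -D.δ i *
      ∏ b ∈ univ.erase a, (D.w ⟨i, a⟩ n - D.δ i - D.w ⟨i, b⟩ n) := by
    rw [← mul_prod_erase univ _ (mem_univ a)]
    congr 1
    ring
  have e3 : ∏ b ∈ univ.erase a, (D.w ⟨i, a⟩ n - D.δ i - (D.w ⟨i, b⟩ n - D.δ i)) =
      ∏ b ∈ univ.erase a, (D.w ⟨i, a⟩ n - D.δ i - D.w ⟨i, b⟩ n + D.δ i) :=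
    prod_congr rfl fun b _ => by ring
  have e4 : ∏ b ∈ univ.erase a, ((D.w ⟨i, a⟩ n - D.δ i - D.w ⟨i, b⟩ (n - Pi.single ⟨i, a⟩ 1)) *
      (D.w ⟨i, a⟩ n - D.δ i - D.w ⟨i, b⟩ (n - Pi.single ⟨i, a⟩ 1) + D.δ i)) =
      ∏ b ∈ univ.erase a, ((D.w ⟨i, a⟩ n - D.δ i - D.w ⟨i, b⟩ n) *
      (D.w ⟨i, a⟩ n - D.δ i - D.w ⟨i, b⟩ n + D.δ i)) := by
    refine prod_congr rfl fun b hb => ?_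
    rw [D.w_sub_single_ne (hne (mem_erase.mp hb).1)]
  rw [e4, e1, e2, e3, prod_mul_distrib, prod_mul_distrib]
  simp only [Pi.one_apply, one_mul, div_eq_mul_inv, mul_inv, inv_neg]
  field_simp
  ring

/-- One step moves the sum of the nodes by 2δ_i if the colour is i. Otherwise it moves the sum of
the N_{ji} zeros attached to the string by N_{ji} δ_j = -2c_{ij}. -/
theorem eigen_one_add_single (i : I) (y : Σ i, Fin (D.m i)) (n : D.Ω) :
    D.eigen i 1 (n + Pi.single y 1) - D.eigen i 1 n = D.d i * D.A i y.1 := by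
  have h0 := D.ħ_ne_zero
  refine mul_left_cancel₀ h0 ?_
  rw [mul_sub, eigen_one, eigen_one, num_nextCoeff, num_nextCoeff]
  simp only [w_add_single]
  obtain ⟨j, q⟩ := y
  have hs : ∀ (i' : I) (b : Fin (D.m i')), (if (⟨i', b⟩ : Σ i, Fin (D.m i)) = ⟨j, q⟩ then
      D.δ i' else 0) = if h : i' = j then (if b = h ▸ q then D.δ i' else 0) else 0 := by
    intro i' b
    by_cases h : i' = j
    · subst h
      simp
    · simp [h]
  simp only [hs]
  by_cases hij : i = j
  · subst hij
    have h1 : ∀ j' ∈ univ.erase i, ∑ b : Fin (D.m j'), ∑ k ∈ range (D.N j' i),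
        (D.w ⟨j', b⟩ n + (if h : j' = i then (if b = h ▸ q then D.δ j' else 0) else 0) +
          D.c i j' + k * D.δ j') = ∑ b : Fin (D.m j'), ∑ k ∈ range (D.N j' i),
        (D.w ⟨j', b⟩ n + D.c i j' + k * D.δ j') := by
      intro j' hj'
      simp [(mem_erase.mp hj').1]
    rw [sum_congr rfl h1, D.A_self]
    simp only [dite_true, mul_add, mul_ite, mul_zero, sum_sub_distrib, sum_add_distrib,
      sum_ite_eq', mem_univ, if_true, δ]
    push_cast
    ring
  · have h1 : ∀ (j' : I) (b : Fin (D.m j')), ∑ k ∈ range (D.N j' i),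
        (D.w ⟨j', b⟩ n + (if h : j' = j then (if b = h ▸ q then D.δ j' else 0) else 0) +
          D.c i j' + k * D.δ j') = ∑ k ∈ range (D.N j' i),
        (D.w ⟨j', b⟩ n + D.c i j' + k * D.δ j') + D.N j' i *
        (if h : j' = j then (if b = h ▸ q then D.δ j' else 0) else 0) := by
      intro j' b
      simp only [sum_add_distrib, sum_const, card_range, nsmul_eq_mul]
      ring
    have h2 : ∑ j' ∈ univ.erase i, ∑ b : Fin (D.m j'), (D.N j' i : ℂ) *
        (if h : j' = j then (if b = h ▸ q then D.δ j' else 0) else 0) = D.N j i * D.δ j := by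
      rw [sum_eq_single_of_mem j (mem_erase.mpr ⟨Ne.symm hij, mem_univ _⟩)]
      · simp
      · intro j' _ h
        simp [h]
    simp only [h1, sum_add_distrib, h2, hij, dite_false, add_zero]
    have h3 := D.two_mul_c hij
    simp only [c] at h3
    linear_combination -h3

end DifferenceData

end Representation

/-! ### Verification of the Yangian relations, and the nonvanishing of a product in the Yangian. -/

noncomputable section Representation

set_option linter.unusedSectionVars false

open Finset

namespace DifferenceData

variable {I : Type*} [Fintype I] [LinearOrder I] (D : DifferenceData I)

/-- The operators by which the raising and lowering currents act. -/
def op (ε : ℤˣ) (i : I) (f : ℂ → ℂ) : Module.End ℂ (D.Ω → ℂ) :=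
  if ε = 1 then D.modelB.X i f else D.modelA.X i f

theorem op_one (i : I) (f : ℂ → ℂ) : D.op 1 i f = D.modelB.X i f := if_pos rfl

theorem op_neg_one (i : I) (f : ℂ → ℂ) : D.op (-1) i f = D.modelA.X i f := if_neg (by decide)

/-- The operators by which the Cartan currents act. -/
def opZero (i : I) (f : ℂ → ℂ) : Module.End ℂ (D.Ω → ℂ) :=
  Algebra.lmul ℂ (D.Ω → ℂ) (D.eigen i f)

theorem opZero_apply (i : I) (f : ℂ → ℂ) (ψ : D.Ω → ℂ) (n : D.Ω) :
    D.opZero i f ψ n = D.eigen i f n * ψ n := rfl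

theorem op_neg_one_apply (i : I) (f : ℂ → ℂ) (ψ : D.Ω → ℂ) (n : D.Ω) :
    D.op (-1) i f ψ n = ∑ a, f (D.w ⟨i, a⟩ n) * D.costA i n (D.w ⟨i, a⟩ n) *
      ψ (n + Pi.single ⟨i, a⟩ 1) := by
  rw [op_neg_one]; rfl

theorem op_one_apply (i : I) (f : ℂ → ℂ) (ψ : D.Ω → ℂ) (n : D.Ω) :
    D.op 1 i f ψ n = ∑ a, f (D.w ⟨i, a⟩ n - D.δ i) * D.costB i n (D.w ⟨i, a⟩ n - D.δ i) *
      ψ (n - Pi.single ⟨i, a⟩ 1) := by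
  simp only [op_one, sub_eq_add_neg n]; rfl

theorem eigen_add (i : I) (f g : ℂ → ℂ) (n : D.Ω) :
    D.eigen i (fun u => f u + g u) n = D.eigen i f n + D.eigen i g n := by
  simp only [eigen, ← sum_add_distrib]
  exact sum_congr rfl fun a _ => by ring

theorem eigen_smul (i : I) (t : ℂ) (f : ℂ → ℂ) (n : D.Ω) :
    D.eigen i (fun u => t * f u) n = t * D.eigen i f n := by
  simp only [eigen, mul_sum]
  exact sum_congr rfl fun a _ => by ring

theorem opZero_commute (i j : I) (f g : ℂ → ℂ) : ⁅D.opZero i f, D.opZero j g⁆ = 0 := by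
  rw [Ring.lie_def, opZero, opZero, ← map_mul, ← map_mul, mul_comm, sub_self]

theorem lie_opZero_op_neg_one_apply (i j : I) (f g : ℂ → ℂ) (ψ : D.Ω → ℂ) (n : D.Ω) :
    ⁅D.opZero i f, D.op (-1) j g⁆ ψ n = ∑ b, g (D.w ⟨j, b⟩ n) * D.costA j n (D.w ⟨j, b⟩ n) *
      (D.eigen i f n - D.eigen i f (n + Pi.single ⟨j, b⟩ 1)) * ψ (n + Pi.single ⟨j, b⟩ 1) := by
  rw [Ring.lie_def, LinearMap.sub_apply, Pi.sub_apply, Module.End.mul_apply, Module.End.mul_apply,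
    opZero_apply, op_neg_one_apply, op_neg_one_apply, mul_sum, ← sum_sub_distrib]
  exact sum_congr rfl fun b _ => by rw [opZero_apply]; ring

theorem lie_opZero_op_one_apply (i j : I) (f g : ℂ → ℂ) (ψ : D.Ω → ℂ) (n : D.Ω) :
    ⁅D.opZero i f, D.op 1 j g⁆ ψ n = ∑ b, g (D.w ⟨j, b⟩ n - D.δ j) *
      D.costB j n (D.w ⟨j, b⟩ n - D.δ j) *
      (D.eigen i f n - D.eigen i f (n - Pi.single ⟨j, b⟩ 1)) * ψ (n - Pi.single ⟨j, b⟩ 1) := by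
  rw [Ring.lie_def, LinearMap.sub_apply, Pi.sub_apply, Module.End.mul_apply, Module.End.mul_apply,
    opZero_apply, op_one_apply, op_one_apply, mul_sum, ← sum_sub_distrib]
  exact sum_congr rfl fun b _ => by rw [opZero_apply]; ring

theorem lie_opZero_one_op (ε : ℤˣ) (i j : I) (g : ℂ → ℂ) :
    ⁅D.opZero i 1, D.op ε j g⁆ = (((ε : ℤ) : ℂ) * (D.d i * D.A i j)) • D.op ε j g := by
  refine LinearMap.ext fun ψ => funext fun n => ?_
  rcases Int.units_eq_one_or ε with rfl | rfl
  · rw [lie_opZero_op_one_apply, LinearMap.smul_apply, Pi.smul_apply, op_one_apply, smul_eq_mul,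
      mul_sum]
    refine sum_congr rfl fun b _ => ?_
    have h := D.eigen_one_add_single i ⟨j, b⟩ (n - Pi.single ⟨j, b⟩ 1)
    rw [sub_add_cancel] at h
    rw [h]
    push_cast
    ring
  · rw [lie_opZero_op_neg_one_apply, LinearMap.smul_apply, Pi.smul_apply, op_neg_one_apply,
      smul_eq_mul, mul_sum]
    refine sum_congr rfl fun b _ => ?_
    have h := D.eigen_one_add_single i ⟨j, b⟩ n
    rw [← neg_sub, h]
    push_cast
    ring

theorem eigen_exchange (i : I) (y : Σ i, Fin (D.m i)) (f : ℂ → ℂ) (n : D.Ω) :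
    D.eigen i (fun u => u * f u) n - (D.w y n - D.c i y.1) * D.eigen i f n =
      D.eigen i (fun u => u * f u) (n + Pi.single y 1) -
        (D.w y n + D.c i y.1) * D.eigen i f (n + Pi.single y 1) := by
  have h := D.eigen_add_single i y f n
  have e1 : (fun u => (u - D.w y n + D.c i y.1) * f u) =
      fun u => u * f u + -(D.w y n - D.c i y.1) * f u := by funext u; ring
  have e2 : (fun u => (u - D.w y n - D.c i y.1) * f u) =
      fun u => u * f u + -(D.w y n + D.c i y.1) * f u := by funext u; ring
  rw [e1, e2, eigen_add, eigen_add, eigen_smul, eigen_smul] at h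
  linear_combination h

theorem opZero_exchange (ε : ℤˣ) (i j : I) (f g : ℂ → ℂ) :
    ⁅D.opZero i (fun u => u * f u), D.op ε j g⁆ - ⁅D.opZero i f, D.op ε j (fun u => u * g u)⁆ =
      (((ε : ℤ) : ℂ) * D.c i j) • (D.opZero i f * D.op ε j g + D.op ε j g * D.opZero i f) := by
  refine LinearMap.ext fun ψ => funext fun n => ?_
  rw [LinearMap.sub_apply, Pi.sub_apply, LinearMap.smul_apply, Pi.smul_apply, smul_eq_mul,
    LinearMap.add_apply, Pi.add_apply, Module.End.mul_apply, Module.End.mul_apply, opZero_apply]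
  rcases Int.units_eq_one_or ε with rfl | rfl
  · rw [lie_opZero_op_one_apply, lie_opZero_op_one_apply, op_one_apply, op_one_apply, mul_sum,
      ← sum_sub_distrib, ← sum_add_distrib, mul_sum]
    refine sum_congr rfl fun b _ => ?_
    have h := D.eigen_exchange i ⟨j, b⟩ f (n - Pi.single ⟨j, b⟩ 1)
    rw [sub_add_cancel, w_sub_single_self] at h
    rw [opZero_apply]
    push_cast
    linear_combination -(g (D.w ⟨j, b⟩ n - D.δ j) * D.costB j n (D.w ⟨j, b⟩ n - D.δ j) *
      ψ (n - Pi.single ⟨j, b⟩ 1)) * h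
  · rw [lie_opZero_op_neg_one_apply, lie_opZero_op_neg_one_apply, op_neg_one_apply,
      op_neg_one_apply, mul_sum, ← sum_sub_distrib, ← sum_add_distrib, mul_sum]
    refine sum_congr rfl fun b _ => ?_
    have h := D.eigen_exchange i ⟨j, b⟩ f n
    rw [opZero_apply]
    push_cast
    linear_combination (g (D.w ⟨j, b⟩ n) * D.costA j n (D.w ⟨j, b⟩ n) *
      ψ (n + Pi.single ⟨j, b⟩ 1)) * h

theorem op_exchange (ε : ℤˣ) (i j : I) (f g : ℂ → ℂ) :
    ⁅D.op ε i (fun u => u * f u), D.op ε j g⁆ - ⁅D.op ε i f, D.op ε j (fun u => u * g u)⁆ =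
      (((ε : ℤ) : ℂ) * D.c i j) • (D.op ε i f * D.op ε j g + D.op ε j g * D.op ε i f) := by
  rcases Int.units_eq_one_or ε with rfl | rfl
  · simp only [op_one, Ring.lie_def, D.modelB.X_exchange, Units.val_one, Int.cast_one, one_mul]
    rw [show D.modelB.c i j = -D.c i j from rfl, neg_neg]
  · simp only [op_neg_one, Ring.lie_def, D.modelA.X_exchange, Units.val_neg, Units.val_one,
      Int.cast_neg, Int.cast_one, neg_mul, one_mul]
    rfl

/-- The condition on the constants in the Serre relation of a string model becomes 2c_{ij} = a_{ij}
δ_i for m = 1 - a_{ij}. In the removing model both constants change sign. -/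
theorem op_serre (ε : ℤˣ) {i j : I} (hij : i ≠ j) (f : ℕ → ℂ → ℂ) (g : ℂ → ℂ)
    (r : Fin (1 - D.A i j).toNat → ℕ) :
    ∑ π : Equiv.Perm (Fin (1 - D.A i j).toNat), (List.ofFn fun k => r (π k)).foldr
      (fun t y => ⁅D.op ε i (f t), y⁆) (D.op ε j g) = 0 := by
  have h := D.A_nonpos i j hij
  have hm : 0 < (1 - D.A i j).toNat := by omega
  have hm' : (((1 - D.A i j).toNat : ℕ) : ℂ) = 1 - D.A i j := by
    have : (((1 - D.A i j).toNat : ℕ) : ℤ) = 1 - D.A i j := Int.toNat_of_nonneg (by omega)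
    exact_mod_cast congrArg (Int.cast : ℤ → ℂ) this
  rcases Int.units_eq_one_or ε with rfl | rfl
  · simp only [op_one]
    refine D.modelB.serre hij hm ?_ f g r
    change 2 * -D.c i j = -(((1 - D.A i j).toNat : ℂ) - 1) * -D.δ i
    rw [hm']
    simp only [c, δ]
    ring
  · simp only [op_neg_one]
    refine D.modelA.serre hij hm ?_ f g r
    change 2 * D.c i j = -(((1 - D.A i j).toNat : ℂ) - 1) * D.δ i
    rw [hm']
    simp only [c, δ]
    ring

theorem op_one_mul_op_neg_one_apply (i j : I) (f g : ℂ → ℂ) (ψ : D.Ω → ℂ) (n : D.Ω) :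
    (D.op 1 i f * D.op (-1) j g) ψ n = ∑ a, ∑ b,
      f (D.w ⟨i, a⟩ n - D.δ i) * D.costB i n (D.w ⟨i, a⟩ n - D.δ i) *
      (g (D.w ⟨j, b⟩ (n - Pi.single ⟨i, a⟩ 1)) *
        D.costA j (n - Pi.single ⟨i, a⟩ 1) (D.w ⟨j, b⟩ (n - Pi.single ⟨i, a⟩ 1)) *
      ψ (n - Pi.single ⟨i, a⟩ 1 + Pi.single ⟨j, b⟩ 1)) := by
  rw [Module.End.mul_apply, op_one_apply]
  exact sum_congr rfl fun a _ => by rw [op_neg_one_apply, mul_sum]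

theorem op_neg_one_mul_op_one_apply (i j : I) (f g : ℂ → ℂ) (ψ : D.Ω → ℂ) (n : D.Ω) :
    (D.op (-1) j g * D.op 1 i f) ψ n = ∑ a, ∑ b,
      g (D.w ⟨j, b⟩ n) * D.costA j n (D.w ⟨j, b⟩ n) *
      (f (D.w ⟨i, a⟩ (n + Pi.single ⟨j, b⟩ 1) - D.δ i) *
        D.costB i (n + Pi.single ⟨j, b⟩ 1) (D.w ⟨i, a⟩ (n + Pi.single ⟨j, b⟩ 1) - D.δ i) *
      ψ (n + Pi.single ⟨j, b⟩ 1 - Pi.single ⟨i, a⟩ 1)) := by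
  rw [Module.End.mul_apply, op_neg_one_apply, sum_comm]
  exact sum_congr rfl fun a _ => by rw [op_one_apply, mul_sum]

theorem lie_op_ne_aux (x y : Σ i, Fin (D.m i)) (h : x ≠ y) (f g : ℂ → ℂ) (ψ : D.Ω → ℂ) (n : D.Ω) :
    f (D.w x n - D.δ x.1) * D.costB x.1 n (D.w x n - D.δ x.1) *
      (g (D.w y (n - Pi.single x 1)) * D.costA y.1 (n - Pi.single x 1) (D.w y (n - Pi.single x 1)) *
      ψ (n - Pi.single x 1 + Pi.single y 1)) =
    g (D.w y n) * D.costA y.1 n (D.w y n) * (f (D.w x (n + Pi.single y 1) - D.δ x.1) *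
        D.costB x.1 (n + Pi.single y 1) (D.w x (n + Pi.single y 1) - D.δ x.1) *
      ψ (n + Pi.single y 1 - Pi.single x 1)) := by
  rw [D.w_sub_single_ne h.symm, D.w_add_single_ne h, sub_add_eq_add_sub]
  linear_combination f (D.w x n - D.δ x.1) * g (D.w y n) * ψ (n + Pi.single y 1 - Pi.single x 1) *
    D.costB_mul_costA h n

theorem lie_op_ne {i j : I} (hij : i ≠ j) (f g : ℂ → ℂ) : ⁅D.op 1 i f, D.op (-1) j g⁆ = 0 := by
  rw [Ring.lie_def, sub_eq_zero]
  refine LinearMap.ext fun ψ => funext fun n => ?_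
  rw [op_one_mul_op_neg_one_apply, op_neg_one_mul_op_one_apply]
  exact sum_congr rfl fun a _ => sum_congr rfl fun b _ =>
    D.lie_op_ne_aux ⟨i, a⟩ ⟨j, b⟩ (fun h => hij (congrArg Sigma.fst h)) f g ψ n

/-- Contributions of two different strings cancel. Adding and removing on the same string returns to
the initial state, and both orders together make up the eigenvalue. -/
theorem lie_op_self (i : I) (f g : ℂ → ℂ) :
    ⁅D.op 1 i f, D.op (-1) i g⁆ = D.opZero i fun u => f u * g u := by
  rw [Ring.lie_def]
  refine LinearMap.ext fun ψ => funext fun n => ?_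
  rw [LinearMap.sub_apply, Pi.sub_apply, op_one_mul_op_neg_one_apply,
    op_neg_one_mul_op_one_apply, opZero_apply, eigen, sum_mul, ← sum_sub_distrib]
  refine sum_congr rfl fun a _ => ?_
  rw [← sum_sub_distrib, sum_eq_single a]
  · rw [D.w_sub_single_self, D.w_add_single_self, sub_add_cancel, add_sub_cancel_right,
      add_sub_cancel_right, cost, cost, sub_add_cancel, D.w_sub_single_self]
    ring
  · intro b _ hb
    rw [sub_eq_zero]
    exact D.lie_op_ne_aux ⟨i, a⟩ ⟨i, b⟩ (fun h => hb (by simpa using h.symm)) f g ψ n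
  · simp

/-- The action of the generators of the Yangian. -/
def genAction : YangianGen I → Module.End ℂ (D.Ω → ℂ)
  | .x ε i r => D.op ε i (fun u => u ^ r)
  | .xi i r => D.opZero i (fun u => u ^ r)

/-- The action of the free algebra. -/
def freeAction : FreeAlgebra ℂ (YangianGen I) →ₐ[ℂ] Module.End ℂ (D.Ω → ℂ) :=
  FreeAlgebra.lift ℂ D.genAction

theorem freeAction_fx (ε : ℤˣ) (i : I) (r : ℕ) :
    D.freeAction (YangianGen.fx ε i r) = D.op ε i (fun u => u ^ r) :=
  FreeAlgebra.lift_ι_apply _ _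

theorem freeAction_fxi (i : I) (r : ℕ) :
    D.freeAction (YangianGen.fxi i r) = D.opZero i (fun u => u ^ r) :=
  FreeAlgebra.lift_ι_apply _ _

theorem _root_.AlgHom.map_ring_lie {W W' : Type*} [Ring W] [Ring W'] [Algebra ℂ W] [Algebra ℂ W']
    (φ : W →ₐ[ℂ] W') (x y : W) : φ ⁅x, y⁆ = ⁅φ x, φ y⁆ := by
  rw [Ring.lie_def, Ring.lie_def, map_sub, map_mul, map_mul]

theorem _root_.AlgHom.map_foldr_lie {W W' : Type*} [Ring W] [Ring W'] [Algebra ℂ W] [Algebra ℂ W']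
    (φ : W →ₐ[ℂ] W') {α : Type*} (x : α → W) (l : List α) (y : W) :
    φ (l.foldr (fun t z => ⁅x t, z⁆) y) = l.foldr (fun t z => ⁅φ (x t), z⁆) (φ y) := by
  induction l with
  | nil => rfl
  | cons t l ih => rw [List.foldr_cons, List.foldr_cons, AlgHom.map_ring_lie, ih]

theorem freeAction_rel {a b : FreeAlgebra ℂ (YangianGen I)} (h : YangianRel D.A D.d D.ħ a b) :
    D.freeAction a = D.freeAction b := by
  have hs : ∀ r : ℕ, (fun u : ℂ => u ^ (r + 1)) = fun u => u * (fun u => u ^ r) u :=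
    fun r => funext fun u => pow_succ' u r
  have h0 : (fun u : ℂ => u ^ 0) = 1 := funext fun u => pow_zero u
  have hadd : ∀ r s : ℕ, (fun u : ℂ => u ^ (r + s)) = fun u => u ^ r * u ^ s :=
    fun r s => funext fun u => pow_add u r s
  cases h with
  | Y1 i j r s =>
    rw [AlgHom.map_ring_lie, freeAction_fxi, freeAction_fxi, opZero_commute, map_zero]
  | Y2 ε i j s =>
    rw [AlgHom.map_ring_lie, map_smul, freeAction_fxi, freeAction_fx, h0, lie_opZero_one_op]
  | Y3 ε i j r s =>
    rw [map_sub, AlgHom.map_ring_lie, AlgHom.map_ring_lie, map_smul, map_add, map_mul, map_mul]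
    simp only [freeAction_fxi, freeAction_fx, hs]
    rw [opZero_exchange, mul_assoc]
    rfl
  | Y4 ε i j r s =>
    rw [map_sub, AlgHom.map_ring_lie, AlgHom.map_ring_lie, map_smul, map_add, map_mul, map_mul]
    simp only [freeAction_fx, hs]
    rw [op_exchange, mul_assoc]
    rfl
  | Y5_same i r s =>
    rw [AlgHom.map_ring_lie, freeAction_fx, freeAction_fx, freeAction_fxi, lie_op_self, hadd]
  | Y5_ne i j hij r s =>
    rw [AlgHom.map_ring_lie, freeAction_fx, freeAction_fx, lie_op_ne D hij, map_zero]
  | Y6 ε i j hij r s =>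
    rw [map_sum, map_zero]
    simp only [AlgHom.map_foldr_lie D.freeAction (fun t => YangianGen.fx ε i t), freeAction_fx]
    exact D.op_serre ε hij (fun t u => u ^ t) (fun u => u ^ s) r

/-- The action of the Yangian by difference operators. -/
def action : Yangian D.A D.d D.ħ →ₐ[ℂ] Module.End ℂ (D.Ω → ℂ) :=
  RingQuot.liftAlgHom ℂ ⟨D.freeAction, fun _ _ h => D.freeAction_rel h⟩

theorem action_x_zero (ε : ℤˣ) (i : I) :
    D.action (Yangian.x D.A D.d D.ħ ε i 0) = D.op ε i 1 := by
  have h : D.action (Yangian.x D.A D.d D.ħ ε i 0) = D.freeAction (YangianGen.fx ε i 0) :=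
    RingQuot.liftAlgHom_mkAlgHom_apply ℂ _ _ _
  rw [h, freeAction_fx]
  simp only [pow_zero]
  rfl

theorem τ_ne_zero {x y : Σ i, Fin (D.m i)} (h : x ≠ y) (n : D.Ω) {s : ℂ} (hs : s ∈ D.Λ) :
    D.τ x.1 y.1 (D.w x n + s - D.w y n) ≠ 0 := by
  refine prod_ne_zero_iff.mpr fun k _ => ?_
  have := D.w_sub_w_add_ne_zero h n n
    (sub_mem (sub_mem hs (D.c_mem x.1 y.1)) (D.natCast_mul_δ_mem k y.1))
  convert this using 1
  simp only [c]
  ring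

theorem w_add_ne_zero (x : Σ i, Fin (D.m i)) (n : D.Ω) {s : ℂ} (hs : s ∈ D.Λ) :
    D.w x n + s ≠ 0 := by
  intro h
  refine D.w₀_notMem x ?_
  have e : D.w₀ x = -(n x * D.δ x.1) - s := by
    rw [w] at h; linear_combination h
  rw [e]
  exact sub_mem (neg_mem (D.intCast_mul_δ_mem _ _)) hs

theorem costA_ne_zero (x : Σ i, Fin (D.m i)) (n : D.Ω) : D.costA x.1 n (D.w x n) ≠ 0 := by
  have h0 := D.w_add_ne_zero x n D.Λ.zero_mem
  rw [add_zero] at h0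
  refine mul_ne_zero (pow_ne_zero _ h0) (prod_ne_zero_iff.mpr fun y _ => ?_)
  simp only [ρ]
  by_cases hxy : x = y
  · subst hxy
    simp [D.δ_ne_zero]
  · split_ifs with h1 h2
    · exact inv_ne_zero (D.w_sub_w_add_ne_zero hxy n n (D.δ_mem _))
    · have := D.τ_ne_zero hxy n D.Λ.zero_mem
      rwa [add_zero] at this
    · exact one_ne_zero

theorem costB_ne_zero (x : Σ i, Fin (D.m i)) (n : D.Ω) :
    D.costB x.1 n (D.w x n - D.δ x.1) ≠ 0 := by
  refine mul_ne_zero (D.d_ne_zero _) (prod_ne_zero_iff.mpr fun y _ => ?_)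
  simp only [ρ']
  by_cases hxy : x = y
  · subst hxy
    simp [D.δ_ne_zero]
  · split_ifs with h1 h2
    · have := D.w_sub_w_add_ne_zero hxy n n (neg_mem (D.δ_mem x.1))
      refine inv_ne_zero ?_
      convert this using 1
      simp only [δ]; ring
    · have := D.τ_ne_zero hxy n (neg_mem (D.δ_mem x.1))
      rwa [← sub_eq_add_neg] at this
    · exact one_ne_zero

theorem γ_ne_zero {x y : Σ i, Fin (D.m i)} (h : x.1 ≠ y.1) (n n' : D.Ω) {s : ℂ} (hs : s ∈ D.Λ) :
    D.γ x.1 y.1 (D.w x n + s) (D.w y n') ≠ 0 := by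
  have hxy : x ≠ y := fun h' => h (congrArg Sigma.fst h')
  simp only [γ, h, if_false]
  split_ifs
  · refine div_ne_zero ?_ ?_
    · have := D.w_sub_w_add_ne_zero hxy n n' (add_mem hs (D.c_mem x.1 y.1))
      convert this using 1
      simp only [c]; ring
    · have := D.w_sub_w_add_ne_zero hxy n n' (sub_mem hs (D.c_mem x.1 y.1))
      convert this using 1
      simp only [c]; ring
  · exact one_ne_zero

/-- The product acts by a nonzero difference operator: all costs and cross interactions are nonzero
since the starting points are in general position. -/
theorem mul_lie_ne_zero (ε : ℤˣ) {i j : I} (hij : i ≠ j) (hA : D.A i j ≠ 0) :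
    Yangian.x D.A D.d D.ħ ε j 0 * ⁅Yangian.x D.A D.d D.ħ ε j 0, Yangian.x D.A D.d D.ħ ε i 0⁆
      ≠ 0 := by
  intro h
  have h1 := congrArg D.action h
  rw [map_mul, AlgHom.map_ring_lie, map_zero, action_x_zero, action_x_zero, Ring.lie_def] at h1
  have hc : D.c i j ≠ 0 := mul_ne_zero D.ħ_ne_zero
    (div_ne_zero (mul_ne_zero (D.d_ne_zero i) (Int.cast_ne_zero.mpr hA)) two_ne_zero)
  rcases Int.units_eq_one_or ε with rfl | rfl
  · simp only [op_one] at h1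
    refine D.modelB.X_mul_lie_ne_zero hij (neg_ne_zero.mpr hc) ⟨0, D.m_pos i⟩ ⟨0, D.m_pos j⟩ 0
      (fun i a n => D.costB_ne_zero ⟨i, a⟩ n) ?_ h1
    change D.γ j i (D.w ⟨j, ⟨0, D.m_pos j⟩⟩ _ - D.δ j) (D.w ⟨i, ⟨0, D.m_pos i⟩⟩ _ - D.δ i) ≠ 0
    have := D.γ_ne_zero (x := ⟨j, ⟨0, D.m_pos j⟩⟩) (y := ⟨i, ⟨0, D.m_pos i⟩⟩) hij.symm
      (0 + -Pi.single ⟨j, ⟨0, D.m_pos j⟩⟩ 1) (0 - Pi.single ⟨i, ⟨0, D.m_pos i⟩⟩ 1)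
      (neg_mem (D.δ_mem j))
    rw [w_sub_single_self] at this
    exact this
  · simp only [op_neg_one] at h1
    refine D.modelA.X_mul_lie_ne_zero hij hc ⟨0, D.m_pos i⟩ ⟨0, D.m_pos j⟩ 0
      (fun i a n => D.costA_ne_zero ⟨i, a⟩ n) ?_ h1
    have := D.γ_ne_zero (x := ⟨i, ⟨0, D.m_pos i⟩⟩) (y := ⟨j, ⟨0, D.m_pos j⟩⟩) hij
      0 (0 + Pi.single ⟨j, ⟨0, D.m_pos j⟩⟩ 1) D.Λ.zero_mem
    rw [add_zero] at this
    exact this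

end DifferenceData

/-- Points in general position with respect to a countable subgroup. -/
theorem exists_general_position (Λ : AddSubgroup ℂ) (hΛ : (Λ : Set ℂ).Countable) {κ : Type*}
    [Finite κ] : ∃ w : κ → ℂ, (∀ x, w x ∉ Λ) ∧ ∀ x y, x ≠ y → w x - w y ∉ Λ := by
  -- Suitable points are distinct positive multiples of one number t. It suffices that no nonzero
  -- integer multiple of t lies in Λ; the term k = 0 only adds the point 0 to the excluded set.
  have hb : (⋃ k : ℤ, (fun z : ℂ => z / k) '' (Λ : Set ℂ)).Countable :=
    Set.countable_iUnion fun k => hΛ.image _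
  obtain ⟨t, ht⟩ : ∃ t, t ∉ ⋃ k : ℤ, (fun z : ℂ => z / k) '' (Λ : Set ℂ) := by
    by_contra! hcon
    exact not_countable_complex (hb.mono fun z _ => hcon z)
  have key : ∀ k : ℤ, k ≠ 0 → (k : ℂ) * t ∉ Λ := by
    intro k hk h
    refine ht (Set.mem_iUnion.mpr ⟨k, _, h, ?_⟩)
    have : (k : ℂ) ≠ 0 := Int.cast_ne_zero.mpr hk
    field_simp
  obtain ⟨n, ⟨e⟩⟩ := Finite.exists_equiv_fin κ
  refine ⟨fun x => (((e x : ℕ) + 1 : ℤ) : ℂ) * t, fun x => key _ (by omega), fun x y hxy => ?_⟩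
  rw [← sub_mul, ← Int.cast_sub]
  refine key _ fun h => hxy (e.injective (Fin.ext ?_))
  omega

/-- The order of the colours needed to distribute the costs is arbitrary. The steps and interaction
constants generate a countable subgroup, so starting points in general position exist. -/
theorem Yangian.mul_lie_ne_zero {I : Type*} [Finite I] (A : Matrix I I ℤ) (d : I → ℂ) (ħ : ℂ)
    (m : I → ℕ) (hA : ∀ i, A i i = 2) (hA' : ∀ i j, i ≠ j → A i j ≤ 0)
    (hd : ∀ i j, d i * A i j = d j * A j i) (hd' : ∀ i, d i ≠ 0) (hħ : ħ ≠ 0) (hm : ∀ i, 0 < m i)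
    (hm' : ∀ i, 0 ≤ ∑ᶠ j, (m j : ℤ) * A j i) (ε : ℤˣ) {i j : I} (hij : i ≠ j) (h : A i j ≠ 0) :
    Yangian.x A d ħ ε j 0 * ⁅Yangian.x A d ħ ε j 0, Yangian.x A d ħ ε i 0⁆ ≠ 0 := by
  have := Fintype.ofFinite I
  let _ : LinearOrder I := LinearOrder.lift' _ (Fintype.equivFin I).injective
  set v : I ⊕ I × I → ℂ :=
    Sum.elim (fun i => ħ * d i) (fun p => ħ * (d p.1 * A p.1 p.2 / 2)) with hv
  set Λ := (LinearMap.range (Fintype.linearCombination ℤ v)).toAddSubgroup with hΛ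
  have hc : (Λ : Set ℂ).Countable := Set.countable_range (Fintype.linearCombination ℤ v)
  have hmem : ∀ s, v s ∈ Λ := fun s => ⟨Pi.single s 1, by simp⟩
  obtain ⟨w, h1, h2⟩ := exists_general_position Λ hc (κ := Σ i, Fin (m i))
  exact (DifferenceData.mk A d ħ m w Λ hA hA' hd hd' hħ hm
    (fun i => by rw [← finsum_eq_sum_of_fintype]; exact hm' i)
    (fun i => hmem (Sum.inl i)) (fun i j => hmem (Sum.inr (i, j))) h1 h2).mul_lie_ne_zero ε hij h

end Representation

/-! ### Positive roots as combinations of simple roots, and their sum. -/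

section RootFacts

open Finset

theorem RootPairing.Base.IsPos.exists_root_eq_sum_nat {ι R M N : Type*} [CommRing R]
    [AddCommGroup M] [Module R M] [AddCommGroup N] [Module R N] {P : RootPairing ι R M N}
    {b : P.Base} [CharZero R] {k : ι} (hk : b.IsPos k) :
    ∃ f : ι → ℕ, (k ∈ b.support → 0 < f k) ∧ P.root k = ∑ j ∈ b.support, f j • P.root j := by
  classical
  by_cases hks : k ∈ b.support
  · refine ⟨Pi.single k 1, fun _ => by simp, ?_⟩
    rw [sum_eq_single_of_mem k hks fun j _ hj => by simp [hj]]
    simp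
  · obtain ⟨f, -, hf | hf⟩ := b.exists_root_eq_sum_nat_or_neg k
    · exact ⟨f, fun h => absurd h hks, hf⟩
    · exfalso
      have h1 : P.root k = ∑ j ∈ b.support, (fun j => -(f j : ℤ)) j • P.root j := by
        rw [hf, ← sum_neg_distrib]
        exact sum_congr rfl fun j _ => by simp
      have h2 := RootPairing.Base.height_eq_sum (b := b) h1
      have h3 : ∑ j ∈ b.support, -(f j : ℤ) ≤ 0 := sum_nonpos fun j _ => by simp
      have h4 : 0 < b.height k := hk
      omega

/-- The sum of the positive roots is a positive combination of simple roots, and takes the value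
`2` on every simple coroot. -/
theorem RootPairing.Base.exists_sum_mul_pairingIn_eq_two {ι R M N : Type*} [Finite ι] [CommRing R]
    [IsDomain R] [CharZero R] [AddCommGroup M] [Module R M] [AddCommGroup N] [Module R N]
    {P : RootPairing ι R M N} [P.IsCrystallographic] [P.IsReduced] (b : P.Base) :
    ∃ m : ι → ℕ, (∀ i ∈ b.support, 0 < m i) ∧
      ∀ i ∈ b.support, ∑ j ∈ b.support, (m j : ℤ) * P.pairingIn ℤ j i = 2 := by
  classical
  have := Fintype.ofFinite ι
  have hex : ∀ k, ∃ f : ι → ℕ, b.IsPos k →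
      (k ∈ b.support → 0 < f k) ∧ P.root k = ∑ j ∈ b.support, f j • P.root j := by
    intro k
    by_cases hk : b.IsPos k
    · obtain ⟨f, hf⟩ := hk.exists_root_eq_sum_nat
      exact ⟨f, fun _ => hf⟩
    · exact ⟨0, fun h => absurd h hk⟩
  choose f hf using hex
  refine ⟨fun j => ∑ k with b.IsPos k, f k j, fun i hi => ?_, fun i hi => ?_⟩
  · have hp := b.isPos_of_mem_support hi
    exact lt_of_lt_of_le ((hf i hp).1 hi) (single_le_sum (f := fun k => f k i)
      (fun _ _ => Nat.zero_le _) (mem_filter.mpr ⟨mem_univ _, hp⟩))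
  · have h1 : ∀ k, b.IsPos k →
        ∑ j ∈ b.support, (f k j : ℤ) * P.pairingIn ℤ j i = P.pairingIn ℤ k i := by
      intro k hk
      refine FaithfulSMul.algebraMap_injective ℤ R ?_
      rw [P.algebraMap_pairingIn, ← P.root_coroot_eq_pairing, (hf k hk).2, map_sum, map_sum,
        LinearMap.sum_apply]
      refine sum_congr rfl fun j _ => ?_
      rw [map_mul, P.algebraMap_pairingIn, map_nsmul, LinearMap.smul_apply,
        P.root_coroot_eq_pairing, nsmul_eq_mul]
      simp
    push_cast
    simp only [sum_mul]
    rw [sum_comm, sum_congr rfl fun k hk => h1 k (mem_filter.mp hk).2]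
    have hp := b.isPos_of_mem_support hi
    have hmem : i ∈ univ.filter b.IsPos := mem_filter.mpr ⟨mem_univ _, hp⟩
    rw [← add_sum_erase _ _ hmem, P.pairingIn_same]
    have hself : ∀ k, P.pairingIn ℤ (P.reflectionPerm i k) i = -P.pairingIn ℤ k i := by
      intro k
      rw [← P.pairingIn_reflectionPerm, P.pairingIn_reflectionPerm_self_right]
    -- The simple reflection permutes the positive roots other than α_i and negates their pairings
    -- with the coroot of α_i. Only α_i itself remains, with pairing 2.
    have h0 : ∑ k ∈ (univ.filter b.IsPos).erase i, P.pairingIn ℤ k i = 0 := by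
      refine sum_involution (fun k _ => P.reflectionPerm i k) ?_ ?_ ?_ ?_
      · intro k _
        rw [hself]; ring
      · intro k _ hne heq
        have := hself k
        rw [heq] at this
        omega
      · intro k hk
        rw [mem_erase, mem_filter] at hk ⊢
        refine ⟨fun h => ?_, mem_univ _, hk.2.2.reflectionPerm hi hk.1⟩
        have h' : k = P.reflectionPerm i i := by
          rw [← P.reflectionPerm_self i k, h]
        have h2 := hk.2.2
        have h4 := b.height_reflectionPerm_self i
        change b.height (P.reflectionPerm i i) = _ at h4
        rw [h', RootPairing.Base.isPos_iff, h4] at h2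
        have h3 : 0 < b.height i := hp
        omega
      · intro k _
        exact P.reflectionPerm_self _ _
    rw [h0, add_zero]

end RootFacts

/-! ### The Cartan matrix, its symmetrization, and nonvanishing in the Yangian of 𝔤. -/

section SimpleRoots

open LieAlgebra LieAlgebra.IsKilling Finset

variable {L : Type*} [LieRing L] [LieAlgebra ℂ L] [FiniteDimensional ℂ L]
  [LieAlgebra.IsSemisimple ℂ L] {H : LieSubalgebra ℂ L} [H.IsCartanSubalgebra]

theorem cartanA_self (b : (rootSystem H).Base) (i : b.support) : cartanA b i i = 2 :=
  (rootSystem H).pairingIn_same ℤ _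

theorem cartanA_nonpos (b : (rootSystem H).Base) {i j : b.support} (h : i ≠ j) :
    cartanA b i j ≤ 0 :=
  b.pairingIn_le_zero_of_ne (fun h' => h (Subtype.ext h'.symm)) j.2 i.2

theorem cartanA_cast (b : (rootSystem H).Base) (i j : b.support) :
    ((cartanA b i j : ℤ) : ℂ) = (rootSystem H).root j.1 ((rootSystem H).coroot i.1) :=
  ((rootSystem H).algebraMap_pairingIn ℤ _ _).trans rfl

/-- Applied to the dual root system: the m_j are the coefficients of the sum of positive coroots.
They serve as numbers of strings in the representation, and as the grading element in the triangular
decomposition. -/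
theorem exists_sum_mul_cartanA_eq_two (b : (rootSystem H).Base) :
    ∃ m : b.support → ℕ, (∀ i, 0 < m i) ∧ ∀ i, ∑ j, (m j : ℤ) * cartanA b j i = 2 := by
  obtain ⟨m, h1, h2⟩ := b.flip.exists_sum_mul_pairingIn_eq_two
  refine ⟨fun i => m i.1, fun i => h1 _ i.2, fun i => ?_⟩
  have h3 := h2 i.1 i.2
  rw [← h3, ← Finset.sum_coe_sort b.flip.support]
  rfl

variable {κ : InvForm L} {b : (rootSystem H).Base}

theorem dhBasis_apply (i : b.support) :
    dhBasis κ b i = (κ.nu H).symm ((rootSystem H).root i.1) := by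
  rw [dhBasis, Module.Basis.map_apply, RootPairing.Base.toWeightBasis_apply]

theorem InvForm.form_nu_symm (κ : InvForm L) (μ : Module.Dual ℂ H) (h : H) :
    κ.form ((κ.nu H).symm μ : L) (h : L) = μ h :=
  LinearMap.congr_fun ((κ.nu H).apply_symm_apply μ) h

theorem form_dhBasis (i : b.support) (h : H) :
    κ.form (dhBasis κ b i : L) (h : L) = (rootSystem H).root i.1 h := by
  rw [dhBasis_apply, κ.form_nu_symm]

theorem cartanD_eq (i : b.support) :
    cartanD κ b i = (rootSystem H).root i.1 (dhBasis κ b i) / 2 := by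
  rw [cartanD, InvForm.dual, κ.form_nu_symm, dhBasis_apply]

/-- Being a bracket of opposite root vectors, the element lies in the coroot line. The
proportionality factor is found by applying α_i; that it is nonzero follows because `dhBasis` is a
basis. -/
theorem dhBasis_eq_smul_coroot (c : SimpleRootVectors κ b) (i : b.support) :
    dhBasis κ b i = cartanD κ b i • (rootSystem H).coroot i.1 := by
  obtain ⟨t, ht⟩ : ∃ t : ℂ, dhBasis κ b i = t • (rootSystem H).coroot i.1 := by
    have h1 : dhBasis κ b i ∈ corootSpace (i.1.1 : H → ℂ) :=
      (mem_corootSpace _).mpr (Submodule.subset_span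
        ⟨c.e i, c.e_mem i, c.f i, c.f_mem i, c.lie_e_f i⟩)
    have h2 : dhBasis κ b i ∈ (corootSpace (i.1.1 : H → ℂ)).toSubmodule := h1
    rw [coe_corootSpace_eq_span_singleton, Submodule.mem_span_singleton] at h2
    obtain ⟨t, ht⟩ := h2
    exact ⟨t, ht.symm⟩
  rw [cartanD_eq, ht, map_smul]
  have : (rootSystem H).root i.1 ((rootSystem H).coroot i.1) = 2 :=
    (rootSystem H).root_coroot_two i.1
  rw [this, smul_eq_mul, mul_div_assoc, div_self two_ne_zero, mul_one]

theorem cartanD_ne_zero (c : SimpleRootVectors κ b) (i : b.support) : cartanD κ b i ≠ 0 := by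
  intro h
  have := (dhBasis κ b).ne_zero i
  rw [dhBasis_eq_smul_coroot c, h, zero_smul] at this
  exact this rfl

theorem root_dhBasis (c : SimpleRootVectors κ b) (i j : b.support) :
    (rootSystem H).root j.1 (dhBasis κ b i) = cartanD κ b i * cartanA b i j := by
  rw [cartanA_cast, dhBasis_eq_smul_coroot c, map_smul, smul_eq_mul]

theorem cartanD_mul_cartanA_symm (c : SimpleRootVectors κ b) (i j : b.support) :
    cartanD κ b i * cartanA b i j = cartanD κ b j * cartanA b j i := by
  rw [← root_dhBasis c, ← root_dhBasis c, ← form_dhBasis (κ := κ), ← form_dhBasis (κ := κ),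
    κ.symm]

theorem mul_lie_simple_ne_zero (c : SimpleRootVectors κ b) {ħ : ℂ} (hħ : ħ ≠ 0) (ε : ℤˣ)
    {i j : b.support} (hij : i ≠ j) (h : cartanA b i j ≠ 0) :
    Yangian.x (cartanA b) (cartanD κ b) ħ ε j 0 *
      ⁅Yangian.x (cartanA b) (cartanD κ b) ħ ε j 0,
        Yangian.x (cartanA b) (cartanD κ b) ħ ε i 0⁆ ≠ 0 := by
  obtain ⟨m, hm, hm'⟩ := exists_sum_mul_cartanA_eq_two b
  exact Yangian.mul_lie_ne_zero _ _ ħ m (cartanA_self b) (fun i j => cartanA_nonpos b)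
    (cartanD_mul_cartanA_symm c) (cartanD_ne_zero c) hħ hm
    (fun i => by rw [finsum_eq_sum_of_fintype, hm']; exact zero_le_two) ε hij h

end SimpleRoots

/-! ### A triangular decomposition for abstract Chevalley generators. -/

noncomputable section Triangular

open Finset LieSubalgebra

/-- Elements of a Lie algebra that satisfy the relations of Chevalley generators, up to local
nilpotency. -/
structure ChevalleyData (I V 𝔞 : Type*) [Fintype I] [AddCommGroup V] [Module ℂ V] [LieRing 𝔞]
    [LieAlgebra ℂ 𝔞] where
  /-- the raising elements -/
  E : I → 𝔞
  /-- the lowering elements -/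
  F : I → 𝔞
  /-- the Cartan elements -/
  h : V →ₗ[ℂ] 𝔞
  /-- the simple roots -/
  α : I → Module.Dual ℂ V
  /-- the brackets of raising and lowering elements -/
  t : I → V
  /-- coefficients of twice the half sum of positive coroots -/
  m : I → ℕ
  lie_h_h : ∀ v w, ⁅h v, h w⁆ = 0
  lie_h_E : ∀ v i, ⁅h v, E i⁆ = α i v • E i
  lie_h_F : ∀ v i, ⁅h v, F i⁆ = -(α i v) • F i
  lie_E_F_self : ∀ i, ⁅E i, F i⁆ = h (t i)
  lie_E_F_ne : ∀ i j, i ≠ j → ⁅E i, F j⁆ = 0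
  E_mem_engel : ∀ i j, E j ∈ engel ℂ (E i)
  F_mem_engel : ∀ i j, F j ∈ engel ℂ (F i)
  α_injective : Function.Injective α
  t_ne_zero : ∀ i, t i ≠ 0
  α_sum : ∀ j, α j (∑ i, ((m i : ℂ) / α i (t i)) • t i) = 1

namespace ChevalleyData

variable {I V 𝔞 : Type*} [Fintype I] [AddCommGroup V] [Module ℂ V] [LieRing 𝔞]
  [LieAlgebra ℂ 𝔞] (D : ChevalleyData I V 𝔞)

/-- The element of height one. -/
def v₀ : V := ∑ i, ((D.m i : ℂ) / D.α i (D.t i)) • D.t i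

/-- The data in which raising and lowering elements are interchanged. -/
def swap : ChevalleyData I V 𝔞 where
  E := D.F
  F := D.E
  h := D.h
  α i := -D.α i
  t i := -D.t i
  m := D.m
  lie_h_h := D.lie_h_h
  lie_h_E v i := by rw [D.lie_h_F]; rfl
  lie_h_F v i := by rw [D.lie_h_E, LinearMap.neg_apply, neg_neg]
  lie_E_F_self i := by rw [← lie_skew, D.lie_E_F_self, map_neg]
  lie_E_F_ne i j h := by rw [← lie_skew, D.lie_E_F_ne j i h.symm, neg_zero]
  E_mem_engel := D.F_mem_engel
  F_mem_engel := D.E_mem_engel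
  α_injective i j h := D.α_injective (neg_injective h)
  t_ne_zero i := neg_ne_zero.mpr (D.t_ne_zero i)
  α_sum j := by
    rw [← D.α_sum j, LinearMap.neg_apply, ← map_neg, ← sum_neg_distrib]
    simp only [LinearMap.neg_apply, map_neg, neg_neg, smul_neg]

theorem swap_swap : D.swap.swap = D := by
  cases D
  simp [swap]

theorem swap_v₀ : D.swap.v₀ = -D.v₀ := by
  simp only [v₀, swap, LinearMap.neg_apply, map_neg, neg_neg, smul_neg, sum_neg_distrib]

/-- Iterated brackets of raising elements, with their weights. -/
inductive Word : Module.Dual ℂ V → 𝔞 → Prop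
  | single (i : I) : Word (D.α i) (D.E i)
  | cons (i : I) (χ : Module.Dual ℂ V) (p : 𝔞) : Word χ p → Word (χ + D.α i) ⁅D.E i, p⁆

/-- The span of the words of a given weight. -/
def words (χ : Module.Dual ℂ V) : Submodule ℂ 𝔞 := Submodule.span ℂ {p | D.Word χ p}

variable {D}

theorem α_v₀ (i : I) : D.α i D.v₀ = 1 := D.α_sum i

theorem Word.height {χ : Module.Dual ℂ V} {p : 𝔞} (h : D.Word χ p) :
    ∃ n : ℕ, χ D.v₀ = n + 1 := by
  induction h with
  | single i => exact ⟨0, by rw [α_v₀, Nat.cast_zero, zero_add]⟩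
  | cons i χ p _ ih =>
    obtain ⟨n, hn⟩ := ih
    exact ⟨n + 1, by rw [LinearMap.add_apply, hn, α_v₀]; push_cast; ring⟩

theorem Word.weight {χ : Module.Dual ℂ V} {p : 𝔞} (h : D.Word χ p) (v : V) :
    ⁅D.h v, p⁆ = χ v • p := by
  induction h with
  | single i => exact D.lie_h_E v i
  | cons i χ p _ ih =>
    rw [leibniz_lie, D.lie_h_E, ih, smul_lie, lie_smul, LinearMap.add_apply, add_smul, add_comm]

theorem weight_of_mem_words {χ : Module.Dual ℂ V} {p : 𝔞} (h : p ∈ D.words χ) (v : V) :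
    ⁅D.h v, p⁆ = χ v • p := by
  induction h using Submodule.span_induction with
  | mem p hp => exact Word.weight hp v
  | zero => simp
  | add p q _ _ hp hq => rw [lie_add, hp, hq, smul_add]
  | smul a p _ hp => rw [lie_smul, hp, smul_comm]

theorem lie_E_mem_words {χ : Module.Dual ℂ V} {p : 𝔞} (h : p ∈ D.words χ) (i : I) :
    ⁅D.E i, p⁆ ∈ D.words (χ + D.α i) := by
  induction h using Submodule.span_induction with
  | mem p hp => exact Submodule.subset_span (Word.cons i χ p hp)
  | zero => rw [lie_zero]; exact zero_mem _
  | add p q _ _ hp hq => rw [lie_add]; exact add_mem hp hq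
  | smul a p _ hp => rw [lie_smul]; exact Submodule.smul_mem _ _ hp

theorem mem_engel_of_mem_words {χ : Module.Dual ℂ V} {p : 𝔞} (h : p ∈ D.words χ) (i : I) :
    p ∈ engel ℂ (D.E i) := by
  induction h using Submodule.span_induction with
  | mem p hp =>
    induction hp with
    | single j => exact D.E_mem_engel i j
    | cons j χ p _ ih => exact (engel ℂ (D.E i)).lie_mem (D.E_mem_engel i j) ih
  | zero => exact zero_mem _
  | add p q _ _ hp hq => exact add_mem hp hq
  | smul a p _ hp => exact (engel ℂ (D.E i)).smul_mem _ hp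

theorem lie_F_E (i j : I) : (i = j ∧ ⁅D.F i, D.E j⁆ = -D.h (D.t j)) ∨ ⁅D.F i, D.E j⁆ = 0 := by
  by_cases h : i = j
  · subst h
    exact Or.inl ⟨rfl, by rw [← lie_skew, D.lie_E_F_self]⟩
  · exact Or.inr (by rw [← lie_skew, D.lie_E_F_ne j i (Ne.symm h), neg_zero])

/-- A lowering element moves past each letter of the word up to a Cartan element, which acts on
words by scalars. Words of length one are separated because lowering them leaves the span of words.
-/
theorem Word.lie_F {χ : Module.Dual ℂ V} {p : 𝔞} (h : D.Word χ p) :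
    (∃ i, χ = D.α i ∧ p = D.E i) ∨ ∀ i, ⁅D.F i, p⁆ ∈ D.words (χ - D.α i) := by
  induction h with
  | single i => exact Or.inl ⟨i, rfl, rfl⟩
  | cons j χ p hp ih =>
    refine Or.inr fun i => ?_
    rw [leibniz_lie]
    refine add_mem ?_ ?_
    · rcases D.lie_F_E i j with ⟨rfl, h⟩ | h
      · rw [h, neg_lie, hp.weight, add_sub_cancel_right]
        exact neg_mem (Submodule.smul_mem _ _ (Submodule.subset_span hp))
      · rw [h, zero_lie]
        exact zero_mem _
    · rcases ih with ⟨l, rfl, rfl⟩ | ih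
      · rcases D.lie_F_E i l with ⟨rfl, h⟩ | h
        · rw [h, lie_neg, lie_skew, D.lie_h_E, add_sub_cancel_left]
          exact Submodule.smul_mem _ _ (Submodule.subset_span (Word.single j))
        · rw [h, lie_zero]
          exact zero_mem _
      · have := lie_E_mem_words (ih i) j
        rwa [sub_add_eq_add_sub] at this

/-- The 𝔰𝔩₂ computation for a lowest weight vector p, written without normalizing t_i to a coroot.
-/
theorem lie_F_ad_E_pow {χ : Module.Dual ℂ V} {p : 𝔞} (i : I) (hF : ⁅D.F i, p⁆ = 0)
    (hp : ∀ v, ⁅D.h v, p⁆ = χ v • p) (k : ℕ) :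
    (∀ v, ⁅D.h v, ((LieAlgebra.ad ℂ 𝔞 (D.E i)) ^ k) p⁆ =
      (χ v + k * D.α i v) • ((LieAlgebra.ad ℂ 𝔞 (D.E i)) ^ k) p) ∧
    ⁅D.F i, ((LieAlgebra.ad ℂ 𝔞 (D.E i)) ^ (k + 1)) p⁆ =
      -((k + 1) * (χ (D.t i) + k / 2 * D.α i (D.t i))) •
        ((LieAlgebra.ad ℂ 𝔞 (D.E i)) ^ k) p := by
  have hFE : ⁅D.F i, D.E i⁆ = -D.h (D.t i) := by rw [← lie_skew, D.lie_E_F_self]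
  induction k with
  | zero =>
    refine ⟨fun v => by simpa using hp v, ?_⟩
    rw [zero_add, pow_one, pow_zero, Module.End.one_apply, LieAlgebra.ad_apply, leibniz_lie, hF,
      lie_zero, add_zero, hFE, neg_lie, hp, Nat.cast_zero, zero_div, zero_mul, add_zero, zero_add,
      one_mul, neg_smul]
  | succ k ih =>
    set q := ((LieAlgebra.ad ℂ 𝔞 (D.E i)) ^ k) p with hq
    have e : ((LieAlgebra.ad ℂ 𝔞 (D.E i)) ^ (k + 1)) p = ⁅D.E i, q⁆ := by
      rw [pow_succ', Module.End.mul_apply, LieAlgebra.ad_apply]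
    have h1 : ∀ v, ⁅D.h v, ⁅D.E i, q⁆⁆ = (χ v + (k + 1 : ℕ) * D.α i v) • ⁅D.E i, q⁆ := by
      intro v
      rw [leibniz_lie, D.lie_h_E, ih.1, smul_lie, lie_smul, ← add_smul]
      congr 1
      push_cast
      ring
    refine ⟨fun v => by rw [e]; exact h1 v, ?_⟩
    rw [pow_succ', Module.End.mul_apply, LieAlgebra.ad_apply, leibniz_lie, hFE, ih.2, e, neg_lie,
      h1, lie_smul, ← neg_smul, ← add_smul]
    congr 1
    push_cast
    ring

/-- At the last nonzero vector of the E_i-string through p, the scalar in `lie_F_ad_E_pow` must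
vanish. -/
theorem weight_t_of_lie_F_eq_zero {χ : Module.Dual ℂ V} {p : 𝔞} (i : I) (hF : ⁅D.F i, p⁆ = 0)
    (hp : ∀ v, ⁅D.h v, p⁆ = χ v • p) (hE : p ∈ engel ℂ (D.E i)) (h0 : p ≠ 0) :
    ∃ k : ℕ, χ (D.t i) = -(k / 2 * D.α i (D.t i)) := by
  classical
  rw [mem_engel_iff] at hE
  have hN := Nat.find_spec hE
  obtain ⟨k, hk⟩ : ∃ k, Nat.find hE = k + 1 := by
    refine Nat.exists_eq_succ_of_ne_zero fun h => h0 ?_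
    rwa [h, pow_zero, Module.End.one_apply] at hN
  have h1 := (lie_F_ad_E_pow i hF hp k).2
  rw [hk] at hN
  rw [hN, lie_zero] at h1
  have h2 := Nat.find_min hE (m := k) (by omega)
  have h3 := (smul_eq_zero.mp h1.symm).resolve_right h2
  refine ⟨k, ?_⟩
  have h4 : (k : ℂ) + 1 ≠ 0 := Nat.cast_add_one_ne_zero k
  have h5 := (mul_eq_zero.mp (neg_eq_zero.mp h3)).resolve_left h4
  linear_combination h5

theorem height_of_mem_words {χ : Module.Dual ℂ V} {p : 𝔞} (h : p ∈ D.words χ) (h0 : p ≠ 0) :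
    ∃ n : ℕ, χ D.v₀ = n + 1 := by
  by_contra hcon
  refine h0 ?_
  have : {p | D.Word χ p} = ∅ := Set.eq_empty_of_forall_notMem fun p hp => hcon hp.height
  rwa [words, this, Submodule.span_empty, Submodule.mem_bot] at h

/-- Induction on the height χ(v₀). In height one, p is a multiple of some E_i or zero, and
bracketing with F_i detects the multiple on the Cartan part. In greater height, each [F_i, p] lies
in the kernel at smaller height and is zero. A nonzero p would then be a lowest weight vector for
every 𝔰𝔩₂, which makes χ(v₀) nonpositive. -/
theorem eq_zero_of_mem_words {𝔟 : Type*} [LieRing 𝔟] [LieAlgebra ℂ 𝔟] (π : 𝔞 →ₗ⁅ℂ⁆ 𝔟)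
    (hπ : ∀ v, π (D.h v) = 0 → v = 0) (n : ℕ) {χ : Module.Dual ℂ V} (hχ : χ D.v₀ = n + 1)
    {p : 𝔞} (hp : p ∈ D.words χ) (h0 : π p = 0) : p = 0 := by
  induction n generalizing χ p with
  | zero =>
    rw [Nat.cast_zero, zero_add] at hχ
    by_cases hi : ∃ i, χ = D.α i
    · obtain ⟨i, rfl⟩ := hi
      have hle : D.words (D.α i) ≤ Submodule.span ℂ {D.E i} := by
        refine Submodule.span_mono fun q hq => ?_
        generalize hχ' : D.α i = χ' at hq hχ
        cases hq with
        | single j => rw [D.α_injective hχ']; rfl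
        | cons j χ q hq =>
          obtain ⟨n, hn⟩ := hq.height
          rw [LinearMap.add_apply, hn, α_v₀] at hχ
          have : ((n + 1 : ℕ) : ℂ) = 0 := by push_cast; linear_combination hχ
          exact absurd this (Nat.cast_ne_zero.mpr (Nat.succ_ne_zero n))
      obtain ⟨a, rfl⟩ := Submodule.mem_span_singleton.mp (hle hp)
      have h1 := congrArg (fun z => ⁅z, π (D.F i)⁆) h0
      simp only [zero_lie, ← LieHom.map_lie, smul_lie, D.lie_E_F_self] at h1
      rw [← map_smul] at h1
      have h2 := hπ _ h1
      rw [(smul_eq_zero.mp h2).resolve_right (D.t_ne_zero i), zero_smul]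
    · have : {p | D.Word χ p} = ∅ := by
        refine Set.eq_empty_of_forall_notMem fun p hp => ?_
        cases hp with
        | single i => exact hi ⟨i, rfl⟩
        | cons j χ q hq =>
          obtain ⟨n, hn⟩ := hq.height
          rw [LinearMap.add_apply, hn, α_v₀] at hχ
          have : ((n + 1 : ℕ) : ℂ) = 0 := by push_cast; linear_combination hχ
          exact absurd this (Nat.cast_ne_zero.mpr (Nat.succ_ne_zero n))
      rwa [words, this, Submodule.span_empty, Submodule.mem_bot] at hp
  | succ n ih =>
    by_contra hne
    have hF : ∀ i, ⁅D.F i, p⁆ = 0 := by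
      intro i
      refine ih (χ := χ - D.α i) ?_ ?_ ?_
      · rw [LinearMap.sub_apply, hχ, α_v₀]; push_cast; ring
      · clear h0 hne
        induction hp using Submodule.span_induction with
        | mem p hp =>
          rcases hp.lie_F with ⟨j, rfl, rfl⟩ | h
          · rw [α_v₀] at hχ
            have : ((n + 1 : ℕ) : ℂ) = 0 := by push_cast at hχ ⊢; linear_combination -hχ
            exact absurd this (Nat.cast_ne_zero.mpr (Nat.succ_ne_zero n))
          · exact h i
        | zero => rw [lie_zero]; exact zero_mem _
        | add p q _ _ hp hq => rw [lie_add]; exact add_mem hp hq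
        | smul a p _ hp => rw [lie_smul]; exact Submodule.smul_mem _ _ hp
      · rw [LieHom.map_lie, h0, lie_zero]
    have hw := weight_of_mem_words hp
    choose k hk using fun i =>
      weight_t_of_lie_F_eq_zero i (hF i) hw (mem_engel_of_mem_words hp i) hne
    -- An index with α_i(t_i) = 0 contributes nothing, since its coefficient in v₀ is a division by
    -- zero, hence 0.
    have h1 : χ D.v₀ = ∑ i, -((D.m i : ℂ) * k i * (if D.α i (D.t i) = 0 then 0 else 1)) / 2 := by
      rw [v₀, map_sum]
      refine sum_congr rfl fun i _ => ?_
      rw [map_smul, hk, smul_eq_mul]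
      split_ifs with h
      · rw [h]; simp
      · field_simp
    rw [hχ, ← sum_div, sum_neg_distrib] at h1
    have h2 : (((n + 1 + 1) * 2 + ∑ i, D.m i * k i * (if D.α i (D.t i) = 0 then 0 else 1) : ℕ) : ℂ)
        = 0 := by
      push_cast at h1 ⊢
      linear_combination 2 * h1
    rw [Nat.cast_eq_zero] at h2
    omega

variable (D)

/-- The part of weight `χ`. -/
def part (χ : Module.Dual ℂ V) : Submodule ℂ 𝔞 :=
  (⨆ _ : χ = 0, LinearMap.range D.h) ⊔ (D.words χ ⊔ D.swap.words χ)

theorem swap_part (χ : Module.Dual ℂ V) : D.swap.part χ = D.part χ := by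
  rw [part, part, swap_swap, sup_comm (D.words χ)]
  rfl

theorem h_mem_part (v : V) : D.h v ∈ D.part 0 :=
  Submodule.mem_sup_left (Submodule.mem_iSup_of_mem rfl ⟨v, rfl⟩)

variable {D}

theorem words_le_part (χ : Module.Dual ℂ V) : D.words χ ≤ D.part χ :=
  le_sup_left.trans le_sup_right

theorem swap_words_le_part (χ : Module.Dual ℂ V) : D.swap.words χ ≤ D.part χ :=
  le_sup_right.trans le_sup_right

theorem part_induction {χ : Module.Dual ℂ V} (N : Submodule ℂ 𝔞)
    (h1 : χ = 0 → ∀ v, D.h v ∈ N) (h2 : ∀ p, D.Word χ p → p ∈ N)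
    (h3 : ∀ p, D.swap.Word χ p → p ∈ N) : D.part χ ≤ N := by
  refine sup_le (iSup_le fun h => ?_) (sup_le (Submodule.span_le.mpr h2) (Submodule.span_le.mpr h3))
  rintro _ ⟨v, rfl⟩
  exact h1 h v

theorem weight_of_mem_part {χ : Module.Dual ℂ V} {p : 𝔞} (hp : p ∈ D.part χ) (v : V) :
    ⁅D.h v, p⁆ = χ v • p := by
  have h : D.part χ ≤ LinearMap.ker (LieAlgebra.ad ℂ 𝔞 (D.h v) - χ v • LinearMap.id) := by
    refine part_induction _ (fun h w => ?_) (fun p hp => ?_) fun p hp => ?_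
    · simp [h, D.lie_h_h]
    · simp [hp.weight]
    · have := hp.weight v
      change ⁅D.h v, p⁆ = _ at this
      simp [this]
  have := h hp
  simpa [sub_eq_zero] using this

theorem lie_E_mem_part {χ : Module.Dual ℂ V} {p : 𝔞} (hp : p ∈ D.part χ) (i : I) :
    ⁅D.E i, p⁆ ∈ D.part (χ + D.α i) := by
  have h : D.part χ ≤ (D.part (χ + D.α i)).comap (LieAlgebra.ad ℂ 𝔞 (D.E i)) := by
    refine part_induction _ (fun h v => ?_) (fun p hp => ?_) fun p hp => ?_
    · rw [Submodule.mem_comap, LieAlgebra.ad_apply, ← lie_skew, D.lie_h_E, h, zero_add]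
      exact neg_mem (Submodule.smul_mem _ _ (words_le_part _ (Submodule.subset_span
        (Word.single i))))
    · exact words_le_part _ (lie_E_mem_words (Submodule.subset_span hp) i)
    · rw [Submodule.mem_comap, LieAlgebra.ad_apply]
      rcases hp.lie_F with ⟨j, rfl, rfl⟩ | h
      · change ⁅D.E i, D.F j⁆ ∈ D.part (-D.α j + D.α i)
        by_cases hij : i = j
        · subst hij
          rw [D.lie_E_F_self, neg_add_cancel]
          exact D.h_mem_part _
        · rw [D.lie_E_F_ne i j hij]
          exact zero_mem _
      · have h' : ⁅D.E i, p⁆ ∈ D.swap.words (χ - -D.α i) := h i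
        rw [sub_neg_eq_add] at h'
        exact swap_words_le_part _ h'
  exact h hp

theorem lie_F_mem_part {χ : Module.Dual ℂ V} {p : 𝔞} (hp : p ∈ D.part χ) (i : I) :
    ⁅D.F i, p⁆ ∈ D.part (χ - D.α i) := by
  rw [← swap_part] at hp ⊢
  rw [sub_eq_add_neg]
  exact lie_E_mem_part hp i

variable (D)

/-- The Lie subalgebra generated by the data. -/
def gen : LieSubalgebra ℂ 𝔞 :=
  lieSpan ℂ 𝔞 (Set.range D.E ∪ Set.range D.F ∪ Set.range D.h)

variable {D}

/-- Each generator maps a weight part into a weight part, and stability under two elements passes to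
their bracket by the Jacobi identity. -/
theorem lie_mem_iSup_part {a p : 𝔞} (ha : a ∈ D.gen) (hp : p ∈ ⨆ χ, D.part χ) :
    ⁅a, p⁆ ∈ ⨆ χ, D.part χ := by
  induction ha using lieSpan_induction generalizing p with
  | mem a ha =>
    have h : ⨆ χ, D.part χ ≤ (⨆ χ, D.part χ).comap (LieAlgebra.ad ℂ 𝔞 a) := by
      refine iSup_le fun χ q hq => ?_
      rw [Submodule.mem_comap, LieAlgebra.ad_apply]
      rcases ha with (⟨i, rfl⟩ | ⟨i, rfl⟩) | ⟨v, rfl⟩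
      · exact Submodule.mem_iSup_of_mem _ (lie_E_mem_part hq i)
      · exact Submodule.mem_iSup_of_mem _ (lie_F_mem_part hq i)
      · rw [weight_of_mem_part hq]
        exact Submodule.smul_mem _ _ (Submodule.mem_iSup_of_mem _ hq)
    exact h hp
  | zero => rw [zero_lie]; exact zero_mem _
  | add a b _ _ h1 h2 => rw [add_lie]; exact add_mem (h1 hp) (h2 hp)
  | smul c a _ h1 => rw [smul_lie]; exact Submodule.smul_mem _ _ (h1 hp)
  | lie a b _ _ h1 h2 => rw [lie_lie]; exact sub_mem (h1 (h2 hp)) (h2 (h1 hp))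

theorem gen_le_iSup_part {a : 𝔞} (ha : a ∈ D.gen) : a ∈ ⨆ χ, D.part χ := by
  induction ha using lieSpan_induction with
  | mem a ha =>
    rcases ha with (⟨i, rfl⟩ | ⟨i, rfl⟩) | ⟨v, rfl⟩
    · exact Submodule.mem_iSup_of_mem (D.α i)
        (words_le_part _ (Submodule.subset_span (Word.single i)))
    · exact Submodule.mem_iSup_of_mem (-D.α i)
        (swap_words_le_part _ (Submodule.subset_span (Word.single (D := D.swap) i)))
    · exact Submodule.mem_iSup_of_mem 0 (D.h_mem_part v)
  | zero => exact zero_mem _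
  | add a b _ _ h1 h2 => exact add_mem h1 h2
  | smul c a _ h1 => exact Submodule.smul_mem _ _ h1
  | lie a b ha _ _ h2 => exact lie_mem_iSup_part ha h2

/-- Raising words have positive height and lowering words negative height, so at most one of the
three summands of a part is nonzero, and each is treated separately. -/
theorem eq_zero_of_mem_part {𝔟 : Type*} [LieRing 𝔟] [LieAlgebra ℂ 𝔟] (π : 𝔞 →ₗ⁅ℂ⁆ 𝔟)
    (hπ : ∀ v, π (D.h v) = 0 → v = 0) {χ : Module.Dual ℂ V} {p : 𝔞} (hp : p ∈ D.part χ)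
    (h0 : π p = 0) : p = 0 := by
  rw [part, Submodule.mem_sup] at hp
  obtain ⟨q, hq, _, hrs, rfl⟩ := hp
  rw [Submodule.mem_sup] at hrs
  obtain ⟨r, hr, s, hs, rfl⟩ := hrs
  by_cases hχ : χ = 0
  · have hr0 : r = 0 := by
      by_contra h
      obtain ⟨n, hn⟩ := height_of_mem_words (D := D) hr h
      rw [hχ, LinearMap.zero_apply] at hn
      exact (Nat.cast_add_one_ne_zero n : (n : ℂ) + 1 ≠ 0) hn.symm
    have hs0 : s = 0 := by
      by_contra h
      obtain ⟨n, hn⟩ := height_of_mem_words (D := D.swap) hs h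
      rw [hχ, LinearMap.zero_apply] at hn
      exact (Nat.cast_add_one_ne_zero n : (n : ℂ) + 1 ≠ 0) hn.symm
    rw [iSup_pos hχ] at hq
    obtain ⟨v, rfl⟩ := hq
    rw [hr0, hs0, add_zero, add_zero] at h0 ⊢
    rw [hπ v h0, map_zero]
  · rw [iSup_neg hχ, Submodule.mem_bot] at hq
    rw [hq, zero_add] at h0 ⊢
    by_cases hr0 : r = 0
    · rw [hr0, zero_add] at h0 ⊢
      by_contra h
      obtain ⟨n, hn⟩ := height_of_mem_words (D := D.swap) hs h
      exact h (eq_zero_of_mem_words (D := D.swap) π hπ n hn hs h0)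
    · obtain ⟨n, hn⟩ := height_of_mem_words (D := D) hr hr0
      have hs0 : s = 0 := by
        by_contra h
        obtain ⟨k, hk⟩ := height_of_mem_words (D := D.swap) hs h
        rw [swap_v₀, map_neg, hn] at hk
        have : ((n + 1 + k + 1 : ℕ) : ℂ) = 0 := by push_cast; linear_combination -hk
        exact Nat.cast_ne_zero.mpr (Nat.succ_ne_zero _) this
      rw [hs0, add_zero] at h0 ⊢
      exact eq_zero_of_mem_words π hπ n hn hr h0

/-- A homomorphism that is injective on the Cartan part is injective on the Lie algebra generated
by Chevalley generators, if weight spaces of the target are independent. -/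
theorem eq_zero_of_mem_gen {𝔟 : Type*} [LieRing 𝔟] [LieAlgebra ℂ 𝔟] (π : 𝔞 →ₗ⁅ℂ⁆ 𝔟)
    (hπ : ∀ v, π (D.h v) = 0 → v = 0) (W : Module.Dual ℂ V → Submodule ℂ 𝔟) (hW : iSupIndep W)
    (hW' : ∀ χ x, (∀ v, ⁅π (D.h v), x⁆ = χ v • x) → x ∈ W χ) {a : 𝔞} (ha : a ∈ D.gen)
    (h0 : π a = 0) : a = 0 := by
  obtain ⟨f, hf, rfl⟩ := (Submodule.mem_iSup_iff_exists_finsupp _ _).mp (gen_le_iSup_part ha)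
  refine Finset.sum_eq_zero fun χ hχ => ?_
  refine eq_zero_of_mem_part π hπ (hf χ) ?_
  rw [Finsupp.sum, map_sum] at h0
  refine (iSupIndep_iff_finsetSum_eq_zero_imp_eq_zero W).mp hW f.support (fun χ => π (f χ))
    (fun χ _ => hW' χ _ fun v => ?_) h0 χ hχ
  rw [← LieHom.map_lie, weight_of_mem_part (hf χ), map_smul]

end ChevalleyData

end Triangular

/-! ### The defining relations as identities in the Yangian. -/

section YangianRelations

open Finset

namespace Yangian

variable {I : Type*} {A : Matrix I I ℤ} {d : I → ℂ} {ħ : ℂ}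

theorem mk_eq_of_rel {a b : FreeAlgebra ℂ (YangianGen I)} (h : YangianRel A d ħ a b) :
    mk A d ħ a = mk A d ħ b :=
  RingQuot.mkAlgHom_rel ℂ h

theorem lie_xi_xi (i j : I) (r s : ℕ) : ⁅xi A d ħ i r, xi A d ħ j s⁆ = 0 := by
  have := mk_eq_of_rel (YangianRel.Y1 (A := A) (d := d) (ħ := ħ) i j r s)
  rwa [AlgHom.map_ring_lie, map_zero] at this

theorem lie_xi_zero_x (ε : ℤˣ) (i j : I) (s : ℕ) :
    ⁅xi A d ħ i 0, x A d ħ ε j s⁆ = (((ε : ℤ) : ℂ) * (d i * (A i j : ℂ))) • x A d ħ ε j s := by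
  have := mk_eq_of_rel (YangianRel.Y2 (A := A) (d := d) (ħ := ħ) ε i j s)
  rwa [AlgHom.map_ring_lie, map_smul] at this

theorem lie_xi_x (ε : ℤˣ) (i j : I) (r s : ℕ) :
    ⁅xi A d ħ i (r + 1), x A d ħ ε j s⁆ - ⁅xi A d ħ i r, x A d ħ ε j (s + 1)⁆ =
      (((ε : ℤ) : ℂ) * ħ * (d i * (A i j : ℂ) / 2)) •
        (xi A d ħ i r * x A d ħ ε j s + x A d ħ ε j s * xi A d ħ i r) := by
  have := mk_eq_of_rel (YangianRel.Y3 (A := A) (d := d) (ħ := ħ) ε i j r s)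
  rwa [map_sub, AlgHom.map_ring_lie, AlgHom.map_ring_lie, map_smul, map_add, map_mul,
    map_mul] at this

theorem lie_x_x (ε : ℤˣ) (i j : I) (r s : ℕ) :
    ⁅x A d ħ ε i (r + 1), x A d ħ ε j s⁆ - ⁅x A d ħ ε i r, x A d ħ ε j (s + 1)⁆ =
      (((ε : ℤ) : ℂ) * ħ * (d i * (A i j : ℂ) / 2)) •
        (x A d ħ ε i r * x A d ħ ε j s + x A d ħ ε j s * x A d ħ ε i r) := by
  have := mk_eq_of_rel (YangianRel.Y4 (A := A) (d := d) (ħ := ħ) ε i j r s)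
  rwa [map_sub, AlgHom.map_ring_lie, AlgHom.map_ring_lie, map_smul, map_add, map_mul,
    map_mul] at this

theorem lie_x_one_x_neg_one_self (i : I) (r s : ℕ) :
    ⁅x A d ħ 1 i r, x A d ħ (-1) i s⁆ = xi A d ħ i (r + s) := by
  have := mk_eq_of_rel (YangianRel.Y5_same (A := A) (d := d) (ħ := ħ) i r s)
  rwa [AlgHom.map_ring_lie] at this

theorem lie_x_one_x_neg_one_ne {i j : I} (hij : i ≠ j) (r s : ℕ) :
    ⁅x A d ħ 1 i r, x A d ħ (-1) j s⁆ = 0 := by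
  have := mk_eq_of_rel (YangianRel.Y5_ne (A := A) (d := d) (ħ := ħ) i j hij r s)
  rwa [AlgHom.map_ring_lie, map_zero] at this

theorem sum_foldr_lie (ε : ℤˣ) {i j : I} (hij : i ≠ j) (r : Fin (1 - A i j).toNat → ℕ) (s : ℕ) :
    ∑ π : Equiv.Perm (Fin (1 - A i j).toNat), (List.ofFn fun k => r (π k)).foldr
      (fun t y => ⁅x A d ħ ε i t, y⁆) (x A d ħ ε j s) = 0 := by
  have := mk_eq_of_rel (YangianRel.Y6 (A := A) (d := d) (ħ := ħ) ε i j hij r s)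
  rw [map_sum, map_zero] at this
  simp only [AlgHom.map_foldr_lie (mk A d ħ) (fun t => YangianGen.fx ε i t)] at this
  exact this

/-- With all indices equal to 0, every permutation gives the same summand, so m! times the iterated
commutator vanishes. -/
theorem adMap_x_zero_pow (ε : ℤˣ) {i j : I} (hij : i ≠ j) (s : ℕ) :
    (adMap (x A d ħ ε i 0) ^ (1 - A i j).toNat) (x A d ħ ε j s) = 0 := by
  have h := sum_foldr_lie (A := A) (d := d) (ħ := ħ) ε hij (fun _ => 0) s
  simp only [foldr_lie_eq (fun t => x A d ħ ε i t), List.ofFn_const, List.map_replicate,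
    List.prod_replicate, sum_const] at h
  rw [← Nat.cast_smul_eq_nsmul ℂ] at h
  refine (smul_eq_zero.mp h).resolve_left ?_
  exact Nat.cast_ne_zero.mpr Fintype.card_ne_zero

end Yangian

end YangianRelations

/-! ### The graph of 𝔤 → Y is single-valued, and root vectors are determined by their images. -/

noncomputable section Embedding

set_option linter.unusedSectionVars false

open LieAlgebra LieAlgebra.IsKilling Finset

attribute [local instance] LieRing.ofAssociativeRing

variable {L : Type*} [LieRing L] [LieAlgebra ℂ L] [FiniteDimensional ℂ L]
  [LieAlgebra.IsSemisimple ℂ L] {H : LieSubalgebra ℂ L} [H.IsCartanSubalgebra]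
  {κ : InvForm L} {b : (rootSystem H).Base} (c : SimpleRootVectors κ b) (ħ : ℂ)

theorem hEmb_dhBasis (i : b.support) :
    hEmb κ b ħ (dhBasis κ b i) = Yangian.xi (cartanA b) (cartanD κ b) ħ i 0 :=
  (dhBasis κ b).constr_basis ℂ _ i

theorem tEmb_dhBasis (i : b.support) :
    tEmb κ b ħ (dhBasis κ b i) = Yangian.t1 (cartanA b) (cartanD κ b) ħ i :=
  (dhBasis κ b).constr_basis ℂ _ i

theorem dhBasis_induction {p : H → Prop} (coe : ∀ i, p (dhBasis κ b i)) (zero : p 0)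
    (add : ∀ v w, p v → p w → p (v + w)) (smul : ∀ (a : ℂ) v, p v → p (a • v)) (v : H) : p v := by
  induction (dhBasis κ b).mem_span v using Submodule.span_induction with
  | mem v hv =>
    obtain ⟨i, rfl⟩ := hv
    exact coe i
  | zero => exact zero
  | add v w _ _ hv hw => exact add v w hv hw
  | smul a v _ hv => exact smul a v hv

include c in
theorem lie_hEmb_x (h : H) (ε : ℤˣ) (j : b.support) (s : ℕ) :
    ⁅hEmb κ b ħ h, Yangian.x (cartanA b) (cartanD κ b) ħ ε j s⁆ =
      (((ε : ℤ) : ℂ) * (rootSystem H).root j.1 h) •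
        Yangian.x (cartanA b) (cartanD κ b) ħ ε j s := by
  induction h using dhBasis_induction (κ := κ) (b := b) with
  | coe i => rw [hEmb_dhBasis, Yangian.lie_xi_zero_x, root_dhBasis c]
  | zero => simp
  | add v w hv hw => rw [map_add, add_lie, hv, hw, ← add_smul, map_add, mul_add]
  | smul a v hv => rw [map_smul, smul_lie, hv, map_smul, smul_smul, smul_eq_mul]; ring_nf

theorem lie_hEmb_hEmb (v w : H) : ⁅hEmb κ b ħ v, hEmb κ b ħ w⁆ = 0 := by
  induction v using dhBasis_induction (κ := κ) (b := b) with
  | coe i =>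
    induction w using dhBasis_induction (κ := κ) (b := b) with
    | coe j => rw [hEmb_dhBasis, hEmb_dhBasis, Yangian.lie_xi_xi]
    | zero => simp
    | add v w hv hw => rw [map_add, lie_add, hv, hw, add_zero]
    | smul a v hv => rw [map_smul, lie_smul, hv, smul_zero]
  | zero => simp
  | add v w hv hw => rw [map_add, add_lie, hv, hw, add_zero]
  | smul a v hv => rw [map_smul, smul_lie, hv, smul_zero]

theorem lie_coe_of_mem_rootSpace {χ : H → ℂ} {u : L} (hu : u ∈ rootSpace H χ) (h : H) :
    ⁅(h : L), u⁆ = χ h • u :=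
  lie_eq_smul_of_mem_rootSpace hu h

theorem mem_rootSpace_of_lie {χ : Module.Dual ℂ H} {u : L}
    (hu : ∀ h : H, ⁅(h : L), u⁆ = χ h • u) : u ∈ rootSpace H (χ : H → ℂ) :=
  LieModule.weightSpace_le_genWeightSpace L _ ((LieModule.mem_weightSpace _ _).mpr hu)

/-- The bracket has weight α_i - α_j, which is neither a root nor zero. -/
theorem lie_e_f_ne {i j : b.support} (hij : i ≠ j) : ⁅c.e i, c.f j⁆ = 0 := by
  by_contra hne
  have h1 := lie_mem_genWeightSpace_of_mem_genWeightSpace (c.e_mem i) (c.f_mem j)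
  have hmem : (rootSystem H).root i.1 - (rootSystem H).root j.1 ∉
      Set.range (rootSystem H).root := b.sub_notMem_range_root i.2 j.2
  refine hmem ?_
  have hij' : (rootSystem H).root i.1 - (rootSystem H).root j.1 ≠ 0 := by
    rw [sub_ne_zero]
    exact fun h => hij (Subtype.ext ((rootSystem H).root.injective h))
  have hbot : LieModule.genWeightSpace L
      (((rootSystem H).root i.1 - (rootSystem H).root j.1 : Module.Dual ℂ H) : H → ℂ) ≠ ⊥ := by
    intro hbot
    have h2 : ⁅c.e i, c.f j⁆ ∈ LieModule.genWeightSpace L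
      (((rootSystem H).root i.1 - (rootSystem H).root j.1 : Module.Dual ℂ H) : H → ℂ) := by
      convert h1 using 2
      rw [sub_eq_add_neg]
      rfl
    rw [hbot] at h2
    exact hne h2
  refine ⟨⟨⟨_, hbot⟩, ?_⟩, ?_⟩
  · simp only [LieSubalgebra.root, mem_filter, mem_univ, true_and]
    exact fun h => hij' (LinearMap.ext fun x => congrFun h x)
  · ext h
    rfl

/-- By invariance, pairing [e_i, f_i] with t = ν⁻¹(α_i) gives α_i(t) times the value in question,
and [e_i, f_i] = t gives α_i(t). This number is nonzero because d_i is. -/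
theorem form_e_f (i : b.support) : κ.form (c.e i) (c.f i) = 1 := by
  have hd := cartanD_ne_zero c i
  rw [cartanD_eq] at hd
  have hα : (rootSystem H).root i.1 (dhBasis κ b i) ≠ 0 := fun h => hd (by rw [h, zero_div])
  have h1 := κ.invariant (c.e i) (c.f i) (dhBasis κ b i : L)
  have h2 : ⁅c.f i, (dhBasis κ b i : L)⁆ =
      (rootSystem H).root i.1 (dhBasis κ b i) • c.f i := by
    rw [← lie_skew, lie_coe_of_mem_rootSpace (c.f_mem i), Pi.neg_apply, neg_smul, neg_neg]
  rw [c.lie_e_f, form_dhBasis, h2, map_smul, smul_eq_mul] at h1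
  exact (mul_left_cancel₀ hα (by rw [← h1, mul_one])).symm

theorem root_ne_zero (i : H.root) : ((rootSystem H).root i : H → ℂ) ≠ 0 := fun h =>
  (rootSystem H).ne_zero i (LinearMap.ext fun x => congrFun h x)

theorem neg_root_ne_zero (i : H.root) : (-(rootSystem H).root i : H → ℂ) ≠ 0 :=
  neg_ne_zero.mpr (root_ne_zero i)

theorem ad_pow_prod {Y : Type*} [Ring Y] [Algebra ℂ Y] (p q : L × Y) (n : ℕ) :
    ((LieAlgebra.ad ℂ (L × Y) p) ^ n) q =
      (((LieAlgebra.ad ℂ L p.1) ^ n) q.1, (adMap p.2 ^ n) q.2) := by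
  induction n with
  | zero => rfl
  | succ n ih => rw [pow_succ', Module.End.mul_apply, ih, pow_succ', pow_succ']; rfl

/-- In 𝔤 root vectors are ad-nilpotent, and in the Yangian the Serre relation provides the
nilpotency. -/
theorem mem_engel_prod (ε : ℤˣ) (e : b.support → L) (χ : b.support → H → ℂ)
    (hχ : ∀ i, χ i ≠ 0) (he : ∀ i, e i ∈ rootSpace H (χ i)) (i j : b.support) :
    ((e j, Yangian.x (cartanA b) (cartanD κ b) ħ ε j 0) : L × YangianLie κ b ħ) ∈
      LieSubalgebra.engel ℂ ((e i, Yangian.x (cartanA b) (cartanD κ b) ħ ε i 0) :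
        L × YangianLie κ b ħ) := by
  by_cases hij : i = j
  · subst hij
    exact LieSubalgebra.self_mem_engel ℂ _
  · obtain ⟨N, hN⟩ := LieAlgebra.isNilpotent_ad_of_mem_rootSpace H (hχ i) (he i)
    rw [LieSubalgebra.mem_engel_iff]
    refine ⟨N + (1 - cartanA b i j).toNat, ?_⟩
    rw [ad_pow_prod, Prod.mk_eq_zero]
    constructor
    · rw [add_comm, pow_add, hN, mul_zero, LinearMap.zero_apply]
    · rw [pow_add, Module.End.mul_apply, Yangian.adMap_x_zero_pow ε hij, map_zero]

/-- The Chevalley generators of the graph of the embedding. -/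
def graphData (m : b.support → ℕ) (hm : ∀ i, ∑ j, (m j : ℤ) * cartanA b j i = 2) :
    ChevalleyData b.support H (L × YangianLie κ b ħ) where
  E i := (c.e i, Yangian.x _ _ _ 1 i 0)
  F i := (c.f i, Yangian.x _ _ _ (-1) i 0)
  h := LinearMap.prod H.toSubmodule.subtype (hEmb κ b ħ)
  α i := (rootSystem H).root i.1
  t i := dhBasis κ b i
  m := m
  lie_h_h v w := by
    refine Prod.ext ?_ (lie_hEmb_hEmb ħ v w)
    have : ⁅v, w⁆ = 0 := trivial_lie_zero _ _ _ _
    change ⁅(v : L), (w : L)⁆ = 0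
    rw [← LieSubalgebra.coe_bracket, this]; rfl
  lie_h_E v i := by
    refine Prod.ext (lie_coe_of_mem_rootSpace (c.e_mem i) v) ?_
    refine (lie_hEmb_x c ħ v 1 i 0).trans ?_
    simp
  lie_h_F v i := by
    refine Prod.ext (lie_coe_of_mem_rootSpace (c.f_mem i) v) ?_
    refine (lie_hEmb_x c ħ v (-1) i 0).trans ?_
    simp
  lie_E_F_self i := by
    refine Prod.ext (c.lie_e_f i) ?_
    refine (Yangian.lie_x_one_x_neg_one_self i 0 0).trans ?_
    exact (hEmb_dhBasis ħ i).symm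
  lie_E_F_ne i j h := Prod.ext (lie_e_f_ne c h) (Yangian.lie_x_one_x_neg_one_ne h 0 0)
  E_mem_engel := mem_engel_prod ħ 1 c.e _ (fun i => root_ne_zero i.1) c.e_mem
  F_mem_engel := mem_engel_prod ħ (-1) c.f _ (fun i => neg_root_ne_zero i.1) c.f_mem
  α_injective i j h := Subtype.ext ((rootSystem H).root.injective h)
  t_ne_zero i := (dhBasis κ b).ne_zero i
  α_sum j := by
    rw [map_sum]
    have h1 : ∀ i, (rootSystem H).root j.1 (((m i : ℂ) /
        (rootSystem H).root i.1 (dhBasis κ b i)) • dhBasis κ b i) =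
        2⁻¹ * ((m i : ℂ) * cartanA b i j) := by
      intro i
      have hd := cartanD_ne_zero c i
      rw [map_smul, root_dhBasis c, root_dhBasis c, cartanA_self, smul_eq_mul]
      push_cast
      field_simp
    rw [sum_congr rfl fun i _ => h1 i, ← mul_sum]
    have h2 := congrArg (Int.cast : ℤ → ℂ) (hm j)
    push_cast at h2
    rw [h2]
    norm_num

variable {c ħ}

theorem GEmb.mem_gen {m : b.support → ℕ} {hm : ∀ i, ∑ j, (m j : ℤ) * cartanA b j i = 2}
    {u : L} {y : YangianLie κ b ħ} (h : GEmb c ħ u y) : (u, y) ∈ (graphData c ħ m hm).gen := by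
  induction h with
  | e i => exact LieSubalgebra.subset_lieSpan (Or.inl (Or.inl ⟨i, rfl⟩))
  | f i => exact LieSubalgebra.subset_lieSpan (Or.inl (Or.inr ⟨i, rfl⟩))
  | h i =>
    refine LieSubalgebra.subset_lieSpan (Or.inr ⟨dhBasis κ b i, ?_⟩)
    exact Prod.ext rfl (hEmb_dhBasis ħ i)
  | zero => exact zero_mem _
  | add _ _ h1 h2 => exact add_mem h1 h2
  | smul a _ h1 => exact (graphData c ħ m hm).gen.smul_mem a h1
  | lie _ _ h1 h2 => exact (graphData c ħ m hm).gen.lie_mem h1 h2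

/-- The projection of the graph to 𝔤 is injective by `ChevalleyData.eq_zero_of_mem_gen`: it is
injective on 𝔥, and the weight spaces of 𝔤 are independent. -/
theorem GEmb.eq_zero {y : YangianLie κ b ħ} (h : GEmb c ħ 0 y) : y = 0 := by
  obtain ⟨m, -, hm⟩ := exists_sum_mul_cartanA_eq_two b
  have h1 := ChevalleyData.eq_zero_of_mem_gen (LieHom.fst ℂ L (YangianLie κ b ħ))
    (D := graphData c ħ m hm) (fun v hv => Subtype.ext hv)
    (fun χ => (rootSpace H (χ : H → ℂ)).toSubmodule) ?_ (fun χ x hx => mem_rootSpace_of_lie hx)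
    h.mem_gen rfl
  · exact congrArg Prod.snd h1
  · rw [LieSubmodule.iSupIndep_toSubmodule]
    exact (LieModule.iSupIndep_genWeightSpace ℂ H L).comp DFunLike.coe_injective

theorem GEmb.unique {u : L} {y z : YangianLie κ b ħ} (hy : GEmb c ħ u y) (hz : GEmb c ħ u z) :
    y = z := by
  have h := hy.add (hz.smul (-1))
  rw [neg_one_smul, neg_one_smul, add_neg_cancel] at h
  exact eq_of_sub_eq_zero (by rw [sub_eq_add_neg]; exact h.eq_zero)

theorem GEmb.hEmb (v : H) : GEmb c ħ (v : L) (hEmb κ b ħ v) := by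
  induction v using dhBasis_induction (κ := κ) (b := b) with
  | coe i => rw [hEmb_dhBasis]; exact GEmb.h i
  | zero => rw [map_zero]; exact GEmb.zero
  | add v w hv hw => rw [map_add]; exact hv.add hw
  | smul a v hv => rw [map_smul]; exact hv.smul a

theorem GEmb.mem_yWeight {u : L} {y : YangianLie κ b ħ} (h : GEmb c ħ u y)
    {χ : Module.Dual ℂ H} (hu : u ∈ rootSpace H (χ : H → ℂ)) : y ∈ yWeight κ b ħ χ := by
  intro v
  have h1 := (GEmb.hEmb (c := c) (ħ := ħ) v).lie h
  rw [lie_coe_of_mem_rootSpace hu] at h1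
  exact h1.unique (h.smul _)

theorem PosRoot.eq_smul_of_mem_rootSpace (β : PosRoot b) {u v : L}
    (hu : u ∈ rootSpace H (β.root : H → ℂ)) (hv : v ∈ rootSpace H (β.root : H → ℂ))
    (h0 : v ≠ 0) : ∃ t : ℂ, u = t • v := by
  have hne : (β.1.1 : LieModule.Weight ℂ H L).IsNonZero :=
    (mem_filter.mp β.1.2).2
  have h1 := finrank_rootSpace_eq_one β.1.1 hne
  obtain ⟨t, ht⟩ := (finrank_eq_one_iff_of_nonzero' (⟨v, hv⟩ : rootSpace H (β.1.1 : H → ℂ))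
    (fun h => h0 (congrArg Subtype.val h))).mp h1 ⟨u, hu⟩
  exact ⟨t, (congrArg Subtype.val ht).symm⟩

theorem PosRoot.eq_smul_of_mem_rootSpace_neg (β : PosRoot b) {u v : L}
    (hu : u ∈ rootSpace H (-β.root : H → ℂ)) (hv : v ∈ rootSpace H (-β.root : H → ℂ))
    (h0 : v ≠ 0) : ∃ t : ℂ, u = t • v := by
  have hne : (-β.1.1 : LieModule.Weight ℂ H L).IsNonZero := by
    have : (β.1.1 : LieModule.Weight ℂ H L).IsNonZero := (mem_filter.mp β.1.2).2
    simpa using this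
  have h1 := finrank_rootSpace_eq_one (-β.1.1) hne
  obtain ⟨t, ht⟩ := (finrank_eq_one_iff_of_nonzero'
    (⟨v, hv⟩ : rootSpace H ((-β.1.1 : LieModule.Weight ℂ H L) : H → ℂ))
    (fun h => h0 (congrArg Subtype.val h))).mp h1 ⟨u, hu⟩
  exact ⟨t, (congrArg Subtype.val ht).symm⟩

namespace RootVectors

variable (x : RootVectors c ħ)

theorem xm_mem_yWeight (β : PosRoot b) : x.xm β ∈ yWeight κ b ħ (-β.root) :=
  (x.emb_um β).mem_yWeight (x.um_mem β)

open TensorProduct in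
/-- The tensor of dual root vectors is determined by any pair of root vectors. -/
theorem xm_tmul_xp_eq (β : PosRoot b) {u v : L} {y z : YangianLie κ b ħ}
    (hu : u ∈ rootSpace H (-β.root : H → ℂ)) (hv : v ∈ rootSpace H (β.root : H → ℂ))
    (huy : GEmb c ħ u y) (hvz : GEmb c ħ v z) (h0 : κ.form u v ≠ 0) :
    x.xm β ⊗ₜ[ℂ] x.xp β = (κ.form u v)⁻¹ • (y ⊗ₜ[ℂ] z) := by
  obtain ⟨s, hs⟩ := β.eq_smul_of_mem_rootSpace_neg (x.um_mem β) hu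
    (fun h => h0 (by rw [h, map_zero, LinearMap.zero_apply]))
  obtain ⟨t, ht⟩ := β.eq_smul_of_mem_rootSpace (x.up_mem β) hv
    (fun h => h0 (by rw [h, map_zero]))
  have h1 := (x.emb_um β).unique (hs ▸ huy.smul s)
  have h2 := (x.emb_up β).unique (ht ▸ hvz.smul t)
  have h3 := x.form_eq_one β
  rw [hs, ht, map_smul, map_smul, LinearMap.smul_apply, smul_eq_mul, smul_eq_mul] at h3
  rw [h1, h2, smul_tmul_smul]
  congr 1
  exact eq_inv_of_mul_eq_one_left (by linear_combination h3)

end RootVectors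

end Embedding

/-! ### Roots and partitions below α_i + 2α_j. -/

noncomputable section SmallWeights

set_option linter.unusedSectionVars false

open LieAlgebra LieAlgebra.IsKilling Finset

variable {L : Type*} [LieRing L] [LieAlgebra ℂ L] [FiniteDimensional ℂ L]
  [LieAlgebra.IsSemisimple ℂ L] {H : LieSubalgebra ℂ L} [H.IsCartanSubalgebra]
  {b : (rootSystem H).Base}

/-- The fundamental coweights. -/
def fundCoweight (b : (rootSystem H).Base) (k : b.support) : H :=
  (Module.evalEquiv ℂ H).symm (b.toWeightBasis.coord k)

theorem apply_fundCoweight (k : b.support) (χ : Module.Dual ℂ H) :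
    χ (fundCoweight b k) = b.toWeightBasis.repr χ k := by
  rw [fundCoweight, Module.apply_evalEquiv_symm_apply, Module.Basis.coord_apply]

open Classical in
theorem root_fundCoweight (k l : b.support) :
    (rootSystem H).root l.1 (fundCoweight b k) = if l = k then 1 else 0 := by
  rw [apply_fundCoweight, ← b.toWeightBasis_apply, Module.Basis.repr_self, Finsupp.single_apply]

theorem PosRoot.exists_eq_sum_nat (δ : PosRoot b) :
    ∃ f : b.support → ℕ, δ.root = ∑ k, f k • (rootSystem H).root k.1 := by
  obtain ⟨f, -, hf⟩ := RootPairing.Base.IsPos.exists_root_eq_sum_nat δ.2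
  exact ⟨fun k => f k.1, hf.trans (Finset.sum_coe_sort b.support
    (fun j => f j • (rootSystem H).root j)).symm⟩

theorem exists_nat_of_mem_Qplus {γ : Module.Dual ℂ H} (h : γ ∈ Qplus b) (k : b.support) :
    ∃ n : ℕ, γ (fundCoweight b k) = n := by
  classical
  induction h using AddSubmonoid.closure_induction with
  | mem γ hγ =>
    obtain ⟨δ, rfl⟩ := hγ
    obtain ⟨f, hf⟩ := δ.exists_eq_sum_nat
    refine ⟨f k, ?_⟩
    rw [hf, LinearMap.sum_apply]
    simp only [LinearMap.smul_apply, root_fundCoweight, smul_ite, smul_zero, sum_ite_eq', mem_univ,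
      if_true, nsmul_eq_mul, mul_one]
  | zero => exact ⟨0, by simp⟩
  | add γ δ _ _ hγ hδ =>
    obtain ⟨m, hm⟩ := hγ
    obtain ⟨n, hn⟩ := hδ
    exact ⟨m + n, by rw [LinearMap.add_apply, hm, hn, Nat.cast_add]⟩

theorem PosRoot.root_mem_Qplus (δ : PosRoot b) : δ.root ∈ Qplus b :=
  AddSubmonoid.subset_closure ⟨δ, rfl⟩

theorem PosRoot.root_injective : Function.Injective (PosRoot.root (b := b)) :=
  fun _ _ h => Subtype.ext ((rootSystem H).root.injective h)

theorem PosRoot.root_ne_zero (δ : PosRoot b) : δ.root ≠ 0 := (rootSystem H).ne_zero _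

theorem eq_of_apply_fundCoweight {χ ψ : Module.Dual ℂ H}
    (h : ∀ k, χ (fundCoweight b k) = ψ (fundCoweight b k)) : χ = ψ := by
  refine b.toWeightBasis.repr.injective (Finsupp.ext fun k => ?_)
  rw [← apply_fundCoweight, ← apply_fundCoweight, h]

variable [LinearOrder (PosRoot b)]

/-- Two simple roots and their sum, in an order that excludes a factorization. -/
structure AdmissibleTriple (αi αj αij : PosRoot b) : Prop where
  simple_i : αi.IsSimple
  simple_j : αj.IsSimple
  root_ij : αij.root = αi.root + αj.root
  root_ne : ∀ ℓ : ℕ, 2 ≤ ℓ → ∀ β : PosRoot b, β.root ≠ αi.root + ℓ • αj.root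
  lt_ij : αi < αij
  ij_lt : αij < αj

namespace AdmissibleTriple

variable {αi αj αij : PosRoot b} (h : AdmissibleTriple αi αj αij)
include h

theorem i_ne_j : αi ≠ αj := (h.lt_ij.trans h.ij_lt).ne

theorem coweights : ∃ v w : H, αi.root v = 1 ∧ αj.root v = 0 ∧ αi.root w = 0 ∧ αj.root w = 1 ∧
    ∀ γ ∈ Qplus b, (∃ n : ℕ, γ v = n) ∧ ∃ n : ℕ, γ w = n := by
  have hne : (⟨αi.1, h.simple_i⟩ : b.support) ≠ ⟨αj.1, h.simple_j⟩ := fun h' =>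
    h.i_ne_j (PosRoot.root_injective
      (congrArg (fun k : b.support => (rootSystem H).root k.1) h'))
  refine ⟨fundCoweight b ⟨αi.1, h.simple_i⟩, fundCoweight b ⟨αj.1, h.simple_j⟩, ?_, ?_, ?_, ?_,
    fun γ hγ => ⟨exists_nat_of_mem_Qplus hγ _, exists_nat_of_mem_Qplus hγ _⟩⟩
  · exact (root_fundCoweight ⟨αi.1, h.simple_i⟩ ⟨αi.1, h.simple_i⟩).trans (if_pos rfl)
  · exact (root_fundCoweight ⟨αi.1, h.simple_i⟩ ⟨αj.1, h.simple_j⟩).trans (if_neg hne.symm)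
  · exact (root_fundCoweight ⟨αj.1, h.simple_j⟩ ⟨αi.1, h.simple_i⟩).trans (if_neg hne)
  · exact (root_fundCoweight ⟨αj.1, h.simple_j⟩ ⟨αj.1, h.simple_j⟩).trans (if_pos rfl)

theorem mem_Qplus_iff (p q : ℤ) : p • αi.root + q • αj.root ∈ Qplus b ↔ 0 ≤ p ∧ 0 ≤ q := by
  constructor
  · intro hm
    obtain ⟨v, w, h1, h2, h3, h4, h5⟩ := h.coweights
    obtain ⟨⟨m, hm⟩, n, hn⟩ := h5 _ hm
    simp only [LinearMap.add_apply, LinearMap.smul_apply, h1, h2, h3, h4, smul_zero, add_zero,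
      zero_add, zsmul_one] at hm hn
    have hm' : p = m := by exact_mod_cast hm
    have hn' : q = n := by exact_mod_cast hn
    omega
  · rintro ⟨hp, hq⟩
    lift p to ℕ using hp
    lift q to ℕ using hq
    rw [natCast_zsmul, natCast_zsmul]
    exact add_mem (nsmul_mem αi.root_mem_Qplus _) (nsmul_mem αj.root_mem_Qplus _)

/-- Comparing coordinates at the fundamental coweights gives δ = mα_i + nα_j with m ≤ 1 and n ≤ 2.
The case 2α_j is excluded because the root system is reduced, and α_i + 2α_j by hypothesis. -/
theorem eq_of_sub_mem_Qplus {p q : ℕ} (hp : p ≤ 1) (hq : q ≤ 2) {δ : PosRoot b}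
    (hδ : p • αi.root + q • αj.root - δ.root ∈ Qplus b) : δ = αi ∨ δ = αj ∨ δ = αij := by
  classical
  obtain ⟨f, hf⟩ := δ.exists_eq_sum_nat
  have hfk : ∀ k, δ.root (fundCoweight b k) = f k := by
    intro k
    rw [hf, LinearMap.sum_apply]
    simp only [LinearMap.smul_apply, root_fundCoweight, smul_ite, smul_zero, sum_ite_eq', mem_univ,
      if_true, nsmul_eq_mul, mul_one]
  set ki : b.support := ⟨αi.1, h.simple_i⟩ with hki
  set kj : b.support := ⟨αj.1, h.simple_j⟩ with hkj
  have hne : ki ≠ kj := fun h' => h.i_ne_j (PosRoot.root_injective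
      (congrArg (fun k : b.support => (rootSystem H).root k.1) h'))
  have hi : ∀ k, αi.root (fundCoweight b k) = if ki = k then 1 else 0 :=
    fun k => root_fundCoweight k ki
  have hj : ∀ k, αj.root (fundCoweight b k) = if kj = k then 1 else 0 :=
    fun k => root_fundCoweight k kj
  have hle : ∀ k, f k ≤ p * (if ki = k then 1 else 0) + q * (if kj = k then 1 else 0) := by
    intro k
    obtain ⟨n, hn⟩ := exists_nat_of_mem_Qplus hδ k
    rw [LinearMap.sub_apply, LinearMap.add_apply, LinearMap.smul_apply, LinearMap.smul_apply, hfk,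
      hi, hj] at hn
    have hn' : ((p * (if ki = k then 1 else 0) + q * (if kj = k then 1 else 0) : ℕ) : ℂ) =
        ((n + f k : ℕ) : ℂ) := by
      push_cast
      rw [nsmul_eq_mul, nsmul_eq_mul] at hn
      linear_combination hn
    have := Nat.cast_injective hn'
    omega
  have hroot : δ.root = f ki • αi.root + f kj • αj.root := by
    refine eq_of_apply_fundCoweight (b := b) fun k => ?_
    rw [LinearMap.add_apply, LinearMap.smul_apply, LinearMap.smul_apply, hfk, hi, hj]
    have := hle k
    by_cases h1 : ki = k
    · subst h1
      simp [hne.symm]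
    · by_cases h2 : kj = k
      · subst h2
        simp [h1]
      · have : f k = 0 := by simpa [h1, h2] using this
        simp [h1, h2, this]
  have h1 : f ki ≤ p := by simpa [hne.symm] using hle ki
  have h2 : f kj ≤ q := by simpa [hne] using hle kj
  have h3 : f ki ≤ 1 := h1.trans hp
  have h4 : f kj ≤ 2 := h2.trans hq
  generalize f ki = m at *
  generalize f kj = n at *
  interval_cases m <;> interval_cases n
  · exact absurd (by simpa using hroot) δ.root_ne_zero
  · exact Or.inr (Or.inl (PosRoot.root_injective (by simpa using hroot)))
  · rw [zero_smul, zero_add] at hroot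
    have : IsAddTorsionFree (Module.Dual ℂ H) := IsAddTorsionFree.of_isTorsionFree ℂ _
    exact absurd ⟨δ.1, hroot⟩ ((rootSystem H).nsmul_notMem_range_root (n := 2) (i := αj.1))
  · exact Or.inl (PosRoot.root_injective (by simpa using hroot))
  · exact Or.inr (Or.inr (PosRoot.root_injective (by rw [hroot, h.root_ij, one_smul, one_smul])))
  · exact absurd (by rw [hroot, one_smul]) (h.root_ne 2 le_rfl δ)

theorem sum_filter_eq {W : Type*} [AddCommMonoid W] {p q : ℕ} (hp : p ≤ 1) (hq : q ≤ 2)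
    (γ : Module.Dual ℂ H) (hγ : γ = p • αi.root + q • αj.root)
    [DecidablePred fun δ : PosRoot b => γ - δ.root ∈ Qplus b] (t : PosRoot b → W) :
    ∑ δ : PosRoot b with γ - δ.root ∈ Qplus b, t δ =
      (if 1 ≤ p then t αi else 0) + ((if 1 ≤ q then t αj else 0) +
        if 1 ≤ p ∧ 1 ≤ q then t αij else 0) := by
  classical
  rw [sum_filter, ← sum_subset (subset_univ {αi, αj, αij}), sum_insert, sum_insert, sum_singleton]
  · have e : ∀ (p' q' : ℤ) (δ : PosRoot b), δ.root = p' • αi.root + q' • αj.root →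
        (γ - δ.root ∈ Qplus b ↔ 0 ≤ (p : ℤ) - p' ∧ 0 ≤ (q : ℤ) - q') := by
      intro p' q' δ hδ
      rw [← h.mem_Qplus_iff, hγ, hδ, ← natCast_zsmul, ← natCast_zsmul]
      have : (p : ℤ) • αi.root + (q : ℤ) • αj.root - (p' • αi.root + q' • αj.root) =
          ((p : ℤ) - p') • αi.root + ((q : ℤ) - q') • αj.root := by module
      rw [this]
    have h1 : γ - αi.root ∈ Qplus b ↔ 1 ≤ p := by
      rw [e 1 0 αi (by module)]; omega
    have h2 : γ - αj.root ∈ Qplus b ↔ 1 ≤ q := by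
      rw [e 0 1 αj (by module)]; omega
    have h3 : γ - αij.root ∈ Qplus b ↔ 1 ≤ p ∧ 1 ≤ q := by
      rw [e 1 1 αij (by rw [h.root_ij]; module)]; omega
    simp only [h1, h2, h3]
  · rw [mem_singleton]
    exact h.ij_lt.ne'
  · rw [mem_insert, mem_singleton, not_or]
    exact ⟨h.i_ne_j, h.lt_ij.ne⟩
  · intro δ _ hδ
    refine if_neg fun hδ' => hδ ?_
    rw [hγ] at hδ'
    rcases h.eq_of_sub_mem_Qplus hp hq hδ' with rfl | rfl | rfl <;> simp

theorem orderedProd_eq {M : Type*} [Monoid M] (A : PosRoot b → M)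
    (hA : ∀ δ, δ ≠ αi → δ ≠ αj → δ ≠ αij → A δ = 1) :
    orderedProd A = A αi * (A αij * A αj) := by
  classical
  have hfilter : ∀ l : List (PosRoot b), (l.map A).prod =
      ((l.filter (fun δ => δ ∈ ({αi, αj, αij} : Finset (PosRoot b)))).map A).prod := by
    intro l
    induction l with
    | nil => rfl
    | cons δ l ih =>
      by_cases hδ : δ ∈ ({αi, αj, αij} : Finset (PosRoot b))
      · rw [List.filter_cons_of_pos (by simpa using hδ), List.map_cons, List.map_cons,
          List.prod_cons, List.prod_cons, ih]
      · rw [List.filter_cons_of_neg (by simpa using hδ), List.map_cons, List.prod_cons, ih,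
          hA δ, one_mul] <;> rintro rfl <;> simp at hδ
  have hl : (univ : Finset (PosRoot b)).sort.filter
      (fun δ => δ ∈ ({αi, αj, αij} : Finset (PosRoot b))) = [αi, αij, αj] := by
    refine List.Perm.eq_of_pairwise (le := (· ≤ ·)) (fun _ _ _ _ => le_antisymm) ?_ ?_ ?_
    · exact (Finset.pairwise_sort univ (· ≤ ·)).filter _
    · simp [h.lt_ij.le, h.ij_lt.le, (h.lt_ij.trans h.ij_lt).le]
    · rw [List.perm_ext_iff_of_nodup]
      · intro δ
        simp only [List.mem_filter, Finset.mem_sort, mem_univ, true_and, decide_eq_true_eq,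
          mem_insert, mem_singleton, List.mem_cons, List.not_mem_nil, or_false]
        tauto
      · exact (Finset.sort_nodup _ _).filter _
      · simp [h.lt_ij.ne, h.ij_lt.ne, h.i_ne_j]
  rw [orderedProd, hfilter, hl]
  simp

theorem partitions_eq {p q : ℕ} (hp : p ≤ 1) (hq : q ≤ 2) {k : PosRoot b → ℕ} :
    k ∈ partitions b (p • αi.root + q • αj.root) ↔
      (∀ δ, δ ≠ αi → δ ≠ αj → δ ≠ αij → k δ = 0) ∧ k αi + k αij = p ∧ k αj + k αij = q := by
  classical
  have hsum : (∀ δ, δ ≠ αi → δ ≠ αj → δ ≠ αij → k δ = 0) → ∑ δ, k δ • δ.root =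
      (k αi + k αij) • αi.root + (k αj + k αij) • αj.root := by
    intro hk
    rw [← sum_subset (subset_univ {αi, αj, αij}), sum_insert, sum_insert, sum_singleton, h.root_ij]
    · module
    · rw [mem_singleton]
      exact h.ij_lt.ne'
    · rw [mem_insert, mem_singleton, not_or]
      exact ⟨h.i_ne_j, h.lt_ij.ne⟩
    · intro δ _ hδ
      simp only [mem_insert, mem_singleton, not_or] at hδ
      rw [hk δ hδ.1 hδ.2.1 hδ.2.2, zero_smul]
  rw [partitions, Set.Finite.mem_toFinset, Set.mem_ofPred_eq]
  constructor
  · intro hk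
    have h0 : ∀ δ, δ ≠ αi → δ ≠ αj → δ ≠ αij → k δ = 0 := by
      intro δ h1 h2 h3
      by_contra hne
      have hmem : p • αi.root + q • αj.root - δ.root ∈ Qplus b := by
        rw [hk, ← add_sum_erase univ _ (mem_univ δ)]
        obtain ⟨n, hn⟩ := Nat.exists_eq_succ_of_ne_zero hne
        rw [hn, succ_nsmul, add_sub_right_comm, add_sub_cancel_right]
        exact add_mem (nsmul_mem δ.root_mem_Qplus _)
          (sum_mem fun ε _ => nsmul_mem ε.root_mem_Qplus _)
      rcases h.eq_of_sub_mem_Qplus hp hq hmem with h' | h' | h'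
      · exact h1 h'
      · exact h2 h'
      · exact h3 h'
    refine ⟨h0, ?_⟩
    rw [hsum h0] at hk
    obtain ⟨v, w, h1, h2, h3, h4, -⟩ := h.coweights
    have e1 := LinearMap.congr_fun hk v
    have e2 := LinearMap.congr_fun hk w
    simp only [LinearMap.add_apply, LinearMap.smul_apply, h1, h2, h3, h4, smul_zero, add_zero,
      zero_add, nsmul_eq_mul, mul_one, Nat.cast_inj] at e1 e2
    exact ⟨e1.symm, e2.symm⟩
  · rintro ⟨h0, h1, h2⟩
    rw [hsum h0, h1, h2]

theorem sum_partitions {W : Type*} [AddCommMonoid W] {p q : ℕ} (hp : p ≤ 1) (hq : q ≤ 2)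
    (G : ℕ → ℕ → ℕ → W) :
    ∑ k ∈ partitions b (p • αi.root + q • αj.root), G (k αi) (k αij) (k αj) =
      ∑ z ∈ range (min p q + 1), G (p - z) z (q - z) := by
  classical
  symm
  refine sum_bij (fun z _ δ => if δ = αi then p - z else if δ = αj then q - z else
    if δ = αij then z else 0) ?_ ?_ ?_ ?_
  · intro z hz
    rw [mem_range] at hz
    rw [h.partitions_eq hp hq]
    refine ⟨fun δ h1 h2 h3 => by simp [h1, h2, h3], ?_, ?_⟩
    · simp only [if_true, h.lt_ij.ne', h.ij_lt.ne, if_false]; omega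
    · simp only [if_true, h.lt_ij.ne', h.ij_lt.ne, h.i_ne_j.symm, if_false]; omega
  · intro z _ z' _ hzz
    have := congrFun hzz αij
    simpa [h.lt_ij.ne', h.ij_lt.ne] using this
  · intro k hk
    rw [h.partitions_eq hp hq] at hk
    obtain ⟨h0, h1, h2⟩ := hk
    refine ⟨k αij, ?_, ?_⟩
    · rw [mem_range]; omega
    · funext δ
      split_ifs with e1 e2 e3
      · subst e1; omega
      · subst e2; omega
      · subst e3; rfl
      · exact (h0 δ e1 e2 e3).symm
  · intro z _
    simp [h.lt_ij.ne', h.ij_lt.ne, h.i_ne_j.symm]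

/-- A partition is determined by the multiplicity z of α_i + α_j. This is where the position of the
sum between the two simple roots enters. -/
theorem blockProduct_eq {κ : InvForm L} {ħ : ℂ} {F : PosRoot b → ℕ → YYSeries κ b ħ}
    (hF : ∀ δ, F δ 0 = 1) {p q : ℕ} (hp : p ≤ 1) (hq : q ≤ 2) :
    blockProduct F (p • αi.root + q • αj.root) =
      ∑ z ∈ range (min p q + 1), F αi (p - z) * (F αij z * F αj (q - z)) := by
  rw [← h.sum_partitions hp hq fun u v w => F αi u * (F αij v * F αj w), blockProduct]
  refine sum_congr rfl fun k hk => ?_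
  rw [h.partitions_eq hp hq] at hk
  exact h.orderedProd_eq _ fun δ h1 h2 h3 => by rw [hk.1 δ h1 h2 h3, hF]

/-- The α_j-string through α_i ends exactly at α_i + α_j. For simple roots, the pairing is minus the
number of steps to the top of the string. -/
theorem exists_cartanA : ∃ i j : b.support, i ≠ j ∧ αi.root = (rootSystem H).root i.1 ∧
    αj.root = (rootSystem H).root j.1 ∧ cartanA b j i = -1 := by
  refine ⟨⟨αi.1, h.simple_i⟩, ⟨αj.1, h.simple_j⟩, ?_, rfl, rfl, ?_⟩
  · exact fun h' => h.i_ne_j (PosRoot.root_injective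
      (congrArg (fun k : b.support => (rootSystem H).root k.1) h'))
  · set i : b.support := ⟨αi.1, h.simple_i⟩
    set j : b.support := ⟨αj.1, h.simple_j⟩
    have hne : j ≠ i := fun h' => h.i_ne_j (PosRoot.root_injective
      (congrArg (fun k : b.support => (rootSystem H).root k.1) h'.symm))
    have h1 := RootPairing.Base.chainTopCoeff_eq_of_ne (b := b) hne
    have hlin := b.linearIndependent_pair_of_ne hne
    have h2 : 1 ≤ (rootSystem H).chainTopCoeff j.1 i.1 := by
      rw [← (rootSystem H).root_add_nsmul_mem_range_iff_le_chainTopCoeff hlin, one_smul]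
      exact ⟨αij.1, h.root_ij⟩
    have h3 : ¬2 ≤ (rootSystem H).chainTopCoeff j.1 i.1 := by
      rw [← (rootSystem H).root_add_nsmul_mem_range_iff_le_chainTopCoeff hlin]
      rintro ⟨k, hk⟩
      have hpos : b.IsPos k := αij.2.add αj.2 (by
        rw [hk]
        have : (rootSystem H).root αij.1 = (rootSystem H).root αi.1 + (rootSystem H).root αj.1 :=
          h.root_ij
        rw [this, two_smul, add_assoc])
      exact h.root_ne 2 le_rfl ⟨k, hpos⟩ hk
    change (rootSystem H).pairingIn ℤ i.1 j.1 = -1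
    omega

end AdmissibleTriple

end SmallWeights

/-! ### The recursion in weights up to α + 2β and its comparison with the factorization. -/

noncomputable section IntertwiningEquation

set_option linter.unusedSectionVars false

open LieAlgebra LieAlgebra.IsKilling Finset

theorem Ring.lie_smul_right {W : Type*} [Ring W] [Algebra ℂ W] (a : ℂ) (y z : W) :
    ⁅y, a • z⁆ = a • ⁅y, z⁆ := by
  rw [Ring.lie_def, Ring.lie_def, smul_sub, mul_smul_comm, smul_mul_assoc]

theorem Ring.lie_mul {W : Type*} [Ring W] (x y z : W) : ⁅x, y * z⁆ = ⁅x, y⁆ * z + y * ⁅x, z⁆ := by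
  simp only [Ring.lie_def]
  noncomm_ring

theorem Ring.lie_add_right {W : Type*} [Ring W] (x y z : W) : ⁅x, y + z⁆ = ⁅x, y⁆ + ⁅x, z⁆ := by
  simp only [Ring.lie_def]
  noncomm_ring

/-- The computation of the coefficient of weight `α + 2β` and order `s⁻³` of a factorized solution
of the intertwining equation. -/
theorem lie_eq_of_factorization {W : Type*} [Ring W] [Algebra ℂ W] {ħ : ℂ} (hħ : ħ ≠ 0)
    (F : ℕ → ℕ → PowerSeries W) (Dv Dw Xα Xβ Xθ : W) (h00 : F 0 0 = 1)
    (hv : ∀ p : ℕ, p ≤ 1 → ∀ q : ℕ, q ≤ 2 → ∀ n, (p : ℂ) • PowerSeries.coeff (n + 1) (F p q) =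
      ⁅Dv, PowerSeries.coeff n (F p q)⁆ +
        ħ • ((if 1 ≤ p then PowerSeries.coeff n (F (p - 1) q) * Xα else 0) +
          if 1 ≤ p ∧ 1 ≤ q then PowerSeries.coeff n (F (p - 1) (q - 1)) * Xθ else 0))
    (hw : ∀ p : ℕ, p ≤ 1 → ∀ q : ℕ, q ≤ 2 → ∀ n, (q : ℂ) • PowerSeries.coeff (n + 1) (F p q) =
      ⁅Dw, PowerSeries.coeff n (F p q)⁆ +
        ħ • ((if 1 ≤ q then PowerSeries.coeff n (F p (q - 1)) * Xβ else 0) +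
          if 1 ≤ p ∧ 1 ≤ q then PowerSeries.coeff n (F (p - 1) (q - 1)) * Xθ else 0))
    (h0 : ∀ p : ℕ, p ≤ 1 → ∀ q : ℕ, q ≤ 2 → p + q ≠ 0 → PowerSeries.coeff 0 (F p q) = 0)
    (hF : F 1 2 = F 1 0 * F 0 2 + (F 1 1 - F 1 0 * F 0 1) * F 0 1)
    (hcomm : Xβ * Xθ = Xθ * Xβ) :
    (ħ / 2) • ⁅Xβ, ⁅Xβ, Xα⁆⁆ = ⁅Xθ, ⁅Dw, Xβ⁆⁆ := by
  have one0 : PowerSeries.coeff 0 (F 0 0) = 1 := by rw [h00]; simp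
  have z10 := h0 1 le_rfl 0 (by omega) (by omega)
  have z01 := h0 0 (by omega) 1 (by omega) (by omega)
  have z02 := h0 0 (by omega) 2 (by omega) (by omega)
  have z11 := h0 1 (by omega) 1 (by omega) (by omega)
  have z12 := h0 1 (by omega) 2 (by omega) (by omega)
  have lz : ∀ y : W, ⁅y, (0 : W)⁆ = 0 := fun y => by rw [Ring.lie_def, mul_zero, zero_mul, sub_zero]
  have a10 : PowerSeries.coeff 1 (F 1 0) = ħ • Xα := by
    simpa [z10, one0, lz] using hv 1 le_rfl 0 (by omega) 0
  have a01 : PowerSeries.coeff 1 (F 0 1) = ħ • Xβ := by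
    simpa [z01, one0, lz] using hw 0 (by omega) 1 (by omega) 0
  have a02 : PowerSeries.coeff 1 (F 0 2) = 0 := by
    simpa [z01, z02, lz] using hw 0 (by omega) 2 le_rfl 0
  have a11 : PowerSeries.coeff 1 (F 1 1) = ħ • Xθ := by
    simpa [z11, z01, one0, lz] using hv 1 (by omega) 1 (by omega) 0
  have a12 : PowerSeries.coeff 1 (F 1 2) = 0 := by
    simpa [z12, z02, z01, lz] using hv 1 (by omega) 2 (by omega) 0
  -- In weight β the recursion for the coweight dual to α has left side 0 and no root terms.
  have hZ : ⁅Dv, Xβ⁆ = 0 := by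
    have := hv 0 (by omega) 1 (by omega) 1
    simp only [a01, Ring.lie_smul_right] at this
    simpa [hħ] using this.symm
  have b01 : PowerSeries.coeff 2 (F 0 1) = ħ • ⁅Dw, Xβ⁆ := by
    have := hw 0 (by omega) 1 (by omega) 1
    simp only [a01, Ring.lie_smul_right] at this
    simpa [h00, PowerSeries.coeff_one] using this
  have b02 : PowerSeries.coeff 2 (F 0 2) = (ħ ^ 2 / 2) • (Xβ * Xβ) := by
    have := hw 0 (by omega) 2 (by omega) 1
    simp only [a01, a02, lz] at this
    have h2 : (2 : ℂ) • PowerSeries.coeff 2 (F 0 2) = (ħ ^ 2) • (Xβ * Xβ) := by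
      simpa [smul_smul, sq] using this
    rw [← inv_smul_smul₀ (two_ne_zero (α := ℂ)) (PowerSeries.coeff 2 (F 0 2)), h2, smul_smul]
    congr 1
    ring
  have b11 : PowerSeries.coeff 2 (F 1 1) = ħ • ⁅Dv, Xθ⁆ + ħ ^ 2 • (Xβ * Xα) := by
    have := hv 1 (by omega) 1 (by omega) 1
    simp only [a11, a01, Ring.lie_smul_right] at this
    simpa [h00, PowerSeries.coeff_one, smul_smul, sq] using this
  have b12 : PowerSeries.coeff 2 (F 1 2) = ħ ^ 2 • (Xβ * Xθ) := by
    have := hv 1 (by omega) 2 (by omega) 1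
    simp only [a12, a01, lz] at this
    simpa [a02, a01, smul_smul, sq] using this
  -- The recursion for the coweight dual to α avoids division, as this weight contains α once. The
  -- term with [Dv, Xθ] cancels later, since [Dv, Xθ] commutes with Xβ.
  have c12 : PowerSeries.coeff 3 (F 1 2) = ħ ^ 2 • (Xβ * ⁅Dv, Xθ⁆) +
      ((ħ ^ 3 / 2) • (Xβ * Xβ * Xα) + ħ ^ 2 • (⁅Dw, Xβ⁆ * Xθ)) := by
    have := hv 1 (by omega) 2 (by omega) 2
    simp only [b12, Ring.lie_smul_right, Ring.lie_mul, hZ, zero_mul, zero_add] at this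
    have h3 : ħ * (ħ ^ 2 / 2) = ħ ^ 3 / 2 := by ring
    simpa [b02, b01, smul_smul, ← sq, h3] using this
  have hc : Xβ * ⁅Dv, Xθ⁆ = ⁅Dv, Xθ⁆ * Xβ := by
    have := congrArg (fun y => ⁅Dv, y⁆) hcomm
    simpa [Ring.lie_mul, hZ] using this
  have key := congrArg (PowerSeries.coeff 3) hF
  have e3 : ∀ P Q : PowerSeries W, PowerSeries.coeff 3 (P * Q) =
      PowerSeries.coeff 0 P * PowerSeries.coeff 3 Q + PowerSeries.coeff 1 P * PowerSeries.coeff 2 Q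
      + PowerSeries.coeff 2 P * PowerSeries.coeff 1 Q
      + PowerSeries.coeff 3 P * PowerSeries.coeff 0 Q := by
    intro P Q
    rw [PowerSeries.coeff_mul, Nat.sum_antidiagonal_eq_sum_range_succ_mk]
    simp [sum_range_succ]
  have e2 : ∀ P Q : PowerSeries W, PowerSeries.coeff 2 (P * Q) =
      PowerSeries.coeff 0 P * PowerSeries.coeff 2 Q + PowerSeries.coeff 1 P * PowerSeries.coeff 1 Q
      + PowerSeries.coeff 2 P * PowerSeries.coeff 0 Q := by
    intro P Q
    rw [PowerSeries.coeff_mul, Nat.sum_antidiagonal_eq_sum_range_succ_mk]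
    simp [sum_range_succ]
  have e1 : ∀ P Q : PowerSeries W, PowerSeries.coeff 1 (P * Q) =
      PowerSeries.coeff 0 P * PowerSeries.coeff 1 Q
      + PowerSeries.coeff 1 P * PowerSeries.coeff 0 Q := by
    intro P Q
    rw [PowerSeries.coeff_mul, Nat.sum_antidiagonal_eq_sum_range_succ_mk]
    simp [sum_range_succ]
  have e0 : ∀ P Q : PowerSeries W, PowerSeries.coeff 0 (P * Q) =
      PowerSeries.coeff 0 P * PowerSeries.coeff 0 Q := by
    intro P Q
    rw [PowerSeries.coeff_mul, Nat.sum_antidiagonal_eq_sum_range_succ_mk]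
    simp
  simp only [map_add, map_sub, e3, e2, e1, e0, c12, z10, z01, z02, z11, a10, a01, a02, a11, b01,
    b02, b11, zero_mul, mul_zero, zero_add, add_zero, sub_zero, hc] at key
  have h2 : ħ ^ 2 • ((ħ / 2) • ⁅Xβ, ⁅Xβ, Xα⁆⁆) = ħ ^ 2 • ⁅Xθ, ⁅Dw, Xβ⁆⁆ := by
    generalize ⁅Dw, Xβ⁆ = Y at *
    generalize ⁅Dv, Xθ⁆ = Z at *
    simp only [Ring.lie_def, mul_sub, sub_mul, add_mul, smul_mul_assoc, mul_smul_comm, smul_smul,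
      smul_sub, mul_assoc, smul_add] at key ⊢
    linear_combination (norm := module) key
  exact smul_right_injective W (pow_ne_zero 2 hħ) h2

end IntertwiningEquation

/-! ### Coefficientwise form of the equations, and weights on the left tensor factor. -/

noncomputable section SeriesCoefficients

set_option linter.unusedSectionVars false

open LieAlgebra LieAlgebra.IsKilling Finset
open scoped TensorProduct

namespace PowerSeries

variable {R : Type*} [Ring R]

theorem coeff_ofPowerSeries_of_neg (P : PowerSeries R) {k : ℤ} (hk : k < 0) :
    (HahnSeries.ofPowerSeries ℤ R P).coeff k = 0 := by
  rw [HahnSeries.ofPowerSeries_apply, HahnSeries.embDomain_notin_image_support]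
  rintro ⟨n, -, hn⟩
  have : (n : ℤ) = k := hn
  omega

theorem coeff_lie_C_add_single (a d : R) (f : LaurentSeries R)
    (k : ℤ) : (⁅HahnSeries.C a + HahnSeries.single (-1 : ℤ) d, f⁆).coeff k =
      ⁅a, f.coeff k⁆ + ⁅d, f.coeff (k + 1)⁆ := by
  rw [Ring.lie_def, add_mul, mul_add, HahnSeries.coeff_sub, HahnSeries.coeff_add,
    HahnSeries.coeff_add, HahnSeries.C_apply, HahnSeries.coeff_single_zero_mul,
    HahnSeries.coeff_mul_single_zero, HahnSeries.coeff_single_mul, HahnSeries.coeff_mul_single,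
    sub_neg_eq_add, Ring.lie_def, Ring.lie_def, add_sub_add_comm]

/-- The term with s shifts coefficients by one, so the exponent -1 of the variable gives a condition
on the constant term alone, and the other exponents give a recursion. -/
theorem lie_C_add_single_eq_iff (a d : R) (P Q : PowerSeries R) :
    ⁅HahnSeries.C a + HahnSeries.single (-1 : ℤ) d, HahnSeries.ofPowerSeries ℤ R P⁆ =
        HahnSeries.ofPowerSeries ℤ R Q ↔
      ⁅d, coeff 0 P⁆ = 0 ∧ ∀ n, ⁅a, coeff n P⁆ + ⁅d, coeff (n + 1) P⁆ = coeff n Q := by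
  have lz : ∀ y : R, Bracket.bracket y (0 : R) = 0 :=
    fun y => by rw [Ring.lie_def, mul_zero, zero_mul, sub_zero]
  have e0 : (-1 : ℤ) + 1 = (0 : ℕ) := rfl
  constructor
  · intro he
    have hc := fun k => congrArg (fun z => HahnSeries.coeff z k) he
    simp only [coeff_lie_C_add_single] at hc
    refine ⟨?_, fun n => ?_⟩
    · have := hc (-1)
      rwa [coeff_ofPowerSeries_of_neg P neg_one_lt_zero,
        coeff_ofPowerSeries_of_neg Q neg_one_lt_zero, lz, zero_add, e0,
        HahnSeries.ofPowerSeries_apply_coeff] at this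
    · have := hc n
      rwa [HahnSeries.ofPowerSeries_apply_coeff, HahnSeries.ofPowerSeries_apply_coeff,
        ← Nat.cast_succ, HahnSeries.ofPowerSeries_apply_coeff] at this
  · rintro ⟨h0, hs⟩
    ext k
    rw [coeff_lie_C_add_single]
    rcases lt_trichotomy k (-1) with hk | rfl | hk
    · rw [coeff_ofPowerSeries_of_neg P (by omega : k < 0),
        coeff_ofPowerSeries_of_neg Q (by omega : k < 0),
        coeff_ofPowerSeries_of_neg P (by omega : k + 1 < 0), lz, lz, add_zero]
    · rw [e0, HahnSeries.ofPowerSeries_apply_coeff, h0,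
        coeff_ofPowerSeries_of_neg P neg_one_lt_zero,
        coeff_ofPowerSeries_of_neg Q neg_one_lt_zero, lz, add_zero]
    · lift k to ℕ using (by omega : 0 ≤ k)
      rw [← Nat.cast_succ, HahnSeries.ofPowerSeries_apply_coeff,
        HahnSeries.ofPowerSeries_apply_coeff, HahnSeries.ofPowerSeries_apply_coeff, hs]

end PowerSeries

variable {L : Type*} [LieRing L] [LieAlgebra ℂ L] [FiniteDimensional ℂ L]
  [LieAlgebra.IsSemisimple ℂ L] {H : LieSubalgebra ℂ L} [H.IsCartanSubalgebra]
  {κ : InvForm L} {b : (rootSystem H).Base} {ħ : ℂ}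

section Coefficients

variable (κ b ħ) in
/-- The coefficient `T(h) ⊗ 1 + 1 ⊗ T(h)` of `s⁰`. -/
def tSum (h : H) : YangianLie κ b ħ ⊗[ℂ] YangianLie κ b ħ :=
  tEmb κ b ħ h ⊗ₜ[ℂ] (1 : YangianLie κ b ħ) + (1 : YangianLie κ b ħ) ⊗ₜ[ℂ] tEmb κ b ħ h

variable (κ b ħ) in
/-- The coefficient `h ⊗ 1` of `s`. -/
def hLeft (h : H) : YangianLie κ b ħ ⊗[ℂ] YangianLie κ b ħ :=
  hEmb κ b ħ h ⊗ₜ[ℂ] (1 : YangianLie κ b ħ)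

theorem coeff_toLaurent (P : YYSeries κ b ħ) (n : ℕ) :
    (toLaurent κ b ħ P).coeff (n : ℤ) = PowerSeries.coeff n P :=
  HahnSeries.ofPowerSeries_apply_coeff P n

theorem coeff_toLaurent_neg (P : YYSeries κ b ħ) {k : ℤ} (hk : k < 0) :
    (toLaurent κ b ħ P).coeff k = 0 :=
  PowerSeries.coeff_ofPowerSeries_of_neg P hk

theorem lie_dElem_eq_iff (h : H) (P Q : YYSeries κ b ħ) :
    ⁅dElem κ b ħ h, toLaurent κ b ħ P⁆ = toLaurent κ b ħ Q ↔
      ⁅hLeft κ b ħ h, PowerSeries.coeff 0 P⁆ = 0 ∧ ∀ n, ⁅tSum κ b ħ h, PowerSeries.coeff n P⁆ +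
        ⁅hLeft κ b ħ h, PowerSeries.coeff (n + 1) P⁆ = PowerSeries.coeff n Q :=
  PowerSeries.lie_C_add_single_eq_iff _ _ P Q

theorem toLaurent_smul (a : ℂ) (P : YYSeries κ b ħ) :
    toLaurent κ b ħ (a • P) = a • toLaurent κ b ħ P := by
  ext k
  rw [HahnSeries.coeff_smul]
  rcases lt_or_ge k 0 with hk | hk
  · rw [coeff_toLaurent_neg _ hk, coeff_toLaurent_neg _ hk, smul_zero]
  · lift k to ℕ using hk
    rw [coeff_toLaurent, coeff_toLaurent, PowerSeries.coeff_smul]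

theorem toLaurent_C (X : YangianLie κ b ħ ⊗[ℂ] YangianLie κ b ħ) :
    toLaurent κ b ħ (PowerSeries.C X) = HahnSeries.C X := HahnSeries.ofPowerSeries_C X

variable {c : SimpleRootVectors κ b} (x : RootVectors c ħ)

/-- The element `x^-_{β,0} ⊗ x^+_{β,0}`. -/
def rootTensor (β : PosRoot b) : YangianLie κ b ħ ⊗[ℂ] YangianLie κ b ħ := x.xm β ⊗ₜ[ℂ] x.xp β

open Classical in
theorem satisfiesBlockIE_iff (F : Module.Dual ℂ H → YYSeries κ b ħ) :
    SatisfiesBlockIE x F ↔ ∀ h : H, ∀ γ ∈ Qplus b,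
      ⁅hLeft κ b ħ h, PowerSeries.coeff 0 (F γ)⁆ = 0 ∧
      ∀ n, ⁅tSum κ b ħ h, PowerSeries.coeff n (F γ)⁆ +
        ⁅hLeft κ b ħ h, PowerSeries.coeff (n + 1) (F γ)⁆ =
        -(ħ • ∑ α : PosRoot b with γ - α.root ∈ Qplus b,
          α.root h • (PowerSeries.coeff n (F (γ - α.root)) * rootTensor x α)) := by
  refine forall_congr' fun h => forall₂_congr fun γ _ => ?_
  have e : -(ħ • ∑ α : PosRoot b with γ - α.root ∈ Qplus b,
        α.root h • (toLaurent κ b ħ (F (γ - α.root)) * HahnSeries.C (x.xm α ⊗ₜ[ℂ] x.xp α))) =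
      toLaurent κ b ħ (-(ħ • ∑ α : PosRoot b with γ - α.root ∈ Qplus b,
        α.root h • (F (γ - α.root) * PowerSeries.C (rootTensor x α)))) := by
    rw [map_neg, toLaurent_smul, map_sum]
    simp only [toLaurent_smul, map_mul, toLaurent_C, rootTensor]
  rw [e, lie_dElem_eq_iff]
  simp only [map_neg, PowerSeries.coeff_smul, map_sum, PowerSeries.coeff_mul_C]

theorem satisfiesIE_iff (R : YYSeries κ b ħ) :
    SatisfiesIE x R ↔ ∀ h : H, ⁅hLeft κ b ħ h, PowerSeries.coeff 0 R⁆ = 0 ∧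
      ∀ n, ⁅tSum κ b ħ h, PowerSeries.coeff n R⁆ + ⁅hLeft κ b ħ h, PowerSeries.coeff (n + 1) R⁆ =
        PowerSeries.coeff n R * rMinusH x h := by
  refine forall_congr' fun h => ?_
  rw [← toLaurent_C, ← map_mul, lie_dElem_eq_iff]
  simp only [PowerSeries.coeff_mul_C]

end Coefficients

/-! ### Weights for the left tensor factor -/

variable (κ b ħ) in
/-- The weight space of weight `χ` for the adjoint action of `𝔥` on the left tensor factor. -/
def lWeight (χ : Module.Dual ℂ H) : Submodule ℂ (YangianLie κ b ħ ⊗[ℂ] YangianLie κ b ħ) where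
  carrier := {y | ∀ h : H, ⁅hLeft κ b ħ h, y⁆ = χ h • y}
  add_mem' {x y} hx hy h := by rw [Ring.lie_add_right, hx h, hy h, smul_add]
  zero_mem' h := by rw [Ring.lie_def, mul_zero, zero_mul, sub_zero, smul_zero]
  smul_mem' c y hy h := by rw [Ring.lie_smul_right, hy h, smul_comm]

theorem mul_mem_lWeight {χ ψ : Module.Dual ℂ H} {y z : YangianLie κ b ħ ⊗[ℂ] YangianLie κ b ħ}
    (hy : y ∈ lWeight κ b ħ χ) (hz : z ∈ lWeight κ b ħ ψ) : y * z ∈ lWeight κ b ħ (χ + ψ) := by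
  intro h
  rw [Ring.lie_mul, hy h, hz h, LinearMap.add_apply, add_smul, smul_mul_assoc, mul_smul_comm]

theorem one_mem_lWeight : (1 : YangianLie κ b ħ ⊗[ℂ] YangianLie κ b ħ) ∈ lWeight κ b ħ 0 := by
  intro h
  rw [Ring.lie_def, mul_one, one_mul, sub_self, LinearMap.zero_apply, zero_smul]

theorem tmul_mem_lWeight {χ : Module.Dual ℂ H} {y : YangianLie κ b ħ} (hy : y ∈ yWeight κ b ħ χ)
    (z : YangianLie κ b ħ) : y ⊗ₜ[ℂ] z ∈ lWeight κ b ħ χ := by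
  intro h
  rw [Ring.lie_def, hLeft, Algebra.TensorProduct.tmul_mul_tmul, Algebra.TensorProduct.tmul_mul_tmul,
    one_mul, mul_one, ← TensorProduct.sub_tmul, ← Ring.lie_def, hy h, TensorProduct.smul_tmul']

theorem blockSpace_le_lWeight (γ : Module.Dual ℂ H) : blockSpace κ b ħ γ ≤ lWeight κ b ħ (-γ) := by
  rintro _ ⟨t, rfl⟩
  induction t with
  | zero => rw [map_zero]; exact zero_mem _
  | tmul y z => exact tmul_mem_lWeight y.2.2 _
  | add t u ht hu => rw [map_add]; exact add_mem ht hu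

theorem coeff_mul_mem_lWeight {χ ψ : Module.Dual ℂ H} {P Q : YYSeries κ b ħ}
    (hP : ∀ n, PowerSeries.coeff n P ∈ lWeight κ b ħ χ)
    (hQ : ∀ n, PowerSeries.coeff n Q ∈ lWeight κ b ħ ψ) (n : ℕ) :
    PowerSeries.coeff n (P * Q) ∈ lWeight κ b ħ (χ + ψ) := by
  rw [PowerSeries.coeff_mul]
  exact sum_mem fun p _ => mul_mem_lWeight (hP _) (hQ _)

theorem coeff_one_mem_lWeight (n : ℕ) :
    PowerSeries.coeff n (1 : YYSeries κ b ħ) ∈ lWeight κ b ħ 0 := by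
  rw [PowerSeries.coeff_one]
  split_ifs
  · exact one_mem_lWeight
  · exact zero_mem _

theorem coeff_orderedProd_mem_lWeight [LinearOrder (PosRoot b)] {χ : PosRoot b → Module.Dual ℂ H}
    {A : PosRoot b → YYSeries κ b ħ} (hA : ∀ α n, PowerSeries.coeff n (A α) ∈ lWeight κ b ħ (χ α))
    (n : ℕ) : PowerSeries.coeff n (orderedProd A) ∈ lWeight κ b ħ (∑ α, χ α) := by
  have key : ∀ (l : List (PosRoot b)) n,
      PowerSeries.coeff n (l.map A).prod ∈ lWeight κ b ħ (l.map χ).sum := by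
    intro l
    induction l with
    | nil => exact coeff_one_mem_lWeight
    | cons α l ih =>
      intro n
      rw [List.map_cons, List.map_cons, List.prod_cons, List.sum_cons]
      exact coeff_mul_mem_lWeight (hA α) ih n
  have := key (univ.sort (· ≤ ·)) n
  rwa [← Multiset.sum_coe, ← Multiset.map_coe, Finset.sort_eq] at this

theorem coeff_blockProduct_mem_lWeight [LinearOrder (PosRoot b)]
    {F : PosRoot b → ℕ → YYSeries κ b ħ} (hF : IsBlockFamily F) (γ : Module.Dual ℂ H) (n : ℕ) :
    PowerSeries.coeff n (blockProduct F γ) ∈ lWeight κ b ħ (-γ) := by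
  rw [blockProduct, map_sum]
  refine sum_mem fun k hk => ?_
  rw [partitions, Set.Finite.mem_toFinset, Set.mem_ofPred_eq] at hk
  rw [hk, ← sum_neg_distrib]
  exact coeff_orderedProd_mem_lWeight
    (fun α n => blockSpace_le_lWeight _ (hF.mem α (k α) n)) n

end SeriesCoefficients

/-! ### Relations at levels zero and one. -/

section SerreConsequences

open Finset

namespace Yangian

variable {I : Type*} {A : Matrix I I ℤ} {d : I → ℂ} {ħ : ℂ}

/-- The commutator of ξ_{i,0}² with x is a multiple of the anticommutator of ξ_{i,0} and x. The
correction in t_{i,1} removes exactly the quadratic term of the defining relation. -/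
theorem lie_t1_x (ε : ℤˣ) (i j : I) :
    ⁅t1 A d ħ i, x A d ħ ε j 0⁆ = (((ε : ℤ) : ℂ) * (d i * (A i j : ℂ))) • x A d ħ ε j 1 := by
  have h1 := lie_xi_x (A := A) (d := d) (ħ := ħ) ε i j 0 0
  have h2 := lie_xi_zero_x (A := A) (d := d) (ħ := ħ) ε i j 0
  have h3 := lie_xi_zero_x (A := A) (d := d) (ħ := ħ) ε i j 1
  rw [zero_add, h3] at h1
  rw [Ring.lie_def] at h1 h2 ⊢
  have h4 : xi A d ħ i 0 ^ 2 * x A d ħ ε j 0 - x A d ħ ε j 0 * xi A d ħ i 0 ^ 2 =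
      (((ε : ℤ) : ℂ) * (d i * (A i j : ℂ))) •
        (xi A d ħ i 0 * x A d ħ ε j 0 + x A d ħ ε j 0 * xi A d ħ i 0) := by
    rw [smul_add, ← mul_smul_comm, ← smul_mul_assoc, ← h2]
    noncomm_ring
  rw [t1, sub_mul, mul_sub, smul_mul_assoc, mul_smul_comm]
  linear_combination (norm := module) h1 - (ħ / 2) • h4

theorem lie_x_one_x_zero (ε : ℤˣ) (j : I) (hj : A j j = 2) :
    ⁅x A d ħ ε j 1, x A d ħ ε j 0⁆ =
      (((ε : ℤ) : ℂ) * ħ * d j) • (x A d ħ ε j 0 * x A d ħ ε j 0) := by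
  have h := lie_x_x (A := A) (d := d) (ħ := ħ) ε j j 0 0
  rw [zero_add, hj, Ring.lie_def, Ring.lie_def] at h
  rw [Ring.lie_def]
  push_cast at h
  linear_combination (norm := module) (1 / 2 : ℂ) • h

theorem sum_lie_lie (ε : ℤˣ) {i j : I} (hij : i ≠ j) (hA : A i j = -1) (r s t : ℕ) :
    ⁅x A d ħ ε i r, ⁅x A d ħ ε i s, x A d ħ ε j t⁆⁆ +
      ⁅x A d ħ ε i s, ⁅x A d ħ ε i r, x A d ħ ε j t⁆⁆ = 0 := by
  have key : ∀ m, (1 - A i j).toNat = m → ∀ r : Fin m → ℕ, ∑ π : Equiv.Perm (Fin m),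
      (List.ofFn fun k => r (π k)).foldr (fun t y => ⁅x A d ħ ε i t, y⁆) (x A d ħ ε j t) = 0 := by
    rintro m rfl r
    exact sum_foldr_lie ε hij r t
  have h2 := key 2 (by rw [hA]; rfl) ![r, s]
  have hu : (univ : Finset (Equiv.Perm (Fin 2))) = {1, Equiv.swap 0 1} := by decide
  rw [hu, sum_pair (by decide)] at h2
  simpa using h2

theorem lie_x_zero_lie_x_zero (ε : ℤˣ) {i j : I} (hij : i ≠ j) (hA : A i j = -1) :
    ⁅x A d ħ ε i 0, ⁅x A d ħ ε i 0, x A d ħ ε j 0⁆⁆ = 0 := by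
  have h := sum_lie_lie (d := d) (ħ := ħ) ε hij hA 0 0 0
  rw [← two_smul ℂ] at h
  exact (smul_eq_zero.mp h).resolve_left two_ne_zero

/-- The Serre relation gives the sum of the two nestings of x_{i,1} and x_{i,0}, and the Jacobi
identity with [x_{i,1}, x_{i,0}] ∈ ℂ x_{i,0}² gives their difference. -/
theorem lie_x_one_lie_x_zero (ε : ℤˣ) {i j : I} (hij : i ≠ j) (hi : A i i = 2)
    (hA : A i j = -1) : ⁅x A d ħ ε i 1, ⁅x A d ħ ε i 0, x A d ħ ε j 0⁆⁆ =
      (((ε : ℤ) : ℂ) * ħ * d i) • (x A d ħ ε i 0 * ⁅x A d ħ ε i 0, x A d ħ ε j 0⁆) := by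
  have h1 := lie_x_one_x_zero (d := d) (ħ := ħ) ε i hi
  have h2 := sum_lie_lie (d := d) (ħ := ħ) ε hij hA 1 0 0
  have h3 := lie_x_zero_lie_x_zero (d := d) (ħ := ħ) ε hij hA
  have h4 := congrArg (fun y => ⁅y, x A d ħ ε j 0⁆) h1
  simp only [Ring.lie_def, mul_sub, sub_mul, smul_mul_assoc, mul_smul_comm, ← mul_assoc] at *
  linear_combination (norm := module) (1 / 2 : ℂ) • h2 + (1 / 2 : ℂ) • h4
    - (1 / 2 * (ε : ℤ) * ħ * d i : ℂ) • h3

end Yangian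

open scoped TensorProduct in
/-- The computation in `Y ⊗ Y` behind the comparison of the two sides at weight `α + 2β`. -/
theorem tmul_eq_zero_of_lie_eq {W : Type*} [Ring W] [Algebra ℂ W] {ħ d : ℂ} (hd : d ≠ 0)
    {a b b₁ a' b' b₁' : W} (hb : ⁅b, ⁅b, a⁆⁆ = 0) (hb' : ⁅b', ⁅b', a'⁆⁆ = 0)
    (h1 : ⁅b₁, ⁅b, a⁆⁆ = -(ħ * d) • (b * ⁅b, a⁆))
    (h1' : ⁅b₁', ⁅b', a'⁆⁆ = (ħ * d) • (b' * ⁅b', a'⁆))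
    (h : (ħ / 2) • ⁅b ⊗ₜ[ℂ] b', ⁅b ⊗ₜ[ℂ] b', a ⊗ₜ[ℂ] a'⁆⁆ =
      ⁅(-d)⁻¹ • (⁅b, a⁆ ⊗ₜ[ℂ] ⁅b', a'⁆), b ⊗ₜ[ℂ] b₁' - b₁ ⊗ₜ[ℂ] b'⁆) (hħ : ħ ≠ 0) :
    (b * ⁅b, a⁆) ⊗ₜ[ℂ] (b' * ⁅b', a'⁆) = 0 := by
  have hba : b * a = a * b + ⁅b, a⁆ := by rw [Ring.lie_def]; abel
  have hba' : b' * a' = a' * b' + ⁅b', a'⁆ := by rw [Ring.lie_def]; abel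
  have h2 : ⁅b ⊗ₜ[ℂ] b', a ⊗ₜ[ℂ] a'⁆ = b ⊗ₜ[ℂ] b' * a ⊗ₜ[ℂ] a' - a ⊗ₜ[ℂ] a' * b ⊗ₜ[ℂ] b' :=
    Ring.lie_def _ _
  rw [h2] at h
  generalize ⁅b, a⁆ = c at *
  generalize ⁅b', a'⁆ = c' at *
  rw [Ring.lie_def, sub_eq_zero] at hb hb'
  rw [Ring.lie_def, sub_eq_iff_eq_add] at h1 h1'
  have hba2 : ∀ y, b * (a * y) = a * (b * y) + c * y := fun y => by
    rw [← mul_assoc, hba, add_mul, mul_assoc]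
  have hba2' : ∀ y, b' * (a' * y) = a' * (b' * y) + c' * y := fun y => by
    rw [← mul_assoc, hba', add_mul, mul_assoc]
  simp only [Ring.lie_def, mul_sub, sub_mul, Algebra.TensorProduct.tmul_mul_tmul, hba, hba2, hba',
    hba2', hb, hb', h1, h1', mul_add, add_mul, mul_assoc, TensorProduct.tmul_add,
    TensorProduct.add_tmul, ← TensorProduct.smul_tmul', TensorProduct.tmul_smul, smul_mul_assoc,
    mul_smul_comm] at h ⊢
  have e : (-d)⁻¹ * (-(ħ * d)) = ħ := by field_simp
  -- Here c = [b, a] and c' = [b', a'] commute with b and b'. After normal ordering, the double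
  -- bracket leaves cb ⊗ c'b' twice, hence ħ times it. On the right the level one terms cancel and
  -- each tensor factor contributes ħ, hence 2ħ.
  have h3 : ħ • ((c * b) ⊗ₜ[ℂ] (c' * b')) = ((-d)⁻¹ * (-(ħ * d)) + (-d)⁻¹ * (-(ħ * d))) •
      ((c * b) ⊗ₜ[ℂ] (c' * b')) := by
    linear_combination (norm := module) h
  rw [e] at h3
  have h4 : ħ • ((c * b) ⊗ₜ[ℂ] (c' * b')) = 0 := by
    linear_combination (norm := module) -h3
  exact (smul_eq_zero.mp h4).resolve_left hħ

end SerreConsequences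

/-! ### No product of blocks solves the componentwise equation. -/

noncomputable section NoBlockSolution

set_option linter.unusedSectionVars false

open LieAlgebra LieAlgebra.IsKilling Finset
open scoped TensorProduct

variable {L : Type*} [LieRing L] [LieAlgebra ℂ L] [FiniteDimensional ℂ L]
  [LieAlgebra.IsSemisimple ℂ L] {H : LieSubalgebra ℂ L} [H.IsCartanSubalgebra]
  {κ : InvForm L} {b : (rootSystem H).Base} {ħ : ℂ} {c : SimpleRootVectors κ b}
  {x : RootVectors c ħ}

variable (κ b ħ) in
/-- The generators `x^ε_{i,r}` of the Yangian of `𝔤`. -/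
abbrev simpleX (ε : ℤˣ) (i : b.support) (r : ℕ) : YangianLie κ b ħ :=
  Yangian.x (cartanA b) (cartanD κ b) ħ ε i r

open Classical in
theorem SatisfiesBlockIE.smul_coeff_succ {G : Module.Dual ℂ H → YYSeries κ b ħ}
    (hG : SatisfiesBlockIE x G)
    (hw : ∀ γ n, PowerSeries.coeff n (G γ) ∈ lWeight κ b ħ (-γ)) {γ : Module.Dual ℂ H}
    (hγ : γ ∈ Qplus b) (u : H) (n : ℕ) :
    γ u • PowerSeries.coeff (n + 1) (G γ) = ⁅tSum κ b ħ u, PowerSeries.coeff n (G γ)⁆ +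
      ħ • ∑ δ : PosRoot b with γ - δ.root ∈ Qplus b,
        δ.root u • (PowerSeries.coeff n (G (γ - δ.root)) * rootTensor x δ) := by
  have h1 := ((satisfiesBlockIE_iff x G).mp hG u γ hγ).2 n
  rw [hw γ (n + 1) u, LinearMap.neg_apply] at h1
  linear_combination (norm := module) -h1

theorem SatisfiesBlockIE.coeff_zero {G : Module.Dual ℂ H → YYSeries κ b ħ}
    (hG : SatisfiesBlockIE x G)
    (hw : ∀ γ n, PowerSeries.coeff n (G γ) ∈ lWeight κ b ħ (-γ)) {γ : Module.Dual ℂ H}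
    (hγ : γ ∈ Qplus b) {u : H} (hu : γ u ≠ 0) : PowerSeries.coeff 0 (G γ) = 0 := by
  have h1 := ((satisfiesBlockIE_iff x G).mp hG u γ hγ).1
  rw [hw γ 0 u, LinearMap.neg_apply] at h1
  exact (smul_eq_zero.mp h1).resolve_left (neg_ne_zero.mpr hu)

theorem lie_tEmb_x (c : SimpleRootVectors κ b) (h : H) (ε : ℤˣ) (j : b.support) :
    ⁅tEmb κ b ħ h, Yangian.x (cartanA b) (cartanD κ b) ħ ε j 0⁆ =
      (((ε : ℤ) : ℂ) * (rootSystem H).root j.1 h) •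
        Yangian.x (cartanA b) (cartanD κ b) ħ ε j 1 := by
  induction h using dhBasis_induction (κ := κ) (b := b) with
  | coe i => rw [tEmb_dhBasis, Yangian.lie_t1_x, root_dhBasis c]
  | zero => simp [Ring.lie_def]
  | add v w hv hw =>
    rw [Ring.lie_def] at *
    rw [map_add, add_mul, mul_add, add_sub_add_comm, hv, hw, ← add_smul, map_add, mul_add]
  | smul a v hv =>
    rw [Ring.lie_def] at *
    rw [map_smul, smul_mul_assoc, mul_smul_comm, ← smul_sub, hv, map_smul, smul_smul, smul_eq_mul]
    ring_nf

theorem tmul_ne_zero {V W : Type*} [AddCommGroup V] [Module ℂ V] [AddCommGroup W] [Module ℂ W]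
    {y : V} {z : W} (hy : y ≠ 0) (hz : z ≠ 0) : y ⊗ₜ[ℂ] z ≠ 0 := by
  intro h
  refine hy ((Module.forall_dual_apply_eq_zero_iff ℂ y).mp fun f => ?_)
  have := congrArg (fun t => TensorProduct.lid ℂ W (f.rTensor W t)) h
  simpa [hz] using this

theorem if_congr_then {W : Type*} {P : Prop} [Decidable P] {y z t : W} (h : P → y = z) :
    (if P then y else t) = if P then z else t := by
  split_ifs with hP
  · exact h hP
  · rfl

theorem lie_tSum_tmul (h : H) (y z : YangianLie κ b ħ) : ⁅tSum κ b ħ h, y ⊗ₜ[ℂ] z⁆ =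
    ⁅tEmb κ b ħ h, y⁆ ⊗ₜ[ℂ] z + y ⊗ₜ[ℂ] ⁅tEmb κ b ħ h, z⁆ := by
  simp only [Ring.lie_def, tSum, add_mul, mul_add, Algebra.TensorProduct.tmul_mul_tmul, one_mul,
    mul_one, TensorProduct.sub_tmul, TensorProduct.tmul_sub]
  abel

/-- This normalizes the root tensor of α_i + α_j built from brackets of simple root vectors. Its
value for a_{ji} = -1 is -d_j. -/
theorem form_lie_f_lie_e {i j : b.support} (hij : i ≠ j) (c : SimpleRootVectors κ b) :
    κ.form ⁅c.f j, c.f i⁆ ⁅c.e j, c.e i⁆ = cartanD κ b i * cartanA b i j := by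
  have h1 : ⁅c.f i, ⁅c.e j, c.e i⁆⁆ = (cartanD κ b i * cartanA b i j) • c.e j := by
    rw [leibniz_lie, ← lie_skew (c.f i) (c.e j), lie_e_f_ne c hij.symm, neg_zero, zero_lie, zero_add,
      ← lie_skew (c.f i) (c.e i), c.lie_e_f, lie_neg, lie_skew,
      lie_coe_of_mem_rootSpace (c.e_mem j), root_dhBasis c]
  rw [κ.invariant, h1, map_smul, κ.symm, form_e_f, smul_eq_mul, mul_one]

namespace AdmissibleTriple

variable [LinearOrder (PosRoot b)] {αi αj αij : PosRoot b} (h : AdmissibleTriple αi αj αij)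
include h

theorem rootTensor_eq (x : RootVectors c ħ) : ∃ i j : b.support, i ≠ j ∧ cartanA b j i = -1 ∧
    αj.root = (rootSystem H).root j.1 ∧
    rootTensor x αi = simpleX κ b ħ (-1) i 0 ⊗ₜ[ℂ] simpleX κ b ħ 1 i 0 ∧
    rootTensor x αj = simpleX κ b ħ (-1) j 0 ⊗ₜ[ℂ] simpleX κ b ħ 1 j 0 ∧
    rootTensor x αij = (-cartanD κ b j)⁻¹ •
      (⁅simpleX κ b ħ (-1) j 0, simpleX κ b ħ (-1) i 0⁆ ⊗ₜ[ℂ]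
        ⁅simpleX κ b ħ 1 j 0, simpleX κ b ħ 1 i 0⁆) := by
  obtain ⟨i, j, hij, hi, hj, hA⟩ := h.exists_cartanA
  have simple : ∀ (α : PosRoot b) (k : b.support), α.root = (rootSystem H).root k.1 →
      rootTensor x α = simpleX κ b ħ (-1) k 0 ⊗ₜ[ℂ] simpleX κ b ħ 1 k 0 := by
    intro α k hk
    have hform : κ.form (c.f k) (c.e k) = 1 := by rw [κ.symm, form_e_f]
    rw [rootTensor, x.xm_tmul_xp_eq α (by rw [hk]; exact c.f_mem k) (by rw [hk]; exact c.e_mem k)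
      (GEmb.f k) (GEmb.e k) (by rw [hform]; exact one_ne_zero), hform, inv_one, one_smul]
  have hform : κ.form ⁅c.f j, c.f i⁆ ⁅c.e j, c.e i⁆ = -cartanD κ b j := by
    rw [form_lie_f_lie_e hij, cartanD_mul_cartanA_symm c, hA]
    simp
  refine ⟨i, j, hij, hA, hj, simple αi i hi, simple αj j hj, ?_⟩
  rw [rootTensor, ← hform]
  refine x.xm_tmul_xp_eq αij ?_ ?_ ((GEmb.f j).lie (GEmb.f i)) ((GEmb.e j).lie (GEmb.e i)) ?_
  · have := lie_mem_genWeightSpace_of_mem_genWeightSpace (c.f_mem j) (c.f_mem i)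
    convert this using 2
    rw [h.root_ij, hi, hj]
    ext
    simp
  · have := lie_mem_genWeightSpace_of_mem_genWeightSpace (c.e_mem j) (c.e_mem i)
    convert this using 2
    rw [h.root_ij, hi, hj]
    ext
    simp [add_comm]
  · rw [hform]
    exact neg_ne_zero.mpr (cartanD_ne_zero c j)

/-- Restriction to the grid of weights pα_i + qα_j. The coweight dual to α_i reads off p and kills
the α_j-term of the recursion, and symmetrically for w. -/
theorem lie_eq_of_factorization {W : Type*} [Ring W] [Algebra ℂ W] (hħ : ħ ≠ 0)
    (G : Module.Dual ℂ H → PowerSeries W) (T : H → W) (X : PosRoot b → W)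
    [∀ γ : Module.Dual ℂ H, DecidablePred fun δ : PosRoot b => γ - δ.root ∈ Qplus b]
    (hrec : ∀ γ ∈ Qplus b, ∀ (u : H) (n : ℕ), γ u • PowerSeries.coeff (n + 1) (G γ) =
      ⁅T u, PowerSeries.coeff n (G γ)⁆ + ħ • ∑ δ : PosRoot b with γ - δ.root ∈ Qplus b,
        δ.root u • (PowerSeries.coeff n (G (γ - δ.root)) * X δ))
    (h0 : ∀ γ ∈ Qplus b, ∀ u : H, γ u ≠ 0 → PowerSeries.coeff 0 (G γ) = 0) (hone : G 0 = 1)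
    (hprod : G (1 • αi.root + 2 • αj.root) =
      G (1 • αi.root + 0 • αj.root) * G (0 • αi.root + 2 • αj.root) +
        (G (1 • αi.root + 1 • αj.root) -
          G (1 • αi.root + 0 • αj.root) * G (0 • αi.root + 1 • αj.root)) *
          G (0 • αi.root + 1 • αj.root))
    (hcomm : X αj * X αij = X αij * X αj) {w : H} (hiw : αi.root w = 0) (hjw : αj.root w = 1) :
    (ħ / 2) • ⁅X αj, ⁅X αj, X αi⁆⁆ = ⁅X αij, ⁅T w, X αj⁆⁆ := by
  obtain ⟨v, -, hiv, hjv, -⟩ := h.coweights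
  have hmem : ∀ p q : ℕ, p • αi.root + q • αj.root ∈ Qplus b := fun p q =>
    add_mem (nsmul_mem αi.root_mem_Qplus _) (nsmul_mem αj.root_mem_Qplus _)
  have e1 : ∀ p q : ℕ, 1 ≤ p →
      p • αi.root + q • αj.root - αi.root = (p - 1) • αi.root + q • αj.root := by
    intro p q hp
    obtain ⟨p, rfl⟩ := Nat.exists_eq_add_of_le' hp
    rw [Nat.add_sub_cancel]
    module
  have e2 : ∀ p q : ℕ, 1 ≤ q →
      p • αi.root + q • αj.root - αj.root = p • αi.root + (q - 1) • αj.root := by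
    intro p q hq
    obtain ⟨q, rfl⟩ := Nat.exists_eq_add_of_le' hq
    rw [Nat.add_sub_cancel]
    module
  have e3 : ∀ p q : ℕ, 1 ≤ p ∧ 1 ≤ q → p • αi.root + q • αj.root - αij.root =
      (p - 1) • αi.root + (q - 1) • αj.root := by
    rintro p q ⟨hp, hq⟩
    obtain ⟨p, rfl⟩ := Nat.exists_eq_add_of_le' hp
    obtain ⟨q, rfl⟩ := Nat.exists_eq_add_of_le' hq
    rw [Nat.add_sub_cancel, Nat.add_sub_cancel, h.root_ij]
    module
  have ev : ∀ p q : ℕ, (p • αi.root + q • αj.root) v = p := fun p q => by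
    rw [LinearMap.add_apply, LinearMap.smul_apply, LinearMap.smul_apply, hiv, hjv, smul_zero,
      add_zero, nsmul_one]
  have ew : ∀ p q : ℕ, (p • αi.root + q • αj.root) w = q := fun p q => by
    rw [LinearMap.add_apply, LinearMap.smul_apply, LinearMap.smul_apply, hiw, hjw, smul_zero,
      zero_add, nsmul_one]
  have hv : αij.root v = 1 := by rw [h.root_ij, LinearMap.add_apply, hiv, hjv, add_zero]
  have hw : αij.root w = 1 := by rw [h.root_ij, LinearMap.add_apply, hiw, hjw, zero_add]
  refine _root_.lie_eq_of_factorization hħ (fun p q => G (p • αi.root + q • αj.root)) (T v) (T w)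
    (X αi) (X αj) (X αij) ?_ ?_ ?_ ?_ hprod hcomm
  · simp only [zero_smul, add_zero, hone]
  · intro p hp q hq n
    have := hrec _ (hmem p q) v n
    rw [h.sum_filter_eq hp hq _ rfl, ev, hv, hiv, hjv, zero_smul, ite_self, zero_add, one_smul,
      one_smul] at this
    rw [this]
    congr 2
    exact congrArg₂ (· + ·) (if_congr_then fun hp => by rw [e1 p q hp])
      (if_congr_then fun hpq => by rw [e3 p q hpq])
  · intro p hp q hq n
    have := hrec _ (hmem p q) w n
    rw [h.sum_filter_eq hp hq _ rfl, ew, hw, hiw, hjw, zero_smul, ite_self, zero_add, one_smul,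
      one_smul] at this
    rw [this]
    congr 2
    exact congrArg₂ (· + ·) (if_congr_then fun hq => by rw [e2 p q hq])
      (if_congr_then fun hpq => by rw [e3 p q hpq])
  · intro p hp q hq hpq
    rcases Nat.eq_zero_or_pos p with rfl | hp'
    · exact h0 _ (hmem 0 q) w (by rw [ew]; exact Nat.cast_ne_zero.mpr (by omega))
    · exact h0 _ (hmem p q) v (by rw [ev]; exact Nat.cast_ne_zero.mpr (by omega))

theorem blockProduct_factorization {F : PosRoot b → ℕ → YYSeries κ b ħ} (hF : ∀ δ, F δ 0 = 1) :
    blockProduct F (1 • αi.root + 2 • αj.root) =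
      blockProduct F (1 • αi.root + 0 • αj.root) * blockProduct F (0 • αi.root + 2 • αj.root) +
        (blockProduct F (1 • αi.root + 1 • αj.root) -
          blockProduct F (1 • αi.root + 0 • αj.root) * blockProduct F (0 • αi.root + 1 • αj.root)) *
          blockProduct F (0 • αi.root + 1 • αj.root) := by
  rw [h.blockProduct_eq hF le_rfl le_rfl, h.blockProduct_eq hF le_rfl zero_le_two,
    h.blockProduct_eq hF zero_le_one le_rfl, h.blockProduct_eq hF le_rfl one_le_two,
    h.blockProduct_eq hF zero_le_one one_le_two]
  simp [sum_range_succ, hF]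

theorem blockProduct_zero {F : PosRoot b → ℕ → YYSeries κ b ħ} (hF : ∀ δ, F δ 0 = 1) :
    blockProduct F 0 = 1 := by
  have := h.blockProduct_eq hF zero_le_one zero_le_two
  rw [zero_smul, zero_smul, add_zero] at this
  rw [this]
  simp [hF]

/-- The order enters through the factorization in weight α_i + 2α_j. The resulting identity makes a
tensor vanish whose two factors are nonzero by `mul_lie_simple_ne_zero`. -/
theorem not_satisfiesBlockIE (hħ : ħ ≠ 0) {F : PosRoot b → ℕ → YYSeries κ b ħ}
    (hF : IsBlockFamily F) : ¬SatisfiesBlockIE x (blockProduct F) := by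
  classical
  intro hIE
  obtain ⟨-, w, -, -, hiw, hjw, -⟩ := h.coweights
  obtain ⟨i, j, hij, hA, hj, hXi, hXj, hXij⟩ := h.rootTensor_eq x
  have hserre := fun ε =>
    Yangian.lie_x_zero_lie_x_zero (d := cartanD κ b) (ħ := ħ) ε hij.symm hA
  have hserre1 := fun ε =>
    Yangian.lie_x_one_lie_x_zero (d := cartanD κ b) (ħ := ħ) ε hij.symm (cartanA_self b j) hA
  have hcomm := fun ε => sub_eq_zero.mp ((Ring.lie_def _ _).symm.trans (hserre ε))
  have hw := coeff_blockProduct_mem_lWeight hF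
  have hkey := h.lie_eq_of_factorization hħ (blockProduct F) (tSum κ b ħ) (rootTensor x)
    (fun γ hγ u n => hIE.smul_coeff_succ hw hγ u n) (fun γ hγ u hu => hIE.coeff_zero hw hγ hu)
    (h.blockProduct_zero hF.zero) (h.blockProduct_factorization hF.zero)
    (by rw [hXj, hXij, mul_smul_comm, smul_mul_assoc, Algebra.TensorProduct.tmul_mul_tmul,
      Algebra.TensorProduct.tmul_mul_tmul, hcomm, hcomm]) hiw hjw
  rw [hXi, hXj, hXij, lie_tSum_tmul, lie_tEmb_x c, lie_tEmb_x c, ← hj, hjw] at hkey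
  have hA' : cartanA b i j ≠ 0 := by
    intro h0
    have := cartanD_mul_cartanA_symm c i j
    rw [h0, hA] at this
    simp [cartanD_ne_zero c j] at this
  refine tmul_ne_zero (mul_lie_simple_ne_zero c hħ (-1) hij hA')
    (mul_lie_simple_ne_zero c hħ 1 hij hA') (tmul_eq_zero_of_lie_eq (cartanD_ne_zero c j)
    (hserre (-1)) (hserre 1) (b₁ := simpleX κ b ħ (-1) j 1) (b₁' := simpleX κ b ħ 1 j 1)
    ?_ ?_ ?_ hħ)
  · rw [hserre1]
    congr 1
    simp
  · rw [hserre1]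
    congr 1
    simp
  · rw [hkey]
    congr 1
    rw [mul_one, mul_one, Units.val_neg, Units.val_one, Int.cast_neg, Int.cast_one, neg_smul,
      one_smul, one_smul, TensorProduct.neg_tmul, neg_add_eq_sub]

end AdmissibleTriple

end NoBlockSolution

/-! ### Expansion of an ordered product of infinite sums into block products. -/

noncomputable section OrderedProductExpansion

set_option linter.unusedSectionVars false

open LieAlgebra LieAlgebra.IsKilling Finset
open scoped TensorProduct

variable {L : Type*} [LieRing L] [LieAlgebra ℂ L] [FiniteDimensional ℂ L]
  [LieAlgebra.IsSemisimple ℂ L] {H : LieSubalgebra ℂ L} [H.IsCartanSubalgebra]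
  {b : (rootSystem H).Base} [LinearOrder (PosRoot b)]

theorem orderedProd_sum {M : Type*} [Ring M] (s : Finset ℕ) (F : PosRoot b → ℕ → M) :
    orderedProd (fun α => ∑ k ∈ s, F α k) =
      ∑ k ∈ Fintype.piFinset fun _ : PosRoot b => s, orderedProd fun α => F α (k α) := by
  set l := (univ : Finset (PosRoot b)).sort (· ≤ ·) with hl
  let e : Fin l.length ≃ PosRoot b := List.Nodup.getEquivOfForallMemList l (Finset.sort_nodup _ _)
    fun α => (Finset.mem_sort _).mpr (mem_univ α)
  let f := (MultilinearMap.mkPiAlgebraFin ℤ l.length M).domDomCongr e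
  have hf : ∀ A : PosRoot b → M, orderedProd A = f A := by
    intro A
    change _ = (MultilinearMap.mkPiAlgebraFin ℤ l.length M) fun i => A (l.get i)
    rw [MultilinearMap.mkPiAlgebraFin_apply, orderedProd]
    congr 1
    have := congrArg (List.map A) (List.ofFn_get l)
    rw [List.map_ofFn] at this
    exact this.symm
  rw [hf, MultilinearMap.map_sum_finset]
  simp only [hf]

theorem coeff_orderedProd_congr {M : Type*} [Ring M] {N : ℕ} {A B : PosRoot b → PowerSeries M}
    (h : ∀ α, ∀ n ≤ N, PowerSeries.coeff n (A α) = PowerSeries.coeff n (B α)) {n : ℕ}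
    (hn : n ≤ N) : PowerSeries.coeff n (orderedProd A) = PowerSeries.coeff n (orderedProd B) := by
  have key : ∀ l : List (PosRoot b), ∀ n ≤ N, PowerSeries.coeff n (l.map A).prod =
      PowerSeries.coeff n (l.map B).prod := by
    intro l
    induction l with
    | nil => exact fun _ _ => rfl
    | cons α l ih =>
      intro n hn
      rw [List.map_cons, List.map_cons, List.prod_cons, List.prod_cons, PowerSeries.coeff_mul,
        PowerSeries.coeff_mul]
      refine sum_congr rfl fun p hp => ?_
      have := mem_antidiagonal.mp hp
      rw [h α p.1 (by omega), ih p.2 (by omega)]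
  exact key _ n hn

theorem coeff_orderedProd_eq_zero {M : Type*} [Ring M] {N : ℕ} {A : PosRoot b → PowerSeries M}
    (α : PosRoot b) (h : ∀ n ≤ N, PowerSeries.coeff n (A α) = 0) {n : ℕ} (hn : n ≤ N) :
    PowerSeries.coeff n (orderedProd A) = 0 := by
  have key : ∀ l : List (PosRoot b), α ∈ l → ∀ n ≤ N, PowerSeries.coeff n (l.map A).prod = 0 := by
    intro l
    induction l with
    | nil => exact fun hα => absurd hα List.not_mem_nil
    | cons β l ih =>
      intro hα n hn
      rw [List.map_cons, List.prod_cons, PowerSeries.coeff_mul]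
      refine sum_eq_zero fun p hp => ?_
      have := mem_antidiagonal.mp hp
      rcases List.mem_cons.mp hα with rfl | hα
      · rw [h p.1 (by omega), zero_mul]
      · rw [ih hα p.2 (by omega), mul_zero]
  exact key _ ((Finset.mem_sort _).mpr (mem_univ α)) n hn

/-- Modulo a power of the variable, an ordered product of infinite sums is a finite sum of
ordered products. -/
theorem exists_coeff_orderedProd_eq_sum {M : Type*} [Ring M] {F : PosRoot b → ℕ → PowerSeries M}
    {J : PosRoot b → PowerSeries M} (hfin : ∀ α n, {k | PowerSeries.coeff n (F α k) ≠ 0}.Finite)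
    (hJ : ∀ α n, PowerSeries.coeff n (J α) = ∑ᶠ k, PowerSeries.coeff n (F α k)) (n : ℕ) :
    ∃ S : Finset (PosRoot b → ℕ),
      PowerSeries.coeff n (orderedProd J) =
        ∑ k ∈ S, PowerSeries.coeff n (orderedProd fun α => F α (k α)) ∧
      ∀ k ∉ S, PowerSeries.coeff n (orderedProd fun α => F α (k α)) = 0 := by
  classical
  have hs : (⋃ α : PosRoot b, ⋃ m ∈ Set.Iic n, {k | PowerSeries.coeff m (F α k) ≠ 0}).Finite :=
    Set.finite_iUnion fun α => (Set.finite_Iic n).biUnion fun m _ => hfin α m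
  set s := hs.toFinset with hsd
  have hzero : ∀ α, ∀ m ≤ n, ∀ k ∉ s, PowerSeries.coeff m (F α k) = 0 := by
    intro α m hm k hk
    by_contra hne
    refine hk (hs.mem_toFinset.mpr ?_)
    simp only [Set.mem_iUnion]
    exact ⟨α, m, hm, hne⟩
  refine ⟨Fintype.piFinset fun _ => s, ?_, ?_⟩
  · rw [← map_sum, ← orderedProd_sum]
    refine coeff_orderedProd_congr (N := n) (fun α m hm => ?_) le_rfl
    rw [hJ, map_sum, finsum_eq_sum_of_support_subset]
    intro k hk
    by_contra hks
    exact hk (hzero α m hm k hks)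
  · intro k hk
    rw [Fintype.mem_piFinset] at hk
    push Not at hk
    obtain ⟨α, hα⟩ := hk
    exact coeff_orderedProd_eq_zero (N := n) α (fun m hm => hzero α m hm _ hα) le_rfl

variable {κ : InvForm L} {ħ : ℂ}

theorem blockProduct_eq_zero_of_notMem (F : PosRoot b → ℕ → YYSeries κ b ħ) {γ : Module.Dual ℂ H}
    (hγ : γ ∉ Qplus b) : blockProduct F γ = 0 := by
  refine sum_eq_zero fun k hk => absurd ?_ hγ
  rw [partitions, Set.Finite.mem_toFinset, Set.mem_ofPred_eq] at hk
  rw [hk]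
  exact sum_mem fun α _ => nsmul_mem α.root_mem_Qplus _

/-- For a fixed power of the variable only finitely many exponent vectors matter. They are grouped
by their weight. -/
theorem coeff_orderedProd_eq_finsum {F : PosRoot b → ℕ → YYSeries κ b ħ}
    {J : PosRoot b → YYSeries κ b ħ} (hfin : ∀ α n, {k | PowerSeries.coeff n (F α k) ≠ 0}.Finite)
    (hJ : ∀ α n, PowerSeries.coeff n (J α) = ∑ᶠ k, PowerSeries.coeff n (F α k)) (n : ℕ) :
    (Function.support fun γ => PowerSeries.coeff n (blockProduct F γ)).Finite ∧
    PowerSeries.coeff n (orderedProd J) = ∑ᶠ γ, PowerSeries.coeff n (blockProduct F γ) := by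
  classical
  obtain ⟨S, hS, hS0⟩ := exists_coeff_orderedProd_eq_sum hfin hJ n
  have hG : ∀ γ, PowerSeries.coeff n (blockProduct F γ) =
      ∑ k ∈ S with ∑ α, k α • α.root = γ, PowerSeries.coeff n (orderedProd fun α => F α (k α)) := by
    intro γ
    rw [blockProduct, map_sum]
    symm
    refine sum_subset_zero_on_sdiff ?_ ?_ (fun _ _ => rfl)
    · intro k hk
      rw [partitions, Set.Finite.mem_toFinset, Set.mem_ofPred_eq]
      exact (mem_filter.mp hk).2.symm
    · intro k hk
      rw [mem_sdiff, partitions, Set.Finite.mem_toFinset, Set.mem_ofPred_eq] at hk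
      exact hS0 k fun hkS => hk.2 (mem_filter.mpr ⟨hkS, hk.1.symm⟩)
  have hsub : (Function.support fun γ => PowerSeries.coeff n (blockProduct F γ)) ⊆
      ((S.image fun k => ∑ α, k α • α.root : Finset (Module.Dual ℂ H)) : Set (Module.Dual ℂ H)) := by
    intro γ hγ
    by_contra hne
    refine hγ ((hG γ).trans (sum_eq_zero fun k hk => absurd ?_ hne))
    rw [mem_filter] at hk
    exact mem_coe.mpr (mem_image.mpr ⟨k, hk⟩)
  refine ⟨(finite_toSet _).subset hsub, ?_⟩
  rw [finsum_eq_sum_of_support_subset _ hsub, hS,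
    ← sum_fiberwise_of_maps_to (fun k hk => mem_image_of_mem (fun k => ∑ α, k α • α.root) hk)]
  exact sum_congr rfl fun γ _ => (hG γ).symm

end OrderedProductExpansion

/-! ### Splitting the intertwining equation into weight components. -/

noncomputable section WeightComponents

set_option linter.unusedSectionVars false

open LieAlgebra LieAlgebra.IsKilling Finset
open scoped TensorProduct

theorem Submodule.smul_sum_smul_mem {V ι : Type*} [AddCommGroup V] [Module ℂ V] [Fintype ι]
    (p : Submodule ℂ V) (t : ℂ) (a : ι → ℂ) {f : ι → V} (hf : ∀ β, f β ∈ p) :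
    t • ∑ β, a β • f β ∈ p :=
  p.smul_mem _ (p.sum_mem fun β _ => p.smul_mem _ (hf β))

section Finsum

variable {W Γ ι : Type*} [Ring W] [Algebra ℂ W] [AddCommGroup Γ] [Fintype ι]

theorem support_lie_finite (y : W) {g : Γ → W} (hg : (Function.support g).Finite) :
    (Function.support fun γ => ⁅y, g γ⁆).Finite := by
  refine hg.subset fun γ hγ h0 => hγ ?_
  simp only [h0, Ring.lie_def, mul_zero, zero_mul, sub_zero]

theorem lie_finsum (y : W) {g : Γ → W} (hg : (Function.support g).Finite) :
    ⁅y, ∑ᶠ γ, g γ⁆ = ∑ᶠ γ, ⁅y, g γ⁆ :=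
  (AddMonoidHom.mk' (fun z => ⁅y, z⁆) (Ring.lie_add_right y)).map_finsum hg

theorem support_shift_mul_finite {g : Γ → W} (hg : (Function.support g).Finite) (δ : Γ) (X : W) :
    (Function.support fun γ => g (γ - δ) * X).Finite := by
  refine (hg.image fun γ => γ + δ).subset fun γ hγ => ?_
  refine ⟨γ - δ, fun h0 => hγ ?_, sub_add_cancel _ _⟩
  simp only [h0, zero_mul]

theorem support_sum_shift_mul_finite {g : Γ → W} (hg : (Function.support g).Finite) (ρ : ι → Γ)
    (a : ι → ℂ) (X : ι → W) :
    (Function.support fun γ => ∑ β, a β • (g (γ - ρ β) * X β)).Finite := by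
  refine (Set.finite_iUnion fun β => support_shift_mul_finite hg (ρ β) (X β)).subset
    fun γ hγ => ?_
  by_contra hne
  rw [Set.mem_iUnion, not_exists] at hne
  refine hγ (sum_eq_zero fun β _ => ?_)
  rw [Function.notMem_support.mp (hne β), smul_zero]

/-- Multiplication by X_β shifts the weight by ρ_β; reindexing each sum collects the terms of the
product in weight γ. -/
theorem finsum_mul_sum_smul {g : Γ → W} (hg : (Function.support g).Finite) (ρ : ι → Γ)
    (a : ι → ℂ) (X : ι → W) :
    (∑ᶠ γ, g γ) * ∑ β, a β • X β = ∑ᶠ γ, ∑ β, a β • (g (γ - ρ β) * X β) := by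
  rw [mul_sum, finsum_sum_comm]
  · refine sum_congr rfl fun β _ => ?_
    rw [mul_smul_comm, ← smul_finsum' _ (support_shift_mul_finite hg (ρ β) (X β)),
      finsum_mul' _ _ hg]
    congr 1
    exact (finsum_comp_equiv (Equiv.subRight (ρ β)) (f := fun γ => g γ * X β)).symm
  · refine fun β _ => (support_shift_mul_finite hg (ρ β) (X β)).subset fun γ hγ h0 => hγ ?_
    simp only at h0
    simp only [h0, smul_zero]

theorem finsum_lie_add_lie_eq_zero {g g' : Γ → W} (hg : (Function.support g).Finite)
    (hg' : (Function.support g').Finite) (ρ : ι → Γ) (a : ι → ℂ) (X : ι → W) (ħ : ℂ) (t d : W)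
    (h : ⁅t, ∑ᶠ γ, g γ⁆ + ⁅d, ∑ᶠ γ, g' γ⁆ = (∑ᶠ γ, g γ) * -(ħ • ∑ β, a β • X β)) :
    (Function.support fun γ =>
      ⁅t, g γ⁆ + ⁅d, g' γ⁆ + ħ • ∑ β, a β • (g (γ - ρ β) * X β)).Finite ∧
    ∑ᶠ γ, (⁅t, g γ⁆ + ⁅d, g' γ⁆ + ħ • ∑ β, a β • (g (γ - ρ β) * X β)) = 0 := by
  have h1 := support_lie_finite t hg
  have h2 := support_lie_finite d hg'
  have h12 := (h1.union h2).subset (Function.support_add _ _)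
  have h3 := support_sum_shift_mul_finite hg ρ a X
  have h4 : (Function.support fun γ => ħ • ∑ β, a β • (g (γ - ρ β) * X β)).Finite := by
    refine h3.subset fun γ hγ h0 => hγ ?_
    simp only at h0
    simp only [h0, smul_zero]
  refine ⟨(h12.union h4).subset (Function.support_add _ _), ?_⟩
  rw [finsum_add_distrib h12 h4, finsum_add_distrib h1 h2, ← lie_finsum t hg, ← lie_finsum d hg', h,
    ← smul_finsum' _ h3, ← finsum_mul_sum_smul hg, mul_neg, mul_smul_comm, neg_add_cancel]

end Finsum

variable {L : Type*} [LieRing L] [LieAlgebra ℂ L] [FiniteDimensional ℂ L]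
  [LieAlgebra.IsSemisimple ℂ L] {H : LieSubalgebra ℂ L} [H.IsCartanSubalgebra]
  {κ : InvForm L} {b : (rootSystem H).Base} {ħ : ℂ} {c : SimpleRootVectors κ b}
  {x : RootVectors c ħ}

theorem eq_zero_of_sum_lWeight_eq_zero
    {E : Module.Dual ℂ H → YangianLie κ b ħ ⊗[ℂ] YangianLie κ b ħ}
    (hE : ∀ γ, E γ ∈ lWeight κ b ħ (-γ)) (T : Finset (Module.Dual ℂ H)) (hT : ∑ γ ∈ T, E γ = 0) :
    ∀ γ ∈ T, E γ = 0 := by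
  classical
  induction T using Finset.induction_on generalizing E with
  | empty => exact fun γ hγ => absurd hγ (notMem_empty γ)
  | insert δ T hδ ih =>
    rw [sum_insert hδ] at hT
    have key : ∀ γ ∈ T, E γ = 0 := by
      intro γ hγ
      -- Adding δ(u) times the sum to its bracket with u ⊗ 1 removes the component δ and multiplies
      -- the component γ by δ(u) - γ(u), which is nonzero for this u.
      obtain ⟨u, hu⟩ : ∃ u : H, δ u - γ u ≠ 0 := by
        by_contra! hcon
        refine hδ ?_
        rwa [show δ = γ from LinearMap.ext fun u => sub_eq_zero.mp (hcon u)]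
      have h1 : ⁅hLeft κ b ħ u, E δ + ∑ γ ∈ T, E γ⁆ = 0 := by
        rw [hT, Ring.lie_def, mul_zero, zero_mul, sub_zero]
      have h2 : ⁅hLeft κ b ħ u, ∑ γ ∈ T, E γ⁆ = ∑ γ ∈ T, (-γ) u • E γ := by
        rw [Ring.lie_def, mul_sum, sum_mul, ← sum_sub_distrib]
        exact sum_congr rfl fun γ _ => hE γ u
      have h3 : ∑ γ ∈ T, (δ u - γ u) • E γ = 0 := by
        rw [Ring.lie_add_right, hE δ u, h2] at h1
        have h4 : δ u • (E δ + ∑ γ ∈ T, E γ) = 0 := by rw [hT, smul_zero]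
        simp only [LinearMap.neg_apply, neg_smul, sum_neg_distrib] at h1
        rw [smul_add, smul_sum] at h4
        simp only [sub_smul, sum_sub_distrib]
        linear_combination (norm := module) h1 + h4
      exact (smul_eq_zero.mp (ih (E := fun γ => (δ u - γ u) • E γ)
        (fun γ => Submodule.smul_mem _ _ (hE γ)) h3 γ hγ)).resolve_left hu
    intro γ hγ
    rcases mem_insert.mp hγ with rfl | hγ
    · rwa [sum_eq_zero key, add_zero] at hT
    · exact key γ hγ

theorem eq_zero_of_finsum_lWeight_eq_zero
    {E : Module.Dual ℂ H → YangianLie κ b ħ ⊗[ℂ] YangianLie κ b ħ}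
    (hE : ∀ γ, E γ ∈ lWeight κ b ħ (-γ)) (hfin : (Function.support E).Finite)
    (h0 : ∑ᶠ γ, E γ = 0) (γ : Module.Dual ℂ H) : E γ = 0 := by
  by_contra hne
  rw [finsum_eq_sum _ hfin] at h0
  exact hne (eq_zero_of_sum_lWeight_eq_zero hE _ h0 γ (hfin.mem_toFinset.mpr hne))

theorem lie_hEmb_tEmb (v w : H) : ⁅hEmb κ b ħ v, tEmb κ b ħ w⁆ = 0 := by
  have hcomm : ∀ i j r, Commute (Yangian.xi (cartanA b) (cartanD κ b) ħ i 0)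
      (Yangian.xi (cartanA b) (cartanD κ b) ħ j r) := fun i j r =>
    sub_eq_zero.mp ((Ring.lie_def _ _).symm.trans (Yangian.lie_xi_xi i j 0 r))
  have : Commute (hEmb κ b ħ v) (tEmb κ b ħ w) := by
    induction v using dhBasis_induction (κ := κ) (b := b) with
    | coe i =>
      induction w using dhBasis_induction (κ := κ) (b := b) with
      | coe j =>
        rw [hEmb_dhBasis, tEmb_dhBasis, Yangian.t1]
        exact (hcomm i j 1).sub_right (((hcomm i j 0).pow_right 2).smul_right _)
      | zero => rw [map_zero]; exact Commute.zero_right _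
      | add v w hv hw => rw [map_add]; exact hv.add_right hw
      | smul a v hv => rw [map_smul]; exact hv.smul_right a
    | zero => rw [map_zero]; exact Commute.zero_left _
    | add v w hv hw => rw [map_add]; exact hv.add_left hw
    | smul a v hv => rw [map_smul]; exact hv.smul_left a
  rw [Ring.lie_def]
  exact sub_eq_zero.mpr this

theorem tSum_mem_lWeight (u : H) : tSum κ b ħ u ∈ lWeight κ b ħ 0 := by
  refine add_mem (tmul_mem_lWeight (fun h => ?_) _) (tmul_mem_lWeight (fun h => ?_) _)
  · rw [lie_hEmb_tEmb, LinearMap.zero_apply, zero_smul]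
  · rw [Ring.lie_def, mul_one, one_mul, sub_self, LinearMap.zero_apply, zero_smul]

theorem lie_tSum_mem_lWeight (u : H) {χ : Module.Dual ℂ H}
    {y : YangianLie κ b ħ ⊗[ℂ] YangianLie κ b ħ} (hy : y ∈ lWeight κ b ħ χ) :
    ⁅tSum κ b ħ u, y⁆ ∈ lWeight κ b ħ χ := by
  rw [Ring.lie_def]
  refine sub_mem ?_ ?_
  · simpa using mul_mem_lWeight (tSum_mem_lWeight u) hy
  · simpa using mul_mem_lWeight hy (tSum_mem_lWeight u)

theorem rootTensor_mem_lWeight (x : RootVectors c ħ) (β : PosRoot b) :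
    rootTensor x β ∈ lWeight κ b ħ (-β.root) :=
  tmul_mem_lWeight (x.xm_mem_yWeight β) _

theorem rMinusH_eq (x : RootVectors c ħ) (u : H) :
    rMinusH x u = -(ħ • ∑ β : PosRoot b, β.root u • rootTensor x β) := by
  have h1 : ⁅hLeft κ b ħ u, ∑ β : PosRoot b, rootTensor x β⁆ =
      ∑ β : PosRoot b, (-β.root) u • rootTensor x β := by
    rw [Ring.lie_def, mul_sum, sum_mul, ← sum_sub_distrib]
    exact sum_congr rfl fun β _ => rootTensor_mem_lWeight x β u
  change ⁅hLeft κ b ħ u, ħ • ∑ β : PosRoot b, rootTensor x β⁆ = _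
  rw [Ring.lie_smul_right, h1]
  simp only [LinearMap.neg_apply, neg_smul, sum_neg_distrib, smul_neg]

/-- The restriction γ - β ∈ Q₊ in the componentwise equation may be dropped for families that vanish
outside Q₊. -/
theorem sum_filter_Qplus_eq {W : Type*} [Ring W] [Algebra ℂ W] (g : Module.Dual ℂ H → W)
    (hg : ∀ γ ∉ Qplus b, g γ = 0) (γ : Module.Dual ℂ H)
    [DecidablePred fun β : PosRoot b => γ - β.root ∈ Qplus b] (a : PosRoot b → ℂ)
    (X : PosRoot b → W) :
    ∑ β : PosRoot b with γ - β.root ∈ Qplus b, a β • (g (γ - β.root) * X β) =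
      ∑ β : PosRoot b, a β • (g (γ - β.root) * X β) := by
  refine sum_subset (filter_subset _ _) fun β _ hβ => ?_
  rw [hg _ fun hmem => hβ (mem_filter.mpr ⟨mem_univ β, hmem⟩), zero_mul, smul_zero]

section Components

variable {R : YYSeries κ b ħ} {G : Module.Dual ℂ H → YYSeries κ b ħ}
  (hw : ∀ γ n, PowerSeries.coeff n (G γ) ∈ lWeight κ b ħ (-γ))

include hw in
theorem defect_mem_lWeight (x : RootVectors c ħ) (u : H) (n : ℕ) (γ : Module.Dual ℂ H) :
    ⁅tSum κ b ħ u, PowerSeries.coeff n (G γ)⁆ +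
        ⁅hLeft κ b ħ u, PowerSeries.coeff (n + 1) (G γ)⁆ + ħ • ∑ β : PosRoot b,
          β.root u • (PowerSeries.coeff n (G (γ - β.root)) * rootTensor x β) ∈
      lWeight κ b ħ (-γ) := by
  refine Submodule.add_mem _ (Submodule.add_mem _ (lie_tSum_mem_lWeight u (hw γ n)) ?_) ?_
  · rw [hw γ (n + 1) u]
    exact Submodule.smul_mem _ _ (hw γ (n + 1))
  · refine (lWeight κ b ħ (-γ)).smul_sum_smul_mem ħ _ fun β => ?_
    have := mul_mem_lWeight (hw (γ - β.root) n) (rootTensor_mem_lWeight x β)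
    rwa [neg_sub, sub_eq_add_neg, add_neg_cancel_comm] at this

variable (hfin : ∀ n, (Function.support fun γ => PowerSeries.coeff n (G γ)).Finite)
  (hsum : ∀ n, PowerSeries.coeff n R = ∑ᶠ γ, PowerSeries.coeff n (G γ))
include hw hfin hsum

theorem SatisfiesIE.lie_hLeft_coeff_zero (hR : SatisfiesIE x R) (u : H) (γ : Module.Dual ℂ H) :
    ⁅hLeft κ b ħ u, PowerSeries.coeff 0 (G γ)⁆ = 0 := by
  refine eq_zero_of_finsum_lWeight_eq_zero
    (E := fun γ => ⁅hLeft κ b ħ u, PowerSeries.coeff 0 (G γ)⁆) (fun γ => ?_)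
    (support_lie_finite _ (hfin 0)) ?_ γ
  · rw [hw γ 0 u]
    exact Submodule.smul_mem _ _ (hw γ 0)
  · rw [← lie_finsum _ (hfin 0), ← hsum, (((satisfiesIE_iff x R).mp hR) u).1]

/-- The defect of the componentwise equation in weight γ lies in the weight space -γ, and all
defects sum to the defect of the full equation, which is zero. Independence of weight spaces gives
the claim. -/
theorem SatisfiesIE.defect_eq_zero (hR : SatisfiesIE x R) (u : H) (n : ℕ) (γ : Module.Dual ℂ H) :
    ⁅tSum κ b ħ u, PowerSeries.coeff n (G γ)⁆ +
        ⁅hLeft κ b ħ u, PowerSeries.coeff (n + 1) (G γ)⁆ + ħ • ∑ β : PosRoot b,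
          β.root u • (PowerSeries.coeff n (G (γ - β.root)) * rootTensor x β) = 0 := by
  have h := (((satisfiesIE_iff x R).mp hR) u).2 n
  rw [rMinusH_eq, hsum, hsum] at h
  obtain ⟨h1, h2⟩ := finsum_lie_add_lie_eq_zero (hfin n) (hfin (n + 1)) PosRoot.root
    (fun β => β.root u) (rootTensor x) ħ (tSum κ b ħ u) (hLeft κ b ħ u) h
  exact eq_zero_of_finsum_lWeight_eq_zero (defect_mem_lWeight hw x u n) h1 h2 γ

/-- A solution of the intertwining equation satisfies it componentwise. -/
theorem SatisfiesIE.satisfiesBlockIE (hR : SatisfiesIE x R) (hG : ∀ γ ∉ Qplus b, G γ = 0) :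
    SatisfiesBlockIE x G := by
  classical
  rw [satisfiesBlockIE_iff]
  intro u γ _
  refine ⟨hR.lie_hLeft_coeff_zero hw hfin hsum u γ, fun n => ?_⟩
  rw [sum_filter_Qplus_eq (fun γ => PowerSeries.coeff n (G γ))
    (fun γ hγ => by rw [hG γ hγ, map_zero])]
  exact eq_neg_of_add_eq_zero_left (hR.defect_eq_zero hw hfin hsum u n γ)

end Components

end WeightComponents

/-! ### From a factorization of R⁻ to a family of blocks. -/

noncomputable section Factorization

set_option linter.unusedSectionVars false

open LieAlgebra LieAlgebra.IsKilling Finset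
open scoped TensorProduct

variable {L : Type*} [LieRing L] [LieAlgebra ℂ L] [FiniteDimensional ℂ L]
  [LieAlgebra.IsSemisimple ℂ L] {H : LieSubalgebra ℂ L} [H.IsCartanSubalgebra]
  {κ : InvForm L} {b : (rootSystem H).Base} {ħ : ℂ} {c : SimpleRootVectors κ b}
  {x : RootVectors c ħ}

/-- Evaluation at a fundamental coweight on which α is positive shows that the integer multiple is
nonnegative. -/
theorem PosRoot.exists_eq_nsmul (α : PosRoot b) {γ : Module.Dual ℂ H} (hγ : γ ∈ Qplus b)
    (h : γ ∈ AddSubgroup.zmultiples α.root) : ∃ n : ℕ, n • α.root = γ := by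
  obtain ⟨z, hz⟩ := AddSubgroup.mem_zmultiples_iff.mp h
  obtain ⟨k, hk⟩ : ∃ k : b.support, α.root (fundCoweight b k) ≠ 0 := by
    by_contra! hcon
    exact α.root_ne_zero (eq_of_apply_fundCoweight (b := b) fun k => by rw [hcon k]; rfl)
  obtain ⟨m, hm⟩ := exists_nat_of_mem_Qplus α.root_mem_Qplus k
  obtain ⟨n, hn⟩ := exists_nat_of_mem_Qplus hγ k
  rw [← hz, LinearMap.smul_apply, hm, zsmul_eq_mul] at hn
  have hzm : z * m = n := by exact_mod_cast hn
  have hm0 : 0 < (m : ℤ) := by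
    refine Nat.cast_pos.mpr (Nat.pos_of_ne_zero fun h0 => hk ?_)
    rw [hm, h0, Nat.cast_zero]
  have hz0 : 0 ≤ z := nonneg_of_mul_nonneg_left (hzm ▸ Int.natCast_nonneg n) hm0
  lift z to ℕ using hz0
  exact ⟨z, by rw [← hz, natCast_zsmul]⟩

/-- The element `nα` of `Q₊`. -/
def PosRoot.multiple (α : PosRoot b) (n : ℕ) : Qplus b :=
  ⟨n • α.root, nsmul_mem α.root_mem_Qplus n⟩

theorem PosRoot.multiple_injective (α : PosRoot b) : Function.Injective α.multiple := by
  intro m n hmn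
  have h : m • α.root = n • α.root := congrArg Subtype.val hmn
  rw [← Nat.cast_smul_eq_nsmul ℂ, ← Nat.cast_smul_eq_nsmul ℂ] at h
  exact_mod_cast smul_left_injective ℂ α.root_ne_zero h

section Support

variable {α : PosRoot b} {J : YYSeries κ b ħ} {Jc : Qplus b → YYSeries κ b ħ}
  (hJ : IsDecomposition J Jc)
include hJ

theorem IsDecomposition.support_multiple_finite (n : ℕ) :
    {k | PowerSeries.coeff n (Jc (α.multiple k)) ≠ 0}.Finite :=
  (hJ.finite n).preimage α.multiple_injective.injOn

theorem IsDecomposition.coeff_eq_finsum_multiple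
    (hα : ∀ γ : Qplus b, (γ : Module.Dual ℂ H) ∉ AddSubgroup.zmultiples α.root → Jc γ = 0)
    (n : ℕ) : PowerSeries.coeff n J = ∑ᶠ k, PowerSeries.coeff n (Jc (α.multiple k)) := by
  rw [hJ.sum, ← finsum_mem_range (f := fun γ => PowerSeries.coeff n (Jc γ)) α.multiple_injective,
    finsum_mem_def]
  refine finsum_congr fun γ => ?_
  by_cases hγ : γ ∈ Set.range α.multiple
  · rw [Set.indicator_of_mem hγ]
  · rw [Set.indicator_of_notMem hγ, hα γ, map_zero]
    intro hmem
    obtain ⟨k, hk⟩ := α.exists_eq_nsmul γ.2 hmem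
    exact hγ ⟨k, Subtype.ext hk⟩

end Support

/-- A factorization into factors supported on the multiples of the positive roots yields a family
of blocks whose products satisfy the intertwining equation componentwise. -/
theorem SatisfiesIE.exists_isBlockFamily [LinearOrder (PosRoot b)] {J : PosRoot b → YYSeries κ b ħ}
    (hJ : ∀ α, HasZSupport α (J α)) (hR : SatisfiesIE x (orderedProd J)) :
    ∃ F : PosRoot b → ℕ → YYSeries κ b ħ, IsBlockFamily F ∧ SatisfiesBlockIE x (blockProduct F) := by
  choose hJ0 Jc hdec hα hone using hJ
  let F : PosRoot b → ℕ → YYSeries κ b ħ := fun α k => Jc α (α.multiple k)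
  have hF : IsBlockFamily F := by
    refine ⟨fun α n m => (hdec α).mem (α.multiple n) m, fun α => ?_⟩
    rw [← hone α]
    exact congrArg (Jc α) (Subtype.ext (zero_smul ℕ α.root))
  have hexp := coeff_orderedProd_eq_finsum (F := F) (J := J)
    (fun α n => (hdec α).support_multiple_finite n)
    (fun α n => (hdec α).coeff_eq_finsum_multiple (hα α) n)
  exact ⟨F, hF, hR.satisfiesBlockIE (coeff_blockProduct_mem_lWeight hF) (fun n => (hexp n).1)
    (fun n => (hexp n).2) fun γ hγ => blockProduct_eq_zero_of_notMem F hγ⟩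

end Factorization

theorem mainTheorem1 {L : Type*} [LieRing L] [LieAlgebra ℂ L] [FiniteDimensional ℂ L]
    [LieAlgebra.IsSemisimple ℂ L] (H : LieSubalgebra ℂ L) [H.IsCartanSubalgebra]
    (hrank : 1 < Module.finrank ℂ H)
    (κ : InvForm L) (hκ : κ.IsNormalized H)
    (b : (LieAlgebra.IsKilling.rootSystem H).Base)
    (ħ : ℂ) (hħ : ħ ≠ 0)
    (c : SimpleRootVectors κ b) (x : RootVectors c ħ)
    [LinearOrder (PosRoot b)] (hord : IsAdmissibleOrder b) :
    (∀ F : PosRoot b → ℕ → YYSeries κ b ħ, IsBlockFamily F →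
      ¬ SatisfiesBlockIE x (blockProduct F)) ∧
    (∀ R : YYSeries κ b ħ, IsLowerFactor x R →
      ¬ ∃ J : PosRoot b → YYSeries κ b ħ,
        (∀ α, HasZSupport α (J α)) ∧ R = orderedProd J) := by
  obtain ⟨αi, αj, αij, hi, hj, hij, hne, hlt, hlt'⟩ := hord
  have h : AdmissibleTriple αi αj αij := ⟨hi, hj, hij, hne, hlt, hlt'⟩
  refine ⟨fun F hF => h.not_satisfiesBlockIE hħ hF, ?_⟩
  rintro R hR ⟨J, hJ, rfl⟩
  obtain ⟨F, hF, hIE⟩ := SatisfiesIE.exists_isBlockFamily hJ hR.2.2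
  exact h.not_satisfiesBlockIE hħ hF hIE
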